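/- **Setting.** Formulas are first-order formulas in negation normal form (literals, $\land,\lor,\exists,\forall$); $\bar A$ is the de Morgan dual of $A$. *Expansion trees* $E$ and their shallow formulas $\mathrm{Sh}(E)$ are defined inductively: a literal $L$ is one, with $\mathrm{Sh}(L)=L$; $E_1\circ E_2$ for $\circ\in\{\land,\lor\}$, with $\mathrm{Sh}(E_1\circ E_2)=\mathrm{Sh}(E_1)\circ\mathrm{Sh}(E_2)$; $\exists x\,A+^{t_1}E_1\cdots+^{t_n}E_n$ with $n\ge 0$, $t_1,\dots,t_n$ pairwise distinct terms and $\mathrm{Sh}(E_i)=A[x\backslash t_i]$, with shallow formula $\exists x\,A$; and $\forall x\,A+^{\alpha}E_0$ with $\mathrm{Sh}(E_0)=A[x\backslash\alpha]$, with shallow formula $\forall x\,A$. The $+^{t_i}$ and $+^\alpha$ are called ($\exists$- and $\forall$-)expansions; each dominates the expansions in its own subtree; $\alpha$ is the eigenvariable of $+^\alpha$. The deep formula $\mathrm{Dp}(E)$ is obtained by replacing $\exists x\,A+^{t_1}E_1\cdots+^{t_n}E_n$ by $\bigvee_i\mathrm{Dp}(E_i)$ and $\forall x\,A+^\alpha E_0$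 by $\mathrm{Dp}(E_0)$. A *cut* is a pair $C=\{E_1,E_2\}$ of expansion trees with $\mathrm{Sh}(E_1)=\overline{\mathrm{Sh}(E_2)}$; its cut-formula $\mathrm{Sh}(C)$ is the one of the two shallow formulas that is positive (a positive literal, or with top symbol $\lor$ or $\exists$), and $\mathrm{Dp}(C)=\mathrm{Dp}(E_1)\land\mathrm{Dp}(E_2)$. An *expansion pre-proof* $\mathcal P=\mathcal C,\mathcal E$ consists of a finite set $\mathcal C$ of cuts with pairwise different cut-formulas and a finite set $\mathcal E$ of expansion trees of pairwise different closed formulas, such that different $\forall$-expansions in $\mathcal P$ have different eigenvariables. Its shallow sequent is $\mathrm{Sh}(\mathcal P)=\mathrm{Sh}(\mathcal E)$ and its deep sequent is $\mathrm{Dp}(\mathcal P)=\mathrm{Dp}(\mathcal E),\mathrm{Dp}(\mathcal C)$. The *dependency relation* of $\mathcal P$ is the transitive closure of the relation $<^0$ on the expansions and cuts of $\mathcal P$ in which $v<^0w$ if the term of the $\exists$-expansion $w$ contains the eigenvariable of the $\forall$-expansion $v$, or $v$ dominates $w$; $C<^0v$ if $v$ is an expansion in the cut $C$; and $v<^0C$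 if $\mathrm{Sh}(C)$ contains the eigenvariable of $v$. An *expansion proof* is an expansion pre-proof whose dependency relation is acyclic and whose deep sequent is a propositional tautology. It is *cut-free* if $\mathcal C=\emptyset$. **Substitution and merge.** Allow in addition merge nodes $E_1\sqcup E_2$ with $\mathrm{Sh}(E_1)=\mathrm{Sh}(E_2)$. A substitution $\sigma$ (mapping eigenvariables to variables) acts on trees homomorphically, except that in $(\exists x\,A+^{t_1}E_1\cdots+^{t_n}E_n)\sigma$ the subtrees $E_i\sigma$ with the same term $t_i\sigma$ are joined by $\sqcup$. Merge reduction rewrites, anywhere in a collection of cuts and trees, $L\sqcup L$ to $L$; $(E_1'\circ E_1'')\sqcup(E_2'\circ E_2'')$ to $(E_1'\sqcup E_2')\circ(E_1''\sqcup E_2'')$; $(\forall x\,A+^{\alpha_1}E_1)\sqcup(\forall x\,A+^{\alpha_2}E_2)$ to $\forall x\,A+^{\alpha_1}(E_1\sqcup E_2)$ while replacing $\alpha_2$ by $\alpha_1$ everywhere in the collection; two existential trees joined by $\sqcup$ to the tree with all the expansions of both, the subtrees of expansions with a common term being joined by $\sqcup$; two trees outside of cuts with the same shallow formula to their $\sqcup$;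 and two cuts with the same shallow formulas to the cut formed of the $\sqcup$ of their positive and the $\sqcup$ of their negative trees. The union $\cup$ of collections means a normal form of their juxtaposition under merge reduction. **Cut reduction.** The one-step relation $\mapsto$ between expansion pre-proofs is given by the rules $$\{\exists x\,A+^{t_1}E_1\cdots+^{t_n}E_n,\ \forall x\,\bar A+^\alpha E\},\mathcal P\ \mapsto\ \mathcal P\cup\Bigl\{\bigvee_{i=1}^nE_i,\ \bigwedge_{i=1}^nE\eta_i[\alpha\backslash t_i]\Bigr\}\cup\bigcup_{i=1}^n\mathcal P\eta_i[\alpha\backslash t_i],$$ $$\{E_1\lor E_2,\ E_1'\land E_2'\},\mathcal P\ \mapsto\ \{E_1,E_1'\}\cup\{E_2,E_2'\}\cup\mathcal P,\qquad \{A,\bar A\},\mathcal P\ \mapsto\ \mathcal P\ \text{ for an atom } A,$$ where $\eta_1,\dots,\eta_n$ rename the eigenvariables of $\mathcal P,E$ to pairwise different fresh variables, and where for $n=0$ the first rule just deletes the cut. Let $\rightarrow$ be the reflexive and transitive closure of $\mapsto$. **Theorem (Weak Normalization).** For every expansion proof $\mathcal P$ there is a cut-free expansion proof $\mathcal P^*$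 with $\mathrm{Sh}(\mathcal P)=\mathrm{Sh}(\mathcal P^*)$ and $\mathcal P\rightarrow\mathcal P^*$. -/

import Mathlib

universe u v

namespace ExpansionCut

/-! ## First-order formulas in negation normal form

The free variables are the natural numbers; a formula in `NNF L n` may in addition contain the
bound variables `0, …, n - 1`, a quantifier binding the variable with the largest index (the
convention of Mathlib's `BoundedFormula`). -/

/-- Formulas in negation normal form. The literal with `b = true` is the atom `R(ts)`, the one
with `b = false` the negated atom. -/
inductive NNF (L : FirstOrder.Language.{u, v}) : ℕ → Type (max u v)
  | lit {n l : ℕ} (b : Bool) (R : L.Relations l) (ts : Fin l → L.Term (ℕ ⊕ Fin n)) : NNF L n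
  | and {n : ℕ} (A B : NNF L n) : NNF L n
  | or {n : ℕ} (A B : NNF L n) : NNF L n
  | ex {n : ℕ} (A : NNF L (n + 1)) : NNF L n
  | all {n : ℕ} (A : NNF L (n + 1)) : NNF L n

namespace NNF

variable {L : FirstOrder.Language.{u, v}}

/-- The de Morgan dual. -/
def dual : {n : ℕ} → NNF L n → NNF L n
  | _, lit b R ts => lit (!b) R ts
  | _, and A B => or A.dual B.dual
  | _, or A B => and A.dual B.dual
  | _, ex A => all A.dual
  | _, all A => ex A.dual

/-- Substitution for the free variables. -/
def subst (σ : ℕ → L.Term ℕ) : {n : ℕ} → NNF L n → NNF L n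
  | _, lit b R ts => lit b R fun i =>
      (ts i).subst (Sum.elim (fun x => (σ x).relabel Sum.inl) (fun j => FirstOrder.Language.Term.var (Sum.inr j)))
  | _, and A B => and (A.subst σ) (B.subst σ)
  | _, or A B => or (A.subst σ) (B.subst σ)
  | _, ex A => ex (A.subst σ)
  | _, all A => all (A.subst σ)

/-- Replace the outermost bound variable (the one with index `0`) by the term `t`. For
`A : NNF L 1` and a quantified formula `QxA`, this is `A[x\t]`. -/
def inst (t : L.Term ℕ) : {n : ℕ} → NNF L (n + 1) → NNF L n
  | _, lit b R ts => lit b R fun i =>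
      (ts i).subst (Sum.elim (fun x => FirstOrder.Language.Term.var (Sum.inl x))
        (Fin.cases (t.relabel Sum.inl) (fun j => FirstOrder.Language.Term.var (Sum.inr j))))
  | _, and A B => and (A.inst t) (B.inst t)
  | _, or A B => or (A.inst t) (B.inst t)
  | _, ex A => ex (A.inst t)
  | _, all A => all (A.inst t)

/-- The set of free variables. -/
def fv : {n : ℕ} → NNF L n → Set ℕ
  | _, lit _ _ ts => {x | ∃ i, x ∈ (ts i).varFinsetLeft}
  | _, and A B => A.fv ∪ B.fv
  | _, or A B => A.fv ∪ B.fv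
  | _, ex A => A.fv
  | _, all A => A.fv

/-- A formula is positive if its top connective is `∨` or `∃` or if it is a positive literal. -/
def positive : {n : ℕ} → NNF L n → Bool
  | _, lit b _ _ => b
  | _, and _ _ => false
  | _, or _ _ => true
  | _, ex _ => true
  | _, all _ => false

end NNF

/-- Quantifier-free formulas, with `bot` for the empty disjunction. -/
inductive PForm (L : FirstOrder.Language.{u, v}) : Type (max u v)
  | lit {l : ℕ} (b : Bool) (R : L.Relations l) (ts : Fin l → L.Term ℕ) : PForm L
  | bot : PForm L
  | and (A B : PForm L) : PForm L
  | or (A B : PForm L) : PForm L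

/-- Truth of a quantifier-free formula under a propositional valuation of the atoms. -/
def PForm.eval {L : FirstOrder.Language.{u, v}}
    (val : (l : ℕ) → L.Relations l → (Fin l → L.Term ℕ) → Prop) : PForm L → Prop
  | lit true R ts => val _ R ts
  | lit false R ts => ¬ val _ R ts
  | bot => False
  | and A B => A.eval val ∧ B.eval val
  | or A B => A.eval val ∨ B.eval val

/-! ## Expansion trees (with merges) -/

/-- The syntax of expansion trees with merges, subject to `ETree.WF` below.
The tree `∃x A +^{t₁} E₁ ⋯ +^{tₙ} Eₙ` is built up as in this notation, from the tree `ex A`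
without expansions (`n = 0`) by adding `+^{tᵢ} Eᵢ` one after the other on the right, where
`exp F t E` stands for `F +^t E`; `all A a E` stands for `∀x A +^a E` and `merge` for `⊔`. -/
inductive ETree (L : FirstOrder.Language.{u, v}) : Type (max u v)
  | lit {l : ℕ} (b : Bool) (R : L.Relations l) (ts : Fin l → L.Term ℕ) : ETree L
  | and (E F : ETree L) : ETree L
  | or (E F : ETree L) : ETree L
  | ex (A : NNF L 1) : ETree L
  | exp (F : ETree L) (t : L.Term ℕ) (E : ETree L) : ETree L
  | all (A : NNF L 1) (a : ℕ) (E : ETree L) : ETree L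
  | merge (E F : ETree L) : ETree L

namespace ETree

variable {L : FirstOrder.Language.{u, v}}

/-- The shallow formula. -/
def Sh : ETree L → NNF L 0
  | lit b R ts => NNF.lit b R fun i => (ts i).relabel Sum.inl
  | and E F => NNF.and E.Sh F.Sh
  | or E F => NNF.or E.Sh F.Sh
  | ex A => NNF.ex A
  | exp F _ _ => F.Sh
  | all A _ _ => NNF.all A
  | merge E _ => E.Sh

/-- The deep formula. -/
def Dp : ETree L → PForm L
  | lit b R ts => PForm.lit b R ts
  | and E F => PForm.and E.Dp F.Dp
  | or E F => PForm.or E.Dp F.Dp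
  | ex _ => PForm.bot
  | exp F _ E => PForm.or F.Dp E.Dp
  | all _ _ E => E.Dp
  | merge E F => PForm.or E.Dp F.Dp

/-- `E.exBody = some A` if `E` is of the form `∃x A +^{t₁} E₁ ⋯ +^{tₙ} Eₙ`. -/
def exBody : ETree L → Option (NNF L 1)
  | ex A => some A
  | exp F _ _ => F.exBody
  | _ => none

/-- The list `(t₁, E₁), …, (tₙ, Eₙ)` for a tree `∃x A +^{t₁} E₁ ⋯ +^{tₙ} Eₙ`. -/
def expansions : ETree L → List (L.Term ℕ × ETree L)
  | exp F t E => F.expansions ++ [(t, E)]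
  | _ => []

/-- The expansion terms `t₁, …, tₙ` of a tree `∃x A +^{t₁} E₁ ⋯ +^{tₙ} Eₙ`. -/
def terms (E : ETree L) : List (L.Term ℕ) := E.expansions.map Prod.fst

/-- `E` is an expansion tree (without merges). -/
def WF : ETree L → Prop
  | lit _ _ _ => True
  | and E F => E.WF ∧ F.WF
  | or E F => E.WF ∧ F.WF
  | ex _ => True
  | exp F t E => F.WF ∧ E.WF ∧ t ∉ F.terms ∧ ∃ A, F.exBody = some A ∧ E.Sh = A.inst t
  | all A a E => E.WF ∧ E.Sh = A.inst (FirstOrder.Language.Term.var a)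
  | merge _ _ => False

/-- The eigenvariables, one for each `∀`-expansion. -/
def EV : ETree L → Multiset ℕ
  | lit _ _ _ => 0
  | and E F => E.EV + F.EV
  | or E F => E.EV + F.EV
  | ex _ => 0
  | exp F _ E => F.EV + E.EV
  | all _ a E => a ::ₘ E.EV
  | merge E F => E.EV + F.EV

/-- All variables that occur (as eigenvariables or free in a term or formula). -/
def vars : ETree L → Set ℕ
  | lit _ _ ts => {x | ∃ i, x ∈ (ts i).varFinset}
  | and E F => E.vars ∪ F.vars
  | or E F => E.vars ∪ F.vars
  | ex A => A.fv
  | exp F t E => F.vars ∪ {x | x ∈ t.varFinset} ∪ E.vars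
  | all A a E => A.fv ∪ {a} ∪ E.vars
  | merge E F => E.vars ∪ F.vars

open Classical in
/-- Replace the subtree `G` of the expansion `+^t G` of `F` by `G ⊔ E`. -/
noncomputable def absorb : ETree L → L.Term ℕ → ETree L → ETree L
  | exp F s G, t, E => if s = t then exp F s (merge G E) else exp (F.absorb t E) s G
  | F, _, _ => F

open Classical in
/-- Add the expansion `+^t E` to `F`, with a merge node if `F` already has an expansion with
the term `t`. -/
noncomputable def addExp (F : ETree L) (t : L.Term ℕ) (E : ETree L) : ETree L :=
  if t ∈ F.terms then F.absorb t E else exp F t E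

/-- The variable `aσ`, for a substitution `σ` that maps `a` to a variable (the only case in
which a substitution is applied to a tree with eigenvariable `a`). -/
def substVar (σ : ℕ → L.Term ℕ) (a : ℕ) : ℕ :=
  match σ a with
  | FirstOrder.Language.Term.var b => b
  | _ => a

/-- Substitution: subtrees of `∃`-expansions whose terms become equal are joined by `⊔`. -/
noncomputable def subst (σ : ℕ → L.Term ℕ) : ETree L → ETree L
  | lit b R ts => lit b R fun i => (ts i).subst σ
  | and E F => and (E.subst σ) (F.subst σ)
  | or E F => or (E.subst σ) (F.subst σ)
  | ex A => ex (A.subst σ)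
  | exp F t E => (F.subst σ).addExp (t.subst σ) (E.subst σ)
  | all A a E => all (A.subst σ) (substVar σ a) (E.subst σ)
  | merge E F => merge (E.subst σ) (F.subst σ)

/-- Add all the expansions of the second tree to the first: expansions with a common term get
the subtree `E₁ ⊔ E₂`, all others are kept. -/
noncomputable def unionEx (E : ETree L) : ETree L → ETree L
  | exp F t G => (E.unionEx F).addExp t G
  | _ => E

/-- The subtree at a position. At a binary node (and at `F +^t E`) `false` leads to the first
and `true` to the second component; at `∀x A +^a E`, `true` leads to `E`. -/
def sub : ETree L → List Bool → Option (ETree L)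
  | E, [] => some E
  | and E _, false :: p => E.sub p
  | and _ F, true :: p => F.sub p
  | or E _, false :: p => E.sub p
  | or _ F, true :: p => F.sub p
  | exp F _ _, false :: p => F.sub p
  | exp _ _ E, true :: p => E.sub p
  | all _ _ E, true :: p => E.sub p
  | merge E _, false :: p => E.sub p
  | merge _ F, true :: p => F.sub p
  | _, _ :: _ => none

/-- `E₁ ∨ (E₂ ∨ ⋯)` for a non-empty list. -/
def bigOr (E : ETree L) : List (ETree L) → ETree L
  | [] => E
  | F :: l => or E (bigOr F l)

/-- `E₁ ∧ (E₂ ∧ ⋯)` for a non-empty list. -/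
def bigAnd (E : ETree L) : List (ETree L) → ETree L
  | [] => E
  | F :: l => and E (bigAnd F l)

/-- Closure of a relation on trees under contexts: `Ctx R (D[E]) (D[E'])` if `R E E'`. -/
inductive Ctx (R : ETree L → ETree L → Prop) : ETree L → ETree L → Prop
  | hole {E E'} : R E E' → Ctx R E E'
  | and_left {E E'} (F) : Ctx R E E' → Ctx R (and E F) (and E' F)
  | and_right {F F'} (E) : Ctx R F F' → Ctx R (and E F) (and E F')
  | or_left {E E'} (F) : Ctx R E E' → Ctx R (or E F) (or E' F)
  | or_right {F F'} (E) : Ctx R F F' → Ctx R (or E F) (or E F')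
  | exp_left {F F'} (t E) : Ctx R F F' → Ctx R (exp F t E) (exp F' t E)
  | exp_right {E E'} (F t) : Ctx R E E' → Ctx R (exp F t E) (exp F t E')
  | all {E E'} (A a) : Ctx R E E' → Ctx R (all A a E) (all A a E')
  | merge_left {E E'} (F) : Ctx R E E' → Ctx R (merge E F) (merge E' F)
  | merge_right {F F'} (E) : Ctx R F F' → Ctx R (merge E F) (merge E F')

/-- The merge reductions that do not involve a renaming of variables. -/
inductive LocalRule : ETree L → ETree L → Prop
  | lit {l : ℕ} (b : Bool) (R : L.Relations l) (ts : Fin l → L.Term ℕ) :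
      LocalRule (merge (lit b R ts) (lit b R ts)) (lit b R ts)
  | and (E₁ F₁ E₂ F₂ : ETree L) :
      LocalRule (merge (and E₁ F₁) (and E₂ F₂)) (and (merge E₁ E₂) (merge F₁ F₂))
  | or (E₁ F₁ E₂ F₂ : ETree L) :
      LocalRule (merge (or E₁ F₁) (or E₂ F₂)) (or (merge E₁ E₂) (merge F₁ F₂))
  | ex (E₁ E₂ : ETree L) (A : NNF L 1) : E₁.exBody = some A → E₂.exBody = some A →
      LocalRule (merge E₁ E₂) (E₁.unionEx E₂)

/-- The local part of the merge reduction of `(∀x A +^a E₁) ⊔ (∀x A +^b E₂)`; it comes with the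
global renaming of `b` to `a`. -/
inductive AllRule (a b : ℕ) : ETree L → ETree L → Prop
  | all (A : NNF L 1) (E₁ E₂ : ETree L) :
      AllRule a b (merge (all A a E₁) (all A b E₂)) (all A a (merge E₁ E₂))

end ETree

/-- The substitution `[a\t]`. -/
def single {L : FirstOrder.Language.{u, v}} (a : ℕ) (t : L.Term ℕ) : ℕ → L.Term ℕ :=
  Function.update FirstOrder.Language.Term.var a t

/-! ## Cuts and expansion pre-proofs -/

/-- A cut as an ordered pair, the first component being the positive one. -/
abbrev Cut (L : FirstOrder.Language.{u, v}) : Type (max u v) := ETree L × ETree L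

/-- The cut `{E, F}`, written with the positive tree first. -/
def mkCut {L : FirstOrder.Language.{u, v}} (E F : ETree L) : Cut L :=
  if E.Sh.positive then (E, F) else (F, E)

/-- A collection of cuts and expansion trees, possibly with merges; it is an expansion pre-proof
if it satisfies `IsPreProof` below. -/
structure RawProof (L : FirstOrder.Language.{u, v}) : Type (max u v) where
  cuts : Multiset (Cut L)
  trees : Multiset (ETree L)

namespace RawProof

variable {L : FirstOrder.Language.{u, v}}

/-- The shallow sequent, to which the cuts do not contribute. -/
def Sh (P : RawProof L) : Multiset (NNF L 0) := P.trees.map ETree.Sh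

/-- The deep sequent. -/
def Dp (P : RawProof L) : Multiset (PForm L) :=
  P.trees.map ETree.Dp + P.cuts.map fun C => PForm.and C.1.Dp C.2.Dp

/-- The eigenvariables, one for each `∀`-expansion. -/
def EV (P : RawProof L) : Multiset ℕ :=
  P.trees.bind ETree.EV + P.cuts.bind fun C => C.1.EV + C.2.EV

/-- All variables that occur. -/
def vars (P : RawProof L) : Set ℕ :=
  {x | (∃ E ∈ P.trees, x ∈ E.vars) ∨ ∃ C ∈ P.cuts, x ∈ C.1.vars ∪ C.2.vars}

/-- Expansion pre-proofs (without merges). -/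
structure IsPreProof (P : RawProof L) : Prop where
  tree_wf : ∀ E ∈ P.trees, E.WF
  cut_wf : ∀ C ∈ P.cuts, C.1.WF ∧ C.2.WF
  cut_dual : ∀ C ∈ P.cuts, C.2.Sh = C.1.Sh.dual
  cut_positive : ∀ C ∈ P.cuts, C.1.Sh.positive = true
  trees_distinct : (P.trees.map ETree.Sh).Nodup
  cuts_distinct : (P.cuts.map fun C => C.1.Sh).Nodup
  regular : P.EV.Nodup
  closed : ∀ A ∈ P.Sh, A.fv = ∅

/-! ### The dependency relation -/

/-- The places where trees occur in an expansion pre-proof (in which all trees of the end-sequent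
are different, and so are all cuts). -/
inductive Root (L : FirstOrder.Language.{u, v}) : Type (max u v)
  | tree (E : ETree L) : Root L
  | pos (C : Cut L) : Root L
  | neg (C : Cut L) : Root L

/-- The tree at a place. -/
def Root.content : Root L → ETree L
  | tree E => E
  | pos C => C.1
  | neg C => C.2

/-- The place belongs to `P`. -/
def Root.In (P : RawProof L) : Root L → Prop
  | tree E => E ∈ P.trees
  | pos C => C ∈ P.cuts
  | neg C => C ∈ P.cuts

/-- Cuts, and occurrences of expansions (a place and a position in the tree at that place). -/
inductive Node (L : FirstOrder.Language.{u, v}) : Type (max u v)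
  | cut (C : Cut L) : Node L
  | expansion (r : Root L) (p : List Bool) : Node L

/-- There is a `∀`-expansion with eigenvariable `a` at this position of `P`. -/
def AllAt (P : RawProof L) (r : Root L) (p : List Bool) (a : ℕ) : Prop :=
  r.In P ∧ ∃ A E, r.content.sub p = some (ETree.all A a E)

/-- There is an `∃`-expansion with term `t` at this position of `P`. -/
def ExAt (P : RawProof L) (r : Root L) (p : List Bool) (t : L.Term ℕ) : Prop :=
  r.In P ∧ ∃ F E, r.content.sub p = some (ETree.exp F t E)

/-- There is an expansion at this position of `P`. -/
def ExpansionAt (P : RawProof L) (r : Root L) (p : List Bool) : Prop :=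
  (∃ a, P.AllAt r p a) ∨ ∃ t, P.ExAt r p t

/-- The relation `<⁰` whose transitive closure is the dependency relation. An expansion dominates
the expansions in its subtree, which is found by going to `true` from its position. -/
inductive Lt0 (P : RawProof L) : Node L → Node L → Prop
  | term {r p a s q t} : P.AllAt r p a → P.ExAt s q t → a ∈ t.varFinset →
      Lt0 P (Node.expansion r p) (Node.expansion s q)
  | dominates {r p q} : P.ExpansionAt r p → P.ExpansionAt r (p ++ true :: q) →
      Lt0 P (Node.expansion r p) (Node.expansion r (p ++ true :: q))
  | in_pos {C p} : C ∈ P.cuts → P.ExpansionAt (Root.pos C) p →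
      Lt0 P (Node.cut C) (Node.expansion (Root.pos C) p)
  | in_neg {C p} : C ∈ P.cuts → P.ExpansionAt (Root.neg C) p →
      Lt0 P (Node.cut C) (Node.expansion (Root.neg C) p)
  | cut_formula {r p a C} : P.AllAt r p a → C ∈ P.cuts → a ∈ C.1.Sh.fv →
      Lt0 P (Node.expansion r p) (Node.cut C)

/-- The dependency relation. -/
def Lt (P : RawProof L) : Node L → Node L → Prop := Relation.TransGen P.Lt0

/-- Expansion proofs: the dependency relation is acyclic and the deep sequent is a tautology. -/
structure IsProof (P : RawProof L) : Prop where
  preProof : P.IsPreProof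
  acyclic : ∀ x, ¬ P.Lt x x
  tautology : ∀ val, ∃ A ∈ P.Dp, A.eval val

/-! ### Substitution and merge -/

/-- Substitution. -/
noncomputable def subst (σ : ℕ → L.Term ℕ) (P : RawProof L) : RawProof L where
  cuts := P.cuts.map fun C => (C.1.subst σ, C.2.subst σ)
  trees := P.trees.map (ETree.subst σ)

/-- Apply a relation on expansion trees to one tree in `P`. -/
inductive InTree (R : ETree L → ETree L → Prop) : RawProof L → RawProof L → Prop
  | tree {E E'} (cuts trees) : R E E' → InTree R ⟨cuts, E ::ₘ trees⟩ ⟨cuts, E' ::ₘ trees⟩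
  | pos {E E'} (F cuts trees) : R E E' →
      InTree R ⟨(E, F) ::ₘ cuts, trees⟩ ⟨(E', F) ::ₘ cuts, trees⟩
  | neg {F F'} (E cuts trees) : R F F' →
      InTree R ⟨(E, F) ::ₘ cuts, trees⟩ ⟨(E, F') ::ₘ cuts, trees⟩

/-- One step of the merge reduction. Besides the reductions of merge nodes, it merges two trees
of the same formula and two cuts with the same formulas. (Renaming an eigenvariable can make
cut-formulas equal, so that these steps cannot be separated from the others.) -/
inductive MergeStep : RawProof L → RawProof L → Prop
  | loc {P Q} : InTree (ETree.Ctx ETree.LocalRule) P Q → MergeStep P Q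
  | all {P Q} (a b : ℕ) : InTree (ETree.Ctx (ETree.AllRule a b)) P Q →
      MergeStep P (Q.subst (single b (FirstOrder.Language.Term.var a)))
  | trees (E F : ETree L) (cuts trees) : E.Sh = F.Sh →
      MergeStep ⟨cuts, E ::ₘ F ::ₘ trees⟩ ⟨cuts, ETree.merge E F ::ₘ trees⟩
  | cuts (C D : Cut L) (cuts trees) : C.1.Sh = D.1.Sh → C.2.Sh = D.2.Sh →
      MergeStep ⟨C ::ₘ D ::ₘ cuts, trees⟩
        ⟨(ETree.merge C.1 D.1, ETree.merge C.2 D.2) ::ₘ cuts, trees⟩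

/-- `Q` is a normal form of `P` under the merge reduction. -/
def MergesTo (P Q : RawProof L) : Prop :=
  Relation.ReflTransGen MergeStep P Q ∧ ∀ Q', ¬ MergeStep Q Q'

/-! ### Cut reduction -/

/-- Renamings of the variables in `S` to pairwise different variables outside of `V`. -/
structure FreshRenamings {n : ℕ} (η : Fin n → ℕ → ℕ) (S V : Set ℕ) : Prop where
  fixed : ∀ i, ∀ x ∉ S, η i x = x
  fresh : ∀ i, ∀ x ∈ S, η i x ∉ V
  injective : ∀ i j, ∀ x ∈ S, ∀ y ∈ S, η i x = η j y → i = j ∧ x = y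

/-- The cut `{E₁ ∨ ⋯ ∨ Eₙ, F₁ ∧ ⋯ ∧ Fₙ}` for a list of pairs `(Eᵢ, Fᵢ)`; no cut for `n = 0`
(the cut between the empty disjunction and the empty conjunction). -/
def disjunctionCut : List (ETree L × ETree L) → Multiset (Cut L)
  | [] => 0
  | (E, F) :: l => {mkCut (ETree.bigOr E (l.map Prod.fst)) (ETree.bigAnd F (l.map Prod.snd))}

/-- The collection `P, {E₁ ∨ ⋯ ∨ Eₙ, Eη₁[a\t₁] ∧ ⋯ ∧ Eηₙ[a\tₙ]}, Pη₁[a\t₁], …, Pηₙ[a\tₙ]`,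
before merging, where `l` is the list of the pairs `(tᵢ, Eᵢ)`. -/
noncomputable def quantReduct (P : RawProof L) (l : List (L.Term ℕ × ETree L))
    (a : ℕ) (E : ETree L) (η : Fin l.length → ℕ → ℕ) : RawProof L where
  cuts := P.cuts +
    disjunctionCut (List.ofFn fun i : Fin l.length =>
      ((l.get i).2,
        (E.subst fun x => FirstOrder.Language.Term.var (η i x)).subst (single a (l.get i).1))) +
    ∑ i : Fin l.length,
      ((P.subst fun x => FirstOrder.Language.Term.var (η i x)).subst (single a (l.get i).1)).cuts
  trees := P.trees +
    ∑ i : Fin l.length,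
      ((P.subst fun x => FirstOrder.Language.Term.var (η i x)).subst (single a (l.get i).1)).trees

/-- The cut-reduction rules. -/
inductive CutRule : RawProof L → RawProof L → Prop
  | quant (F : ETree L) (A : NNF L 1) (a : ℕ) (E : ETree L) (cuts : Multiset (Cut L))
      (trees : Multiset (ETree L)) (η : Fin F.expansions.length → ℕ → ℕ) (Q : RawProof L) :
      F.exBody = some A →
      FreshRenamings η {x | x ∈ (⟨cuts, trees⟩ : RawProof L).EV + E.EV}
        (vars ⟨(F, ETree.all A.dual a E) ::ₘ cuts, trees⟩) →
      MergesTo (quantReduct ⟨cuts, trees⟩ F.expansions a E η) Q →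
      CutRule ⟨(F, ETree.all A.dual a E) ::ₘ cuts, trees⟩ Q
  | prop (E₁ E₂ F₁ F₂ : ETree L) (cuts : Multiset (Cut L)) (trees : Multiset (ETree L))
      (Q : RawProof L) :
      MergesTo ⟨mkCut E₁ F₁ ::ₘ mkCut E₂ F₂ ::ₘ cuts, trees⟩ Q →
      CutRule ⟨(ETree.or E₁ E₂, ETree.and F₁ F₂) ::ₘ cuts, trees⟩ Q
  | atom {l : ℕ} (R : L.Relations l) (ts : Fin l → L.Term ℕ) (cuts : Multiset (Cut L))
      (trees : Multiset (ETree L)) :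
      CutRule ⟨(ETree.lit true R ts, ETree.lit false R ts) ::ₘ cuts, trees⟩ ⟨cuts, trees⟩

/-- One step of cut reduction, as a relation between expansion pre-proofs. -/
def CutStep (P Q : RawProof L) : Prop :=
  P.IsPreProof ∧ Q.IsPreProof ∧ CutRule P Q

/-- Reduction: the reflexive and transitive closure of `CutStep`. -/
def Reduces : RawProof L → RawProof L → Prop := Relation.ReflTransGen CutStep

/-- A pre-proof without cuts. -/
def CutFree (P : RawProof L) : Prop := P.cuts = 0

end RawProof

end ExpansionCut

/-! Acyclicity of the dependency relation is replaced by a level function on variables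
(`RawProof.IsLevel`). The level of an eigenvariable must exceed the levels of all variables in the
terms on the path to it, and of all free variables of the subformula at which the path leaves the
propositional part of the shallow formula. Since only this subformula counts, splitting a
propositional cut or joining trees to a long disjunction creates no dependency between the
components. An expansion proof has levels (`IsProof.isLeveled`), and a cut-free pre-proof with
levels and a tautological deep sequent is an expansion proof (`IsLeveled.isProof`). In between only
`IsLeveled` is maintained.

Merging is controlled through occurrences `(π, p, a)`: the eigenvariable `a` at the path `p` in a
tree at the place `π`, where places consist of shallow formulas and paths record the terms of
`∃`-expansions. A merge step changes the sets of places and occurrences only by a renaming of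
variables. When two eigenvariables at the same place and path are identified, the minimum of their
levels serves for the result. As every step also removes a node, a tree or a cut, normal forms exist
(`MergeStep.spec`, `Mergeable.exists_normalForm`). In a normal form, place and path determine the
eigenvariable (`has_unique_of_normal`).

Cut reduction terminates by an induction on the maximal quantifier depth `r` of the cut-formulas
and, inside it, on the number of quantified formulas of depth `r` from which the cut-formulas are
built propositionally. Propositional cuts are reduced until all cut-formulas are existential. Then,
among the cut-formulas of depth `r`, one is reduced whose free variables reach the greatest level.
Let `K` be one more than that level, or `0` without free variables. All eigenvariables of this cut
have levels at least `K`, whereas the free variables of every cut-formula of depth `r` have levels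
below `K`. By induction on the level, merging identifies each variable of level below `K` with its
copies (`subst_copySubst`): by the induction hypothesis, place and path of the original and of the
copied occurrence become equal. Hence the copies of cuts of depth `r` merge with their originals,
the new cut has smaller depth, and the number drops (`QuantRedex.exists_progress`). The same
identification makes the new cut dual (`dual_reduct`); before merging duality can fail, since only
the universal side has been renamed. -/

namespace ExpansionCut

open FirstOrder FirstOrder.Language

/-! ### Substitution and variables in terms. -/

section Terms

variable {L : FirstOrder.Language.{u, v}} {α β γ : Type}

theorem term_subst_subst (σ : α → L.Term β) (τ : β → L.Term γ) (t : L.Term α) :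
    (t.subst σ).subst τ = t.subst fun x => (σ x).subst τ := by
  induction t with
  | var => rfl
  | func f ts ih => simp [Term.subst, ih]

theorem term_subst_relabel (g : α → β) (τ : β → L.Term γ) (t : L.Term α) :
    (t.relabel g).subst τ = t.subst fun x => τ (g x) := by
  induction t with
  | var => rfl
  | func f ts ih => simp [Term.subst, ih]

theorem term_relabel_subst (σ : α → L.Term β) (g : β → γ) (t : L.Term α) :
    (t.subst σ).relabel g = t.subst fun x => (σ x).relabel g := by
  induction t with
  | var => rfl
  | func f ts ih => simp [Term.subst, ih]

theorem term_subst_var (t : L.Term α) : t.subst Term.var = t := by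
  induction t with
  | var => rfl
  | func f ts ih => simp [Term.subst, ih]

theorem term_subst_congr [DecidableEq α] {σ τ : α → L.Term β} (t : L.Term α)
    (h : ∀ x ∈ t.varFinset, σ x = τ x) : t.subst σ = t.subst τ := by
  induction t with
  | var => exact h _ (by simp)
  | func f ts ih =>
    simp only [Term.subst, Term.func.injEq, heq_eq_eq, true_and]
    funext i
    exact ih i fun x hx => h x (by simp only [Term.varFinset, Finset.mem_biUnion]; exact ⟨i, by simp, hx⟩)

theorem term_subst_congr_left [DecidableEq α] {σ τ : α ⊕ β → L.Term γ} (t : L.Term (α ⊕ β))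
    (h : ∀ x ∈ t.varFinsetLeft, σ (Sum.inl x) = τ (Sum.inl x))
    (h' : ∀ y, σ (Sum.inr y) = τ (Sum.inr y)) : t.subst σ = t.subst τ := by
  induction t with
  | var x =>
    rcases x with x | y
    · exact h _ (by simp)
    · exact h' y
  | func f ts ih =>
    simp only [Term.subst, Term.func.injEq, heq_eq_eq, true_and]
    funext i
    exact ih i fun x hx => h x (by simp only [Term.varFinsetLeft, Finset.mem_biUnion]; exact ⟨i, by simp, hx⟩)

theorem mem_varFinset_subst [DecidableEq α] [DecidableEq β] {σ : α → L.Term β} {t : L.Term α} {y : β} :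
    y ∈ (t.subst σ).varFinset ↔ ∃ x ∈ t.varFinset, y ∈ (σ x).varFinset := by
  induction t with
  | var => simp [Term.subst]
  | func f ts ih =>
    simp only [Term.subst, Term.varFinset, Finset.mem_biUnion, Finset.mem_univ, true_and, ih]
    grind

theorem mem_varFinsetLeft_subst [DecidableEq α] [DecidableEq β] {δ : Type}
    {σ : α ⊕ γ → L.Term (β ⊕ δ)} {t : L.Term (α ⊕ γ)} {y : β}
    (h : y ∈ (t.subst σ).varFinsetLeft) :
    (∃ x ∈ t.varFinsetLeft, y ∈ (σ (Sum.inl x)).varFinsetLeft) ∨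
      ∃ z, y ∈ (σ (Sum.inr z)).varFinsetLeft := by
  induction t with
  | var x =>
    rcases x with x | z
    · exact Or.inl ⟨x, by simp, h⟩
    · exact Or.inr ⟨z, h⟩
  | func f ts ih =>
    simp only [Term.subst, Term.varFinsetLeft, Finset.mem_biUnion, Finset.mem_univ, true_and] at h ⊢
    obtain ⟨i, hi⟩ := h
    rcases ih i hi with ⟨x, hx, hy⟩ | hz
    · exact Or.inl ⟨x, ⟨i, hx⟩, hy⟩
    · exact Or.inr hz

theorem varFinsetLeft_relabel_inl [DecidableEq α] (t : L.Term α) :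
    (t.relabel (Sum.inl : α → α ⊕ β)).varFinsetLeft = t.varFinset := by
  induction t with
  | var => simp
  | func f ts ih => simp [ih]

/-- Shallow literals contain the relabelled terms of the tree; injectivity lets a shallow literal
determine its tree. -/
theorem relabel_inl_injective {t s : L.Term α}
    (h : t.relabel (Sum.inl : α → α ⊕ β) = s.relabel Sum.inl) : t = s := by
  induction t generalizing s with
  | var => cases s <;> simp_all
  | func f ts ih =>
    cases s with
    | var => simp at h
    | func g us =>
      simp only [Term.relabel, Term.func.injEq] at h
      obtain ⟨rfl, h1, h2⟩ := h
      rw [heq_eq_eq] at h1 h2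
      subst h1
      congr
      funext i
      exact ih i (congrFun h2 i)

end Terms

/-! ### Formulas: duality, substitution, instances and complexity. -/

namespace NNF

variable {L : FirstOrder.Language.{u, v}} {n : ℕ}

@[simp] theorem dual_dual (A : NNF L n) : A.dual.dual = A := by
  induction A <;> simp_all [dual]

theorem dual_subst (σ : ℕ → L.Term ℕ) (A : NNF L n) : (A.subst σ).dual = A.dual.subst σ := by
  induction A <;> simp_all [dual, subst]

@[simp] theorem fv_dual (A : NNF L n) : A.dual.fv = A.fv := by
  induction A <;> simp_all [dual, fv]

theorem positive_dual (A : NNF L n) : A.dual.positive = !A.positive := by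
  cases A <;> simp [dual, positive]

@[simp] theorem positive_subst (σ : ℕ → L.Term ℕ) (A : NNF L n) :
    (A.subst σ).positive = A.positive := by
  cases A <;> simp [subst, positive]

theorem positive_inst (t s : L.Term ℕ) (A : NNF L (n + 1)) :
    (A.inst t).positive = (A.inst s).positive := by
  cases A <;> simp [inst, positive]

theorem dual_inst {n : ℕ} (t : L.Term ℕ) (A : NNF L (n + 1)) : (A.inst t).dual = A.dual.inst t := by
  match n, A with
  | _, lit .. => simp [dual, inst]
  | _, and A B => simp [dual, inst, dual_inst t A, dual_inst t B]
  | _, or A B => simp [dual, inst, dual_inst t A, dual_inst t B]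
  | _, ex A => simp [dual, inst, dual_inst t A]
  | _, all A => simp [dual, inst, dual_inst t A]

theorem subst_subst (σ τ : ℕ → L.Term ℕ) (A : NNF L n) :
    (A.subst σ).subst τ = A.subst fun x => (σ x).subst τ := by
  induction A with
  | lit b R ts =>
    simp only [subst, lit.injEq, heq_eq_eq, true_and]
    funext i
    rw [term_subst_subst]
    congr 1
    funext x
    rcases x with x | j
    · simp [term_subst_relabel, term_relabel_subst]
    · simp [Term.subst]
  | _ => simp_all [subst]

theorem subst_congr {σ τ : ℕ → L.Term ℕ} (A : NNF L n) (h : ∀ x ∈ A.fv, σ x = τ x) :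
    A.subst σ = A.subst τ := by
  induction A with
  | lit b R ts =>
    simp only [subst, lit.injEq, heq_eq_eq, true_and]
    funext i
    refine term_subst_congr_left _ (fun x hx => ?_) (fun y => rfl)
    simp [h x ⟨i, hx⟩]
  | _ => simp_all [subst, fv]

theorem subst_var (A : NNF L n) : A.subst Term.var = A := by
  induction A with
  | lit b R ts =>
    simp only [subst, lit.injEq, heq_eq_eq, true_and]
    funext i
    conv_rhs => rw [← term_subst_var (ts i)]
    congr 1
    funext x
    rcases x with x | j <;> rfl
  | _ => simp_all [subst]

theorem subst_eq_self {σ : ℕ → L.Term ℕ} {A : NNF L n} (h : A.fv = ∅) : A.subst σ = A := by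
  rw [subst_congr A (τ := Term.var) (by simp [h]), subst_var]

theorem subst_inst {n : ℕ} (σ : ℕ → L.Term ℕ) (t : L.Term ℕ) (A : NNF L (n + 1)) :
    (A.inst t).subst σ = (A.subst σ).inst (t.subst σ) := by
  match n, A with
  | _, lit b R ts =>
    simp only [subst, inst, lit.injEq, heq_eq_eq, true_and]
    funext i
    rw [term_subst_subst, term_subst_subst]
    congr 1
    funext x
    rcases x with x | j
    · simp only [Sum.elim_inl, Term.subst, term_subst_relabel]
      induction σ x with
      | var => rfl
      | func f ts ih => simp [Term.subst, ← ih]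
    · refine Fin.cases ?_ (fun j => ?_) j
      · simp [Term.subst, term_subst_relabel, term_relabel_subst]
      · simp [Term.subst]
  | _, and A B => simp [subst, inst, subst_inst σ t A, subst_inst σ t B]
  | _, or A B => simp [subst, inst, subst_inst σ t A, subst_inst σ t B]
  | _, ex A => simp [subst, inst, subst_inst σ t A]
  | _, all A => simp [subst, inst, subst_inst σ t A]

theorem mem_fv_subst {σ : ℕ → L.Term ℕ} {A : NNF L n} {y : ℕ} (h : y ∈ (A.subst σ).fv) :
    ∃ x ∈ A.fv, y ∈ (σ x).varFinset := by
  induction A with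
  | lit b R ts =>
    obtain ⟨i, hi⟩ := h
    rcases mem_varFinsetLeft_subst hi with ⟨x, hx, hy⟩ | ⟨z, hz⟩
    · exact ⟨x, ⟨i, hx⟩, by simpa [varFinsetLeft_relabel_inl] using hy⟩
    · simp at hz
  | and A B ihA ihB | or A B ihA ihB =>
    rcases h with h | h
    · obtain ⟨x, hx, hy⟩ := ihA h
      exact ⟨x, Or.inl hx, hy⟩
    · obtain ⟨x, hx, hy⟩ := ihB h
      exact ⟨x, Or.inr hx, hy⟩
  | ex A ih | all A ih => exact ih h

theorem mem_fv_inst {n : ℕ} {t : L.Term ℕ} {A : NNF L (n + 1)} {y : ℕ} (h : y ∈ (A.inst t).fv) :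
    y ∈ A.fv ∨ y ∈ t.varFinset := by
  match n, A with
  | _, lit b R ts =>
    simp only [inst, fv, Set.mem_ofPred_eq] at h
    obtain ⟨i, hi⟩ := h
    rcases mem_varFinsetLeft_subst hi with ⟨x, hx, hy⟩ | ⟨z, hz⟩
    · simp only [Sum.elim_inl, Term.varFinsetLeft, Finset.mem_singleton] at hy
      subst hy
      exact Or.inl ⟨i, hx⟩
    · revert hz
      refine Fin.cases ?_ (fun j => ?_) z
      · simpa [varFinsetLeft_relabel_inl] using Or.inr
      · simp
  | _, and A B | _, or A B =>
    simp only [inst, fv, Set.mem_union] at h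
    rcases h with h | h
    · exact (mem_fv_inst h).imp Or.inl id
    · exact (mem_fv_inst h).imp Or.inr id
  | _, ex A | _, all A => 
    simp only [inst, fv] at h
    exact mem_fv_inst (A := A) h

theorem fv_finite (A : NNF L n) : A.fv.Finite := by
  induction A with
  | lit b R ts =>
    refine (Finset.finite_toSet (Finset.univ.biUnion fun i => (ts i).varFinsetLeft)).subset ?_
    intro x hx
    simpa [fv] using hx
  | and A B ihA ihB | or A B ihA ihB => exact ihA.union ihB
  | ex A ih | all A ih => exact ih

/-- The quantifier depth. -/
def qd : {n : ℕ} → NNF L n → ℕ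
  | _, lit _ _ _ => 0
  | _, and A B => max A.qd B.qd
  | _, or A B => max A.qd B.qd
  | _, ex A => A.qd + 1
  | _, all A => A.qd + 1

/-- The number of symbols. -/
def size : {n : ℕ} → NNF L n → ℕ
  | _, lit _ _ _ => 1
  | _, and A B => A.size + B.size + 1
  | _, or A B => A.size + B.size + 1
  | _, ex A => A.size + 1
  | _, all A => A.size + 1

/-- The number of quantified formulas of quantifier depth `r` from which the formula is built up
by propositional connectives. -/
def weight (r : ℕ) : {n : ℕ} → NNF L n → ℕ
  | _, lit _ _ _ => 0
  | _, and A B => A.weight r + B.weight r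
  | _, or A B => A.weight r + B.weight r
  | _, ex A => if A.qd + 1 = r then 1 else 0
  | _, all A => if A.qd + 1 = r then 1 else 0

@[simp] theorem qd_dual (A : NNF L n) : A.dual.qd = A.qd := by
  induction A <;> simp_all [dual, qd]

@[simp] theorem qd_subst (σ : ℕ → L.Term ℕ) (A : NNF L n) : (A.subst σ).qd = A.qd := by
  induction A <;> simp_all [subst, qd]

@[simp] theorem qd_inst {n : ℕ} (t : L.Term ℕ) (A : NNF L (n + 1)) : (A.inst t).qd = A.qd := by
  match n, A with
  | _, lit .. => simp [qd, inst]
  | _, and A B => simp [qd, inst, qd_inst t A, qd_inst t B]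
  | _, or A B => simp [qd, inst, qd_inst t A, qd_inst t B]
  | _, ex A => simp [qd, inst, qd_inst t A]
  | _, all A => simp [qd, inst, qd_inst t A]

@[simp] theorem size_dual (A : NNF L n) : A.dual.size = A.size := by
  induction A <;> simp_all [dual, size]

@[simp] theorem size_subst (σ : ℕ → L.Term ℕ) (A : NNF L n) : (A.subst σ).size = A.size := by
  induction A <;> simp_all [subst, size]

@[simp] theorem weight_dual (r : ℕ) (A : NNF L n) : A.dual.weight r = A.weight r := by
  induction A <;> simp_all [dual, weight]

@[simp] theorem weight_subst (r : ℕ) (σ : ℕ → L.Term ℕ) (A : NNF L n) :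
    (A.subst σ).weight r = A.weight r := by
  induction A <;> simp_all [subst, weight]

/-- Formulas of smaller depth do not contribute to the termination measure at depth `r`; this
applies to the cut that a quantifier reduction creates. -/
theorem weight_eq_zero {r : ℕ} {A : NNF L n} (h : A.qd < r) : A.weight r = 0 := by
  induction A with
  | lit => rfl
  | and A B ihA ihB | or A B ihA ihB =>
    simp only [qd, max_lt_iff] at h
    simp [weight, ihA h.1, ihB h.2]
  | ex A ih | all A ih =>
    simp only [qd] at h
    simp [weight, h.ne]

end NNF

end ExpansionCut

namespace ExpansionCut

open FirstOrder FirstOrder.Language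

/-! ## Paths -/

/-- The steps of a path in an expansion tree. -/
inductive Step (L : FirstOrder.Language.{u, v}) : Type u
  | left : Step L
  | right : Step L
  | ex (t : L.Term ℕ) : Step L
  | all : Step L

/-- A path in an expansion tree. -/
abbrev Path (L : FirstOrder.Language.{u, v}) : Type u := List (Step L)

variable {L : FirstOrder.Language.{u, v}}

/-- Substitution in a step. -/
def Step.subst (σ : ℕ → L.Term ℕ) : Step L → Step L
  | left => left
  | right => right
  | ex t => ex (t.subst σ)
  | all => all

/-- The variables in a step. -/
def Step.vars : Step L → Finset ℕ
  | ex t => t.varFinset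
  | _ => ∅

/-- Substitution in a path. -/
def Path.subst (σ : ℕ → L.Term ℕ) (p : Path L) : Path L := p.map (Step.subst σ)

/-- The variables in the terms along a path. -/
def Path.vars : Path L → Finset ℕ
  | [] => ∅
  | s :: p => s.vars ∪ Path.vars p

theorem Step.subst_subst (σ τ : ℕ → L.Term ℕ) (s : Step L) :
    (s.subst σ).subst τ = s.subst fun x => (σ x).subst τ := by
  cases s <;> simp [Step.subst, term_subst_subst]

theorem Path.subst_subst (σ τ : ℕ → L.Term ℕ) (p : Path L) :
    Path.subst τ (Path.subst σ p) = Path.subst (fun x => (σ x).subst τ) p := by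
  simp [Path.subst, Step.subst_subst]

theorem Path.subst_var (p : Path L) : Path.subst Term.var p = p := by
  induction p with
  | nil => rfl
  | cons s p ih =>
    simp only [Path.subst, List.map_cons] at ih ⊢
    rw [ih]
    cases s <;> simp [Step.subst, term_subst_var]

theorem Path.subst_congr {σ τ : ℕ → L.Term ℕ} (p : Path L)
    (h : ∀ x ∈ Path.vars p, σ x = τ x) : Path.subst σ p = Path.subst τ p := by
  induction p with
  | nil => rfl
  | cons s p ih =>
    simp only [Path.vars, Finset.mem_union] at h
    have hp := ih fun x hx => h x (Or.inr hx)
    simp only [Path.subst, List.map_cons] at hp ⊢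
    rw [hp]
    congr 1
    cases s with
    | ex t => exact congrArg Step.ex (term_subst_congr t fun x hx => h x (Or.inl hx))
    | _ => rfl

theorem Path.mem_vars_subst {σ : ℕ → L.Term ℕ} {p : Path L} {y : ℕ}
    (h : y ∈ Path.vars (Path.subst σ p)) : ∃ x ∈ Path.vars p, y ∈ (σ x).varFinset := by
  induction p with
  | nil => simp [Path.subst, Path.vars] at h
  | cons s p ih =>
    simp only [Path.subst, List.map_cons, Path.vars, Finset.mem_union] at h ih ⊢
    rcases h with h | h
    · cases s with
      | ex t =>
        obtain ⟨x, hx, hy⟩ := mem_varFinset_subst.1 h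
        exact ⟨x, Or.inl hx, hy⟩
      | _ => simp [Step.subst, Step.vars] at h
    · obtain ⟨x, hx, hy⟩ := ih h
      exact ⟨x, Or.inr hx, hy⟩

namespace NNF

/-- The subformula that is reached from the root along a path by passing only through
conjunctions and disjunctions. -/
def top {n : ℕ} : NNF L n → Path L → NNF L n
  | and A _, Step.left :: p => A.top p
  | and _ B, Step.right :: p => B.top p
  | or A _, Step.left :: p => A.top p
  | or _ B, Step.right :: p => B.top p
  | A, _ => A

theorem top_subst {n : ℕ} (σ : ℕ → L.Term ℕ) (A : NNF L n) (p : Path L) :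
    (A.subst σ).top (Path.subst σ p) = (A.top p).subst σ := by
  induction A generalizing p with
  | lit | ex | all => simp [subst, top]
  | and A B ihA ihB | or A B ihA ihB =>
    rcases p with _ | ⟨s, p⟩
    · simp [subst, top, Path.subst]
    · cases s with
      | left => simpa [subst, top, Path.subst, Step.subst] using ihA p
      | right => simpa [subst, top, Path.subst, Step.subst] using ihB p
      | _ => simp [subst, top, Path.subst, Step.subst]

theorem fv_top_subset {n : ℕ} (A : NNF L n) (p : Path L) : (A.top p).fv ⊆ A.fv := by
  induction A generalizing p with
  | lit | ex | all => simp [top]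
  | and A B ihA ihB | or A B ihA ihB =>
    rcases p with _ | ⟨s, p⟩
    · simp [top]
    · cases s with
      | left => exact (ihA p).trans Set.subset_union_left
      | right => exact (ihB p).trans Set.subset_union_right
      | _ => simp [top]

/-- The variables on which an eigenvariable depends that is introduced at the path `p` in a
tree with the shallow formula `A`. -/
def deps (A : NNF L 0) (p : Path L) : Set ℕ := {y | y ∈ Path.vars p} ∪ (A.top p).fv

/-- Substitution creates no dependencies out of nothing. Every check of levels after a renaming or
an instantiation goes back to the original through this. -/
theorem mem_deps_subst {σ : ℕ → L.Term ℕ} {A : NNF L 0} {p : Path L} {y : ℕ}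
    (h : y ∈ deps (A.subst σ) (Path.subst σ p)) : ∃ x ∈ deps A p, y ∈ (σ x).varFinset := by
  rcases h with h | h
  · obtain ⟨x, hx, hy⟩ := Path.mem_vars_subst h
    exact ⟨x, Or.inl hx, hy⟩
  · rw [top_subst] at h
    obtain ⟨x, hx, hy⟩ := mem_fv_subst h
    exact ⟨x, Or.inr hx, hy⟩

end NNF

namespace ETree

/-! ## Basic properties of trees -/

theorem Sh_of_exBody {E : ETree L} {A : NNF L 1} (h : E.exBody = some A) : E.Sh = NNF.ex A := by
  induction E with
  | ex => simpa [exBody, Sh] using h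
  | exp F t G ihF _ => exact ihF h
  | _ => simp [exBody] at h

@[simp] theorem terms_exp (F : ETree L) (t : L.Term ℕ) (E : ETree L) :
    (exp F t E).terms = F.terms ++ [t] := by
  simp [terms, expansions]

section absorb

variable {F E : ETree L} {t : L.Term ℕ}

@[simp] theorem exBody_absorb : (F.absorb t E).exBody = F.exBody := by
  induction F with
  | exp F s G ihF _ =>
    rw [absorb]
    split_ifs <;> simp [exBody, ihF]
  | _ => simp [absorb]

@[simp] theorem Sh_absorb : (F.absorb t E).Sh = F.Sh := by
  induction F with
  | exp F s G ihF _ =>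
    rw [absorb]
    split_ifs <;> simp [Sh, ihF]
  | _ => simp [absorb]

@[simp] theorem exBody_addExp : (F.addExp t E).exBody = F.exBody := by
  rw [addExp]
  split_ifs <;> simp [exBody]

@[simp] theorem Sh_addExp : (F.addExp t E).Sh = F.Sh := by
  rw [addExp]
  split_ifs <;> simp [Sh]

/-- Induction principle for `addExp`: it either adds an expansion at the end or replaces a
subtree `G` by `G ⊔ E`. -/
theorem absorb_induction {motive : ETree L → ETree L → Prop}
    (here : ∀ F G, motive (exp F t G) (exp F t (merge G E)))
    (there : ∀ F F' s G, s ≠ t → t ∈ F.terms → motive F F' → motive (exp F s G) (exp F' s G))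
    (h : t ∈ F.terms) : motive F (F.absorb t E) := by
  induction F with
  | exp F s G ihF _ =>
    rw [absorb]
    split_ifs with hs
    · subst hs
      exact here F G
    · have ht : t ∈ F.terms := by
        simp only [terms_exp, List.mem_append, List.mem_singleton] at h
        exact h.resolve_right fun h' => hs h'.symm
      exact there F _ s G hs ht (ihF ht)
  | _ => simp [terms, expansions] at h

theorem EV_addExp : (F.addExp t E).EV = F.EV + E.EV := by
  rw [addExp]
  split_ifs with h
  · refine absorb_induction (motive := fun F F' => F'.EV = F.EV + E.EV) ?_ ?_ h
    · intro F G
      simp [EV, add_assoc]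
    · intro F F' s G _ _ ih
      simp only [EV, ih]
      abel
  · rfl

theorem eval_addExp (val : (l : ℕ) → L.Relations l → (Fin l → L.Term ℕ) → Prop) :
    (F.addExp t E).Dp.eval val ↔ F.Dp.eval val ∨ E.Dp.eval val := by
  rw [addExp]
  split_ifs with h
  · refine absorb_induction (motive := fun F F' =>
      (F'.Dp.eval val ↔ F.Dp.eval val ∨ E.Dp.eval val)) ?_ ?_ h
    · intro F G
      simp [Dp, PForm.eval, or_assoc]
    · intro F F' s G _ _ ih
      simp only [Dp, PForm.eval, ih]
      tauto
  · simp [Dp, PForm.eval]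

end absorb

@[simp] theorem exBody_unionEx (E F : ETree L) : (E.unionEx F).exBody = E.exBody := by
  induction F with
  | exp F t G ihF _ => simp [unionEx, ihF]
  | _ => simp [unionEx]

@[simp] theorem Sh_unionEx (E F : ETree L) : (E.unionEx F).Sh = E.Sh := by
  induction F with
  | exp F t G ihF _ => simp [unionEx, ihF]
  | _ => simp [unionEx]

theorem exBody_subst {σ : ℕ → L.Term ℕ} {E : ETree L} {A : NNF L 1} (h : E.exBody = some A) :
    (E.subst σ).exBody = some (A.subst σ) := by
  induction E with
  | ex =>
    obtain rfl := Option.some.inj h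
    rfl
  | exp F t G ihF _ => simpa [subst] using ihF h
  | _ => simp [exBody] at h

@[simp] theorem Sh_subst (σ : ℕ → L.Term ℕ) (E : ETree L) : (E.subst σ).Sh = E.Sh.subst σ := by
  induction E with
  | lit => simp [subst, Sh, NNF.subst, term_subst_relabel, term_relabel_subst]
  | exp F t G ihF _ => simp [subst, Sh, ihF]
  | _ => simp_all [subst, Sh, NNF.subst]

theorem EV_subst (σ : ℕ → L.Term ℕ) (E : ETree L) :
    (E.subst σ).EV = E.EV.map (substVar σ) := by
  induction E with
  | exp F t G ihF ihG => simp [subst, EV, EV_addExp, ihF, ihG]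
  | _ => simp_all [subst, EV]

theorem eval_subst (σ : ℕ → L.Term ℕ) (E : ETree L)
    (val : (l : ℕ) → L.Relations l → (Fin l → L.Term ℕ) → Prop) :
    (E.subst σ).Dp.eval val ↔ E.Dp.eval fun l R ts => val l R fun i => (ts i).subst σ := by
  induction E with
  | lit b => cases b <;> simp [subst, Dp, PForm.eval]
  | exp F t G ihF ihG => simp [subst, eval_addExp, Dp, PForm.eval, ihF, ihG]
  | _ => simp_all [subst, Dp, PForm.eval]

@[simp] theorem substVar_var (ρ : ℕ → ℕ) (a : ℕ) :
    substVar (fun x => (Term.var (ρ x) : L.Term ℕ)) a = ρ a := rfl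

theorem substVar_eq {σ : ℕ → L.Term ℕ} {a b : ℕ} (h : σ a = Term.var b) : substVar σ a = b := by
  rw [substVar, h]

/-! ## The eigenvariables at a path -/

/-- The tree has at the path `p` a `∀`-expansion with the eigenvariable `a`. -/
def Has : ETree L → Path L → ℕ → Prop
  | lit _ _ _, _, _ => False
  | and E F, p, a => (∃ q, p = Step.left :: q ∧ E.Has q a) ∨ ∃ q, p = Step.right :: q ∧ F.Has q a
  | or E F, p, a => (∃ q, p = Step.left :: q ∧ E.Has q a) ∨ ∃ q, p = Step.right :: q ∧ F.Has q a
  | ex _, _, _ => False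
  | exp F t E, p, a => F.Has p a ∨ ∃ q, p = Step.ex t :: q ∧ E.Has q a
  | all _ b E, p, a => (p = [] ∧ a = b) ∨ ∃ q, p = Step.all :: q ∧ E.Has q a
  | merge E F, p, a => E.Has p a ∨ F.Has p a

/-- A path names the expansion by its term, so it cannot distinguish a new expansion from a subtree
that is joined to an old one. -/
theorem has_addExp {F E : ETree L} {t : L.Term ℕ} {p : Path L} {a : ℕ} :
    (F.addExp t E).Has p a ↔ F.Has p a ∨ ∃ q, p = Step.ex t :: q ∧ E.Has q a := by
  rw [addExp]
  split_ifs with h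
  · refine absorb_induction (motive := fun F F' =>
      (F'.Has p a ↔ F.Has p a ∨ ∃ q, p = Step.ex t :: q ∧ E.Has q a)) ?_ ?_ h
    · intro F G
      simp only [Has, and_or_left, exists_or, or_assoc]
    · intro F F' s G _ _ ih
      simp only [Has, ih]
      exact or_right_comm
  · rfl

theorem has_unionEx {E F : ETree L} {A : NNF L 1} (h : F.exBody = some A) {p : Path L} {a : ℕ} :
    (E.unionEx F).Has p a ↔ E.Has p a ∨ F.Has p a := by
  induction F with
  | ex => simp [unionEx, Has]
  | exp F t G ihF _ => simp [unionEx, has_addExp, Has, ihF h, or_assoc]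
  | _ => simp [exBody] at h

theorem has_subst {σ : ℕ → L.Term ℕ} {E : ETree L} {p : Path L} {a : ℕ} :
    (E.subst σ).Has p a ↔
      ∃ q b, E.Has q b ∧ p = Path.subst σ q ∧ a = substVar σ b := by
  induction E generalizing p a with
  | lit | ex => simp [subst, Has]
  | and E F ihE ihF | or E F ihE ihF =>
    simp only [subst, Has, ihE, ihF]
    constructor
    · rintro (⟨_, rfl, q, b, h, rfl, rfl⟩ | ⟨_, rfl, q, b, h, rfl, rfl⟩)
      · exact ⟨Step.left :: q, b, Or.inl ⟨q, rfl, h⟩, rfl, rfl⟩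
      · exact ⟨Step.right :: q, b, Or.inr ⟨q, rfl, h⟩, rfl, rfl⟩
    · rintro ⟨_, b, ⟨q, rfl, h⟩ | ⟨q, rfl, h⟩, rfl, rfl⟩
      · exact Or.inl ⟨_, rfl, q, b, h, rfl, rfl⟩
      · exact Or.inr ⟨_, rfl, q, b, h, rfl, rfl⟩
  | exp F t E ihF ihE =>
    simp only [subst, has_addExp, Has, ihE, ihF]
    constructor
    · rintro (⟨q, b, h, rfl, rfl⟩ | ⟨_, rfl, q, b, h, rfl, rfl⟩)
      · exact ⟨q, b, Or.inl h, rfl, rfl⟩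
      · exact ⟨Step.ex t :: q, b, Or.inr ⟨q, rfl, h⟩, rfl, rfl⟩
    · rintro ⟨_, b, h | ⟨q, rfl, h⟩, rfl, rfl⟩
      · exact Or.inl ⟨_, b, h, rfl, rfl⟩
      · exact Or.inr ⟨_, rfl, q, b, h, rfl, rfl⟩
  | all A c E ih =>
    simp only [subst, Has, ih]
    constructor
    · rintro (⟨rfl, rfl⟩ | ⟨_, rfl, q, b, h, rfl, rfl⟩)
      · exact ⟨[], c, Or.inl ⟨rfl, rfl⟩, rfl, rfl⟩
      · exact ⟨Step.all :: q, b, Or.inr ⟨q, rfl, h⟩, rfl, rfl⟩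
    · rintro ⟨_, b, ⟨rfl, rfl⟩ | ⟨q, rfl, h⟩, rfl, rfl⟩
      · exact Or.inl ⟨rfl, rfl⟩
      · exact Or.inr ⟨_, rfl, q, b, h, rfl, rfl⟩
  | merge E F ihE ihF =>
    simp only [subst, Has, ihE, ihF, or_and_right, exists_or]

theorem mem_EV_iff {E : ETree L} {a : ℕ} : a ∈ E.EV ↔ ∃ p, E.Has p a := by
  induction E with
  | lit | ex => simp [EV, Has]
  | and E F ihE ihF | or E F ihE ihF =>
    simp only [EV, Multiset.mem_add, ihE, ihF, Has]
    grind
  | exp F t E ihF ihE =>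
    simp only [EV, Multiset.mem_add, ihE, ihF, Has]
    grind
  | all A c E ih =>
    simp only [EV, Multiset.mem_cons, ih, Has]
    grind
  | merge E F ihE ihF =>
    simp only [EV, Multiset.mem_add, ihE, ihF, Has, exists_or]

/-- Two different paths would lead to two `∀`-expansions, and `a` would be counted twice in `EV`. -/
theorem has_path_unique {E : ETree L} (h : E.EV.Nodup) {p q : Path L} {a : ℕ} (hp : E.Has p a)
    (hq : E.Has q a) : p = q := by
  induction E generalizing p q with
  | lit | ex => simp [Has] at hp
  | and E F ihE ihF | or E F ihE ihF =>
    obtain ⟨hE, hF, hd⟩ := Multiset.nodup_add.1 h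
    rw [Multiset.disjoint_left] at hd
    rcases hp with ⟨p, rfl, hp⟩ | ⟨p, rfl, hp⟩ <;> rcases hq with ⟨q, rfl, hq⟩ | ⟨q, rfl, hq⟩
    · rw [ihE hE hp hq]
    · exact (hd (mem_EV_iff.2 ⟨p, hp⟩) (mem_EV_iff.2 ⟨q, hq⟩)).elim
    · exact (hd (mem_EV_iff.2 ⟨q, hq⟩) (mem_EV_iff.2 ⟨p, hp⟩)).elim
    · rw [ihF hF hp hq]
  | exp E t F ihE ihF =>
    obtain ⟨hE, hF, hd⟩ := Multiset.nodup_add.1 h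
    rw [Multiset.disjoint_left] at hd
    rcases hp with hp | ⟨p, rfl, hp⟩ <;> rcases hq with hq | ⟨q, rfl, hq⟩
    · exact ihE hE hp hq
    · exact (hd (mem_EV_iff.2 ⟨p, hp⟩) (mem_EV_iff.2 ⟨q, hq⟩)).elim
    · exact (hd (mem_EV_iff.2 ⟨q, hq⟩) (mem_EV_iff.2 ⟨p, hp⟩)).elim
    · rw [ihF hF hp hq]
  | all A c E ih =>
    obtain ⟨hc, hE⟩ := Multiset.nodup_cons.1 h
    rcases hp with ⟨rfl, rfl⟩ | ⟨p, rfl, hp⟩ <;> rcases hq with ⟨rfl, hq⟩ | ⟨q, rfl, hq⟩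
    · rfl
    · exact (hc (mem_EV_iff.2 ⟨q, hq⟩)).elim
    · exact (hc (mem_EV_iff.2 ⟨p, hq ▸ hp⟩)).elim
    · rw [ih hE hp hq]
  | merge E F ihE ihF =>
    obtain ⟨hE, hF, hd⟩ := Multiset.nodup_add.1 h
    rw [Multiset.disjoint_left] at hd
    rcases hp with hp | hp <;> rcases hq with hq | hq
    · exact ihE hE hp hq
    · exact (hd (mem_EV_iff.2 ⟨p, hp⟩) (mem_EV_iff.2 ⟨q, hq⟩)).elim
    · exact (hd (mem_EV_iff.2 ⟨q, hq⟩) (mem_EV_iff.2 ⟨p, hp⟩)).elim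
    · exact ihF hF hp hq

theorem mem_terms_of_has {F : ETree L} {A : NNF L 1} (h : F.exBody = some A) {p : Path L} {a : ℕ}
    (hp : F.Has p a) : ∃ t q, p = Step.ex t :: q ∧ t ∈ F.terms := by
  induction F with
  | ex => simp [Has] at hp
  | exp F t G ihF _ =>
    rcases hp with hp | ⟨q, rfl, _⟩
    · obtain ⟨s, q, rfl, hs⟩ := ihF h hp
      exact ⟨s, q, rfl, by simp [hs]⟩
    · exact ⟨t, q, rfl, by simp⟩
  | _ => simp [exBody] at h

/-- Without merges and with distinct terms at each existential tree, a path can be followed in only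
one way. -/
theorem WF.has_unique {E : ETree L} (h : E.WF) {p : Path L} {a b : ℕ} (ha : E.Has p a)
    (hb : E.Has p b) : a = b := by
  induction E generalizing p with
  | lit | ex => simp [Has] at ha
  | and E F ihE ihF | or E F ihE ihF =>
    rcases ha with ⟨p, rfl, ha⟩ | ⟨p, rfl, ha⟩ <;> rcases hb with ⟨q, hpq, hb⟩ | ⟨q, hpq, hb⟩ <;>
      simp only [List.cons.injEq, reduceCtorEq, false_and, true_and] at hpq <;> subst hpq
    · exact ihE h.1 ha hb
    · exact ihF h.2 ha hb
  | exp F t E ihF ihE =>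
    obtain ⟨hF, hE, ht, A, hA, _⟩ := h
    have key : ∀ {q c}, F.Has (Step.ex t :: q) c → False := by
      intro q c hc
      obtain ⟨s, q', hs, hs'⟩ := mem_terms_of_has hA hc
      simp only [List.cons.injEq, Step.ex.injEq] at hs
      exact ht (hs.1 ▸ hs')
    rcases ha with ha | ⟨p, rfl, ha⟩ <;> rcases hb with hb | ⟨q, hpq, hb⟩
    · exact ihF hF ha hb
    · subst hpq
      exact (key ha).elim
    · exact (key hb).elim
    · simp only [List.cons.injEq, true_and] at hpq
      subst hpq
      exact ihE hE ha hb
  | all A c E ih =>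
    rcases ha with ⟨rfl, rfl⟩ | ⟨p, rfl, ha⟩ <;> rcases hb with ⟨hp, rfl⟩ | ⟨q, hpq, hb⟩
    · rfl
    · simp at hpq
    · simp at hp
    · simp only [List.cons.injEq, true_and] at hpq
      subst hpq
      exact ih h.1 ha hb
  | merge => exact h.elim

/-! ## Well-formedness in the presence of merges -/

/-- Well-formedness of trees with merges. -/
def MWF : ETree L → Prop
  | lit _ _ _ => True
  | and E F => E.MWF ∧ F.MWF
  | or E F => E.MWF ∧ F.MWF
  | ex _ => True
  | exp F t E => F.MWF ∧ E.MWF ∧ t ∉ F.terms ∧ ∃ A, F.exBody = some A ∧ E.Sh = A.inst t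
  | all A a E => E.MWF ∧ E.Sh = A.inst (Term.var a)
  | merge E F => E.MWF ∧ F.MWF ∧ E.Sh = F.Sh

theorem WF.mwf {E : ETree L} (h : E.WF) : E.MWF := by
  induction E with
  | lit | ex => trivial
  | and E F ihE ihF | or E F ihE ihF => exact ⟨ihE h.1, ihF h.2⟩
  | exp F t E ihF ihE => exact ⟨ihF h.1, ihE h.2.1, h.2.2⟩
  | all A a E ih => exact ⟨ih h.1, h.2⟩
  | merge => exact h.elim

theorem MWF.addExp {F E : ETree L} {t : L.Term ℕ} {A : NNF L 1} (hF : F.MWF) (hE : E.MWF)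
    (hA : F.exBody = some A) (hS : E.Sh = A.inst t) : (F.addExp t E).MWF := by
  rw [ETree.addExp]
  split_ifs with h
  · have key : t ∈ F.terms → F.MWF → F.exBody = some A → (F.absorb t E).MWF := fun h =>
      (absorb_induction (t := t) (E := E) (motive := fun F F' =>
        (F.MWF → F.exBody = some A → F'.exBody = F.exBody ∧ F'.terms = F.terms ∧ F'.MWF)) (by
        rintro F G ⟨h1, h2, h3, B, h4, h5⟩ h6
        have hAB : B = A := by
          simp only [exBody] at h6
          exact Option.some.inj (h4.symm.trans h6)
        subst hAB
        exact ⟨rfl, by simp, h1, ⟨h2, hE, h5.trans hS.symm⟩, h3, B, h4, h5⟩) (by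
        rintro F F' s G _ _ ih ⟨h1, h2, h3, B, h4, h5⟩ h6
        obtain ⟨h7, h8, h9⟩ := ih h1 h6
        exact ⟨h7, by simp [h8], h9, h2, h8 ▸ h3, B, h7.trans h4, h5⟩) h · · |>.2.2)
    exact key h hF hA
  · exact ⟨hF, hE, h, A, hA, hS⟩

theorem MWF.unionEx {E F : ETree L} {A : NNF L 1} (hE : E.MWF) (hF : F.MWF)
    (hA : E.exBody = some A) (hB : F.exBody = some A) : (E.unionEx F).MWF := by
  induction F with
  | ex => exact hE
  | exp F t G ihF _ =>
    obtain ⟨h1, h2, _, B, h4, h5⟩ := hF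
    have hAB : B = A := by
      simp only [exBody] at hB
      exact Option.some.inj (h4.symm.trans hB)
    subst hAB
    exact (ihF h1 h4).addExp h2 (by simpa using hA) h5
  | _ => simp [exBody] at hB

/-- Eigenvariables have to become variables: otherwise the label of a `∀`-expansion would no longer
be the term instantiated in the shallow formula of its subtree. -/
theorem MWF.subst {σ : ℕ → L.Term ℕ} {E : ETree L} (h : E.MWF)
    (hσ : ∀ a ∈ E.EV, ∃ b, σ a = Term.var b) : (E.subst σ).MWF := by
  induction E with
  | lit | ex => trivial
  | and E F ihE ihF | or E F ihE ihF =>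
    simp only [EV, Multiset.mem_add] at hσ
    exact ⟨ihE h.1 fun a ha => hσ a (Or.inl ha), ihF h.2 fun a ha => hσ a (Or.inr ha)⟩
  | exp F t E ihF ihE =>
    simp only [EV, Multiset.mem_add] at hσ
    obtain ⟨h1, h2, _, A, h4, h5⟩ := h
    exact (ihF h1 fun a ha => hσ a (Or.inl ha)).addExp (ihE h2 fun a ha => hσ a (Or.inr ha))
      (exBody_subst h4) (by rw [Sh_subst, h5, NNF.subst_inst])
  | all A a E ih =>
    simp only [EV, Multiset.mem_cons] at hσ
    obtain ⟨b, hb⟩ := hσ a (Or.inl rfl)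
    refine ⟨ih h.1 fun a ha => hσ a (Or.inr ha), ?_⟩
    rw [Sh_subst, h.2, NNF.subst_inst, substVar_eq hb]
    simp [Term.subst, hb]
  | merge E F ihE ihF =>
    simp only [EV, Multiset.mem_add] at hσ
    exact ⟨ihE h.1 fun a ha => hσ a (Or.inl ha), ihF h.2.1 fun a ha => hσ a (Or.inr ha),
      by simp [h.2.2]⟩

end ETree

end ExpansionCut

namespace ExpansionCut

open FirstOrder FirstOrder.Language

variable {L : FirstOrder.Language.{u, v}}

namespace ETree

/-! ## Merge reduction of trees -/

/-- The relation only rewrites merge nodes. -/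
def MergeHeaded (R : ETree L → ETree L → Prop) : Prop :=
  ∀ E E', R E E' → (∃ F G, E = merge F G) ∧ E'.Sh = E.Sh

theorem mergeHeaded_localRule : MergeHeaded (LocalRule (L := L)) := by
  rintro _ _ (_ | _ | _ | ⟨_, _, _, hA, hB⟩)
  · exact ⟨⟨_, _, rfl⟩, rfl⟩
  · exact ⟨⟨_, _, rfl⟩, rfl⟩
  · exact ⟨⟨_, _, rfl⟩, rfl⟩
  · exact ⟨⟨_, _, rfl⟩, by simp [Sh]⟩

theorem mergeHeaded_allRule (a b : ℕ) : MergeHeaded (AllRule (L := L) a b) := by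
  rintro _ _ ⟨⟩
  exact ⟨⟨_, _, rfl⟩, rfl⟩

section Ctx

variable {R : ETree L → ETree L → Prop} {E E' : ETree L}

theorem Ctx.Sh_eq (hR : MergeHeaded R) (h : Ctx R E E') : E'.Sh = E.Sh := by
  induction h with
  | hole h => exact (hR _ _ h).2
  | _ => simp_all [Sh]

/-- The spine of an existential tree contains no merge node, so every rewriting takes place inside
the subtrees of its expansions. -/
theorem Ctx.exBody_eq (hR : MergeHeaded R) (h : Ctx R E E') {A : NNF L 1}
    (hA : E.exBody = some A) : E'.exBody = some A ∧ E'.terms = E.terms := by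
  induction h with
  | hole h =>
    obtain ⟨⟨F, G, rfl⟩, _⟩ := hR _ _ h
    simp [exBody] at hA
  | exp_left t G h ih =>
    obtain ⟨h1, h2⟩ := ih hA
    exact ⟨h1, by simp [h2]⟩
  | exp_right F t h ih => exact ⟨hA, by simp⟩
  | _ => simp [exBody] at hA

end Ctx

/-- The number of nodes other than merges. -/
def nodes : ETree L → ℕ
  | lit _ _ _ => 1
  | and E F => E.nodes + F.nodes + 1
  | or E F => E.nodes + F.nodes + 1
  | ex _ => 1
  | exp F _ E => F.nodes + E.nodes + 1
  | all _ _ E => E.nodes + 1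
  | merge E F => E.nodes + F.nodes

theorem nodes_addExp_le (F : ETree L) (t : L.Term ℕ) (E : ETree L) :
    (F.addExp t E).nodes ≤ F.nodes + E.nodes + 1 := by
  rw [addExp]
  split_ifs with h
  · refine absorb_induction (motive := fun F F' => F'.nodes ≤ F.nodes + E.nodes + 1) ?_ ?_ h
    · intro F G
      simp only [nodes]
      omega
    · intro F F' s G _ _ ih
      simp only [nodes]
      omega
  · rfl

/-- The inequality is strict because the leaf `ex A` of the second tree disappears, even when all
its expansions are kept. -/
theorem nodes_unionEx_lt (E : ETree L) {F : ETree L} {A : NNF L 1} (h : F.exBody = some A) :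
    (E.unionEx F).nodes < E.nodes + F.nodes := by
  induction F with
  | ex => simp [unionEx, nodes]
  | exp F t G ihF _ =>
    have := nodes_addExp_le (E.unionEx F) t G
    have := ihF h
    simp only [unionEx, nodes]
    omega
  | _ => simp [exBody] at h

theorem nodes_subst_le (σ : ℕ → L.Term ℕ) (E : ETree L) : (E.subst σ).nodes ≤ E.nodes := by
  induction E with
  | exp F t G ihF ihG =>
    have := nodes_addExp_le (F.subst σ) (t.subst σ) (G.subst σ)
    simp only [subst, nodes]
    omega
  | _ => simp only [subst, nodes]; omega

section LocalRule

variable {E E' : ETree L}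

theorem EV_unionEx {F : ETree L} {A : NNF L 1} (h : F.exBody = some A) :
    (E.unionEx F).EV = E.EV + F.EV := by
  induction F with
  | ex => simp [unionEx, EV]
  | exp F t G ihF _ => simp [unionEx, EV_addExp, EV, ihF h, add_assoc]
  | _ => simp [exBody] at h

theorem eval_unionEx {F : ETree L} {A : NNF L 1} (h : F.exBody = some A)
    (val : (l : ℕ) → L.Relations l → (Fin l → L.Term ℕ) → Prop) :
    (E.unionEx F).Dp.eval val ↔ E.Dp.eval val ∨ F.Dp.eval val := by
  induction F with
  | ex => simp [unionEx, Dp, PForm.eval]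
  | exp F t G ihF _ => simp [unionEx, eval_addExp, Dp, PForm.eval, ihF h, or_assoc]
  | _ => simp [exBody] at h

theorem Ctx.nodes_lt {R : ETree L → ETree L → Prop} (hR : ∀ E E', R E E' → E'.nodes < E.nodes)
    (h : Ctx R E E') : E'.nodes < E.nodes := by
  induction h with
  | hole h => exact hR _ _ h
  | _ => simp only [nodes]; omega

theorem LocalRule.nodes_lt (h : LocalRule E E') : E'.nodes < E.nodes := by
  cases h with
  | ex _ _ A hA hB => exact nodes_unionEx_lt _ hB
  | _ => simp only [nodes]; omega

theorem AllRule.nodes_lt {a b : ℕ} (h : AllRule a b E E') : E'.nodes < E.nodes := by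
  cases h
  simp only [nodes]
  omega

theorem Ctx.eval {R : ETree L → ETree L → Prop}
    {val : (l : ℕ) → L.Relations l → (Fin l → L.Term ℕ) → Prop}
    (hR : ∀ E E', R E E' → E.Dp.eval val → E'.Dp.eval val) (h : Ctx R E E') :
    E.Dp.eval val → E'.Dp.eval val := by
  induction h with
  | hole h => exact hR _ _ h
  | all A a h ih => exact ih
  | _ =>
    simp only [Dp, PForm.eval]
    tauto

theorem LocalRule.eval {val : (l : ℕ) → L.Relations l → (Fin l → L.Term ℕ) → Prop}
    (h : LocalRule E E') : E.Dp.eval val → E'.Dp.eval val := by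
  cases h with
  | ex _ _ A hA hB => exact (eval_unionEx hB val).2
  | _ =>
    simp only [Dp, PForm.eval]
    tauto

theorem AllRule.eval {a b : ℕ} {val : (l : ℕ) → L.Relations l → (Fin l → L.Term ℕ) → Prop}
    (h : AllRule a b E E') : E.Dp.eval val → E'.Dp.eval val := by
  cases h
  exact id

theorem Ctx.EV_eq (h : Ctx LocalRule E E') : E'.EV = E.EV := by
  induction h with
  | hole h =>
    cases h with
    | ex _ _ A hA hB => exact EV_unionEx hB
    | lit => simp [EV]
    | _ =>
      simp only [EV]
      abel
  | _ => simp_all [EV]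

theorem Ctx.EV_cons {a b : ℕ} (h : Ctx (AllRule a b) E E') : E.EV = b ::ₘ E'.EV := by
  induction h with
  | hole h =>
    cases h
    simp only [EV, Multiset.cons_add, Multiset.add_cons]
  | all A a h ih => simpa only [EV, ih] using Multiset.cons_swap _ _ _
  | _ => simp_all [EV]

theorem Ctx.has_iff (h : Ctx LocalRule E E') {p : Path L} {a : ℕ} :
    E'.Has p a ↔ E.Has p a := by
  induction h generalizing p with
  | hole h =>
    cases h with
    | ex _ _ A hA hB => exact has_unionEx hB
    | lit => simp [Has]
    | _ =>
      simp only [Has, and_or_left, exists_or]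
      exact or_or_or_comm
  | _ => simp_all [Has]

/-- The local part of the rule loses exactly one occurrence, that of `b`, and leaves `a` at the very
same path. This is what makes the identification of `a` and `b` harmless for levels. -/
theorem Ctx.has_all {a b : ℕ} (h : Ctx (AllRule a b) E E') :
    ∃ p, E'.Has p a ∧ E.Has p b ∧ ∀ q c, E.Has q c ↔ E'.Has q c ∨ (q = p ∧ c = b) := by
  induction h with
  | hole h =>
    cases h
    refine ⟨[], Or.inl ⟨rfl, rfl⟩, Or.inr (Or.inl ⟨rfl, rfl⟩), fun q c => ?_⟩
    simp only [Has, and_or_left, exists_or]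
    grind
  | and_left F h ih | or_left F h ih =>
    obtain ⟨p, h1, h2, h3⟩ := ih
    refine ⟨Step.left :: p, Or.inl ⟨p, rfl, h1⟩, Or.inl ⟨p, rfl, h2⟩, fun q c => ?_⟩
    simp only [Has, h3]
    grind
  | and_right F h ih | or_right F h ih =>
    obtain ⟨p, h1, h2, h3⟩ := ih
    refine ⟨Step.right :: p, Or.inr ⟨p, rfl, h1⟩, Or.inr ⟨p, rfl, h2⟩, fun q c => ?_⟩
    simp only [Has, h3]
    grind
  | exp_left t F h ih =>
    obtain ⟨p, h1, h2, h3⟩ := ih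
    refine ⟨p, Or.inl h1, Or.inl h2, fun q c => ?_⟩
    simp only [Has, h3]
    exact or_right_comm
  | exp_right F t h ih =>
    obtain ⟨p, h1, h2, h3⟩ := ih
    refine ⟨Step.ex t :: p, Or.inr ⟨p, rfl, h1⟩, Or.inr ⟨p, rfl, h2⟩, fun q c => ?_⟩
    simp only [Has, h3]
    grind
  | all A d h ih =>
    obtain ⟨p, h1, h2, h3⟩ := ih
    refine ⟨Step.all :: p, Or.inr ⟨p, rfl, h1⟩, Or.inr ⟨p, rfl, h2⟩, fun q c => ?_⟩
    simp only [Has, h3]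
    grind
  | merge_left F h ih =>
    obtain ⟨p, h1, h2, h3⟩ := ih
    refine ⟨p, Or.inl h1, Or.inl h2, fun q c => ?_⟩
    simp only [Has, h3]
    exact or_right_comm
  | merge_right F h ih =>
    obtain ⟨p, h1, h2, h3⟩ := ih
    refine ⟨p, Or.inr h1, Or.inr h2, fun q c => ?_⟩
    simp only [Has, h3]
    exact or_assoc.symm

theorem MWF.ctx_local (hE : E.MWF) (h : Ctx LocalRule E E') : E'.MWF := by
  have hR := mergeHeaded_localRule (L := L)
  induction h with
  | hole h =>
    cases h with
    | ex _ _ A hA hB => exact hE.1.unionEx hE.2.1 hA hB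
    | lit => trivial
    | and | or =>
      obtain ⟨⟨h1, h2⟩, ⟨h3, h4⟩, h5⟩ := hE
      simp only [Sh, NNF.and.injEq, NNF.or.injEq] at h5
      exact ⟨⟨h1, h3, h5.1⟩, h2, h4, h5.2⟩
  | and_left F h ih | or_left F h ih => exact ⟨ih hE.1, hE.2⟩
  | and_right F h ih | or_right F h ih => exact ⟨hE.1, ih hE.2⟩
  | exp_left t F h ih =>
    obtain ⟨h1, h2, h3, A, h4, h5⟩ := hE
    obtain ⟨h6, h7⟩ := h.exBody_eq hR h4
    exact ⟨ih h1, h2, h7 ▸ h3, A, h6, h5⟩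
  | exp_right F t h ih =>
    obtain ⟨h1, h2, h3, A, h4, h5⟩ := hE
    exact ⟨h1, ih h2, h3, A, h4, (h.Sh_eq hR).trans h5⟩
  | all A a h ih => exact ⟨ih hE.1, (h.Sh_eq hR).trans hE.2⟩
  | merge_left F h ih => exact ⟨ih hE.1, hE.2.1, (h.Sh_eq hR).trans hE.2.2⟩
  | merge_right F h ih => exact ⟨hE.1, ih hE.2.1, hE.2.2.trans (h.Sh_eq hR).symm⟩

theorem single_isVar (a b c : ℕ) : ∃ d, single (L := L) b (Term.var a) c = Term.var d := by
  rw [single, Function.update_apply]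
  split_ifs
  · exact ⟨a, rfl⟩
  · exact ⟨c, rfl⟩

/-- The local rewriting alone may break well-formedness, since it joins trees for `A[x\a]` and
`A[x\b]`; the renaming of `b` to `a` makes their shallow formulas equal. -/
theorem MWF.ctx_all {a b : ℕ} (hE : E.MWF) (h : Ctx (AllRule a b) E E') :
    (E'.subst (single b (Term.var a))).MWF := by
  have hR := mergeHeaded_allRule (L := L) a b
  have hs : ∀ {F : ETree L}, F.MWF → (F.subst (single b (Term.var a))).MWF := fun hF =>
    hF.subst fun c _ => single_isVar a b c
  induction h with
  | hole h =>
    cases h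
    obtain ⟨⟨h1, h2⟩, ⟨h3, h4⟩, _⟩ := hE
    have ha : (single b (Term.var a) : ℕ → L.Term ℕ) a = Term.var a := by
      by_cases hab : a = b
      · subst hab
        simp [single]
      · simp [single, hab]
    have hb : (single b (Term.var a) : ℕ → L.Term ℕ) b = Term.var a := by simp [single]
    refine ⟨⟨hs h1, hs h3, ?_⟩, ?_⟩
    · simp [h2, h4, NNF.subst_inst, Term.subst, ha, hb]
    · change (ETree.subst _ _).Sh = _
      rw [substVar_eq ha, Sh_subst, Sh, h2, NNF.subst_inst]
      simp [Term.subst, ha]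
  | and_left F h ih | or_left F h ih => exact ⟨ih hE.1, hs hE.2⟩
  | and_right F h ih | or_right F h ih => exact ⟨hs hE.1, ih hE.2⟩
  | exp_left t F h ih =>
    obtain ⟨h1, h2, h3, A, h4, h5⟩ := hE
    obtain ⟨h6, h7⟩ := h.exBody_eq hR h4
    exact (ih h1).addExp (hs h2) (exBody_subst h6) (by rw [Sh_subst, h5, NNF.subst_inst])
  | exp_right F t h ih =>
    obtain ⟨h1, h2, h3, A, h4, h5⟩ := hE
    exact (hs h1).addExp (ih h2) (exBody_subst h4)
      (by rw [Sh_subst, h.Sh_eq hR, h5, NNF.subst_inst])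
  | all A c h ih =>
    obtain ⟨d, hd⟩ := single_isVar (L := L) a b c
    refine ⟨ih hE.1, ?_⟩
    rw [substVar_eq hd, Sh_subst, h.Sh_eq hR, hE.2, NNF.subst_inst]
    simp [Term.subst, hd]
  | merge_left F h ih => exact ⟨ih hE.1, hs hE.2.1, by simp [h.Sh_eq hR, hE.2.2]⟩
  | merge_right F h ih => exact ⟨hs hE.1, ih hE.2.1, by simp [h.Sh_eq hR, hE.2.2]⟩

end LocalRule

/-! ### The shape of merge-free trees, and irreducible trees. -/

theorem WF.exBody_of_Sh {E : ETree L} (h : E.WF) {A : NNF L 1} (hS : E.Sh = NNF.ex A) :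
    E.exBody = some A := by
  cases E with
  | exp F t E =>
    obtain ⟨_, _, _, B, hB, _⟩ := h
    have := Sh_of_exBody hB
    simp only [Sh] at hS
    rw [this, NNF.ex.injEq] at hS
    exact hS ▸ hB
  | ex => simpa [Sh, exBody] using hS
  | merge => exact h.elim
  | _ => simp [Sh] at hS

theorem WF.eq_all_of_Sh {E : ETree L} (h : E.WF) {A : NNF L 1} (hS : E.Sh = NNF.all A) :
    ∃ a G, E = ETree.all A a G := by
  cases E with
  | exp F t E =>
    obtain ⟨_, _, _, B, hB, _⟩ := h
    have := Sh_of_exBody hB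
    simp_all [Sh]
  | all B a G =>
    simp only [Sh, NNF.all.injEq] at hS
    exact ⟨a, G, by rw [hS]⟩
  | merge => exact h.elim
  | _ => simp [Sh] at hS

theorem WF.eq_and_of_Sh {E : ETree L} (h : E.WF) {A B : NNF L 0} (hS : E.Sh = NNF.and A B) :
    ∃ F G, E = ETree.and F G ∧ F.Sh = A ∧ G.Sh = B := by
  cases E with
  | exp F t E =>
    obtain ⟨_, _, _, B, hB, _⟩ := h
    have := Sh_of_exBody hB
    simp_all [Sh]
  | and F G =>
    simp only [Sh, NNF.and.injEq] at hS
    exact ⟨F, G, rfl, hS⟩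
  | merge => exact h.elim
  | _ => simp [Sh] at hS

theorem WF.eq_or_of_Sh {E : ETree L} (h : E.WF) {A B : NNF L 0} (hS : E.Sh = NNF.or A B) :
    ∃ F G, E = ETree.or F G ∧ F.Sh = A ∧ G.Sh = B := by
  cases E with
  | exp F t E =>
    obtain ⟨_, _, _, B, hB, _⟩ := h
    have := Sh_of_exBody hB
    simp_all [Sh]
  | or F G =>
    simp only [Sh, NNF.or.injEq] at hS
    exact ⟨F, G, rfl, hS⟩
  | merge => exact h.elim
  | _ => simp [Sh] at hS

theorem WF.eq_lit_of_Sh {E : ETree L} (h : E.WF) {l : ℕ} {b : Bool} {R : L.Relations l}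
    {ts : Fin l → L.Term ℕ}
    (hS : E.Sh = NNF.lit b R fun i => (ts i).relabel Sum.inl) : E = ETree.lit b R ts := by
  cases E with
  | exp F t E =>
    obtain ⟨_, _, _, B, hB, _⟩ := h
    have := Sh_of_exBody hB
    simp_all [Sh]
  | lit b' R' ts' =>
    simp only [Sh, NNF.lit.injEq] at hS
    obtain ⟨rfl, rfl, h2, h3⟩ := hS
    rw [heq_eq_eq] at h2 h3
    subst h2
    congr
    funext i
    exact relabel_inl_injective (congrFun h3 i)
  | merge => exact h.elim
  | _ => simp [Sh] at hS

/-- An innermost merge joins two merge-free trees with the same shallow formula. Their roots then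
have the same form, and the merge rule for that form applies. -/
theorem MWF.wf_or_step {E : ETree L} (h : E.MWF) :
    E.WF ∨ (∃ E', Ctx LocalRule E E') ∨ ∃ a b E', Ctx (AllRule a b) E E' := by
  induction E with
  | lit | ex => exact Or.inl trivial
  | and E F ihE ihF =>
    rcases ihE h.1 with hE | ⟨E', hE⟩ | ⟨a, b, E', hE⟩
    · rcases ihF h.2 with hF | ⟨E', hF⟩ | ⟨a, b, E', hF⟩
      · exact Or.inl ⟨hE, hF⟩
      · exact Or.inr (Or.inl ⟨_, .and_right _ hF⟩)
      · exact Or.inr (Or.inr ⟨a, b, _, .and_right _ hF⟩)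
    · exact Or.inr (Or.inl ⟨_, .and_left _ hE⟩)
    · exact Or.inr (Or.inr ⟨a, b, _, .and_left _ hE⟩)
  | or E F ihE ihF =>
    rcases ihE h.1 with hE | ⟨E', hE⟩ | ⟨a, b, E', hE⟩
    · rcases ihF h.2 with hF | ⟨E', hF⟩ | ⟨a, b, E', hF⟩
      · exact Or.inl ⟨hE, hF⟩
      · exact Or.inr (Or.inl ⟨_, .or_right _ hF⟩)
      · exact Or.inr (Or.inr ⟨a, b, _, .or_right _ hF⟩)
    · exact Or.inr (Or.inl ⟨_, .or_left _ hE⟩)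
    · exact Or.inr (Or.inr ⟨a, b, _, .or_left _ hE⟩)
  | exp E t F ihE ihF =>
    rcases ihE h.1 with hE | ⟨E', hE⟩ | ⟨a, b, E', hE⟩
    · rcases ihF h.2.1 with hF | ⟨E', hF⟩ | ⟨a, b, E', hF⟩
      · exact Or.inl ⟨hE, hF, h.2.2⟩
      · exact Or.inr (Or.inl ⟨_, .exp_right _ _ hF⟩)
      · exact Or.inr (Or.inr ⟨a, b, _, .exp_right _ _ hF⟩)
    · exact Or.inr (Or.inl ⟨_, .exp_left _ _ hE⟩)
    · exact Or.inr (Or.inr ⟨a, b, _, .exp_left _ _ hE⟩)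
  | all A c E ihE =>
    rcases ihE h.1 with hE | ⟨E', hE⟩ | ⟨a, b, E', hE⟩
    · exact Or.inl ⟨hE, h.2⟩
    · exact Or.inr (Or.inl ⟨_, .all _ _ hE⟩)
    · exact Or.inr (Or.inr ⟨a, b, _, .all _ _ hE⟩)
  | merge E F ihE ihF =>
    rcases ihE h.1 with hE | ⟨E', hE⟩ | ⟨a, b, E', hE⟩
    · rcases ihF h.2.1 with hF | ⟨E', hF⟩ | ⟨a, b, E', hF⟩
      · refine Or.inr ?_
        have hS := h.2.2.symm
        cases E with
        | lit b R ts =>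
          obtain rfl := hF.eq_lit_of_Sh hS
          exact Or.inl ⟨_, .hole (.lit b R ts)⟩
        | and E₁ E₂ =>
          obtain ⟨F₁, F₂, rfl, -, -⟩ := hF.eq_and_of_Sh hS
          exact Or.inl ⟨_, .hole (.and ..)⟩
        | or E₁ E₂ =>
          obtain ⟨F₁, F₂, rfl, -, -⟩ := hF.eq_or_of_Sh hS
          exact Or.inl ⟨_, .hole (.or ..)⟩
        | ex A => exact Or.inl ⟨_, .hole (.ex _ _ A rfl (hF.exBody_of_Sh hS))⟩
        | exp G t E =>
          obtain ⟨A, hA, -⟩ := hE.2.2.2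
          exact Or.inl ⟨_, .hole (.ex _ _ A hA
            (hF.exBody_of_Sh (hS.trans (Sh_of_exBody hA))))⟩
        | all A a E =>
          obtain ⟨b, G, rfl⟩ := hF.eq_all_of_Sh hS
          exact Or.inr ⟨a, b, _, .hole (.all A E G)⟩
        | merge => exact hE.elim
      · exact Or.inr (Or.inl ⟨_, .merge_right _ hF⟩)
      · exact Or.inr (Or.inr ⟨a, b, _, .merge_right _ hF⟩)
    · exact Or.inr (Or.inl ⟨_, .merge_left _ hE⟩)
    · exact Or.inr (Or.inr ⟨a, b, _, .merge_left _ hE⟩)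

end ETree

end ExpansionCut

namespace ExpansionCut

open FirstOrder FirstOrder.Language

variable {L : FirstOrder.Language.{u, v}}

/-! ## Places and occurrences of eigenvariables -/

/-- A place in a collection of cuts and trees, given by shallow formulas. -/
inductive Place (L : FirstOrder.Language.{u, v}) : Type (max u v)
  | tree (A : NNF L 0) : Place L
  | pos (A B : NNF L 0) : Place L
  | neg (A B : NNF L 0) : Place L

namespace Place

/-- The shallow formula of the trees at a place. -/
def formula : Place L → NNF L 0
  | tree A => A
  | pos A _ => A
  | neg _ B => B

/-- Substitution in a place. -/
def subst (σ : ℕ → L.Term ℕ) : Place L → Place L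
  | tree A => tree (A.subst σ)
  | pos A B => pos (A.subst σ) (B.subst σ)
  | neg A B => neg (A.subst σ) (B.subst σ)

@[simp] theorem formula_subst (σ : ℕ → L.Term ℕ) (π : Place L) :
    (π.subst σ).formula = π.formula.subst σ := by
  cases π <;> rfl

theorem subst_subst (σ τ : ℕ → L.Term ℕ) (π : Place L) :
    (π.subst σ).subst τ = π.subst fun x => (σ x).subst τ := by
  cases π <;> simp [subst, NNF.subst_subst]

theorem subst_var (π : Place L) : π.subst Term.var = π := by
  cases π <;> simp [subst, NNF.subst_var]

end Place

/-- The substitution that renames the variables. -/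
def ren (ρ : ℕ → ℕ) : ℕ → L.Term ℕ := fun x => Term.var (ρ x)

theorem single_eq_ren (a b : ℕ) :
    single b (Term.var a) = ren (L := L) (fun x => if x = b then a else x) := by
  funext x
  simp only [single, ren, Function.update_apply]
  split_ifs <;> rfl

/-- Substitution in an occurrence of an eigenvariable. -/
def occSubst (σ : ℕ → L.Term ℕ) (o : Place L × Path L × ℕ) : Place L × Path L × ℕ :=
  (o.1.subst σ, Path.subst σ o.2.1, ETree.substVar σ o.2.2)

theorem occSubst_ren_ren (ρ τ : ℕ → ℕ) (o : Place L × Path L × ℕ) :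
    occSubst (ren τ) (occSubst (ren ρ) o) = occSubst (ren (τ ∘ ρ)) o := by
  simp only [occSubst, Place.subst_subst, Path.subst_subst]
  rfl

theorem occSubst_id (o : Place L × Path L × ℕ) : occSubst (ren id) o = o := by
  have : ren (L := L) id = Term.var := rfl
  rw [occSubst, this, Place.subst_var, Path.subst_var]
  rfl

namespace RawProof

/-- The trees together with their places. -/
def roots (R : RawProof L) : Multiset (Place L × ETree L) :=
  R.trees.map (fun E => (Place.tree E.Sh, E)) +
    (R.cuts.map (fun C => (Place.pos C.1.Sh C.2.Sh, C.1)) +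
      R.cuts.map fun C => (Place.neg C.1.Sh C.2.Sh, C.2))

/-- The places at which there is a tree. -/
def places (R : RawProof L) : Set (Place L) := {π | ∃ E, (π, E) ∈ R.roots}

/-- The occurrences of eigenvariables. -/
def occs (R : RawProof L) : Set (Place L × Path L × ℕ) :=
  {o | ∃ E, (o.1, E) ∈ R.roots ∧ E.Has o.2.1 o.2.2}

theorem mem_roots {R : RawProof L} {x : Place L × ETree L} :
    x ∈ R.roots ↔ (∃ E ∈ R.trees, (Place.tree E.Sh, E) = x) ∨
      (∃ C ∈ R.cuts, (Place.pos C.1.Sh C.2.Sh, C.1) = x) ∨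
        ∃ C ∈ R.cuts, (Place.neg C.1.Sh C.2.Sh, C.2) = x := by
  simp only [roots, Multiset.mem_add, Multiset.mem_map]

theorem tree_mem_places {R : RawProof L} {A : NNF L 0} :
    Place.tree A ∈ R.places ↔ ∃ E ∈ R.trees, E.Sh = A := by
  simp [places, mem_roots]

theorem pos_mem_places {R : RawProof L} {A B : NNF L 0} :
    Place.pos A B ∈ R.places ↔ ∃ C ∈ R.cuts, C.1.Sh = A ∧ C.2.Sh = B := by
  simp [places, mem_roots]

theorem formula_of_mem_roots {R : RawProof L} {x : Place L × ETree L} (h : x ∈ R.roots) :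
    x.1.formula = x.2.Sh := by
  rcases mem_roots.1 h with ⟨_, _, rfl⟩ | ⟨_, _, rfl⟩ | ⟨_, _, rfl⟩ <;> rfl

theorem EV_eq_bind (R : RawProof L) : R.EV = R.roots.bind fun x => x.2.EV := by
  simp [EV, roots, Multiset.bind_map, Multiset.bind_add]

theorem mem_EV_iff {R : RawProof L} {a : ℕ} : a ∈ R.EV ↔ ∃ π p, (π, p, a) ∈ R.occs := by
  simp only [EV_eq_bind, Multiset.mem_bind, ETree.mem_EV_iff, occs, Prod.exists, Set.mem_ofPred_eq]
  grind

theorem occs_unique {R : RawProof L} (h : R.EV.Nodup) {π π' : Place L} {p p' : Path L} {a : ℕ}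
    (h₁ : (π, p, a) ∈ R.occs) (h₂ : (π', p', a) ∈ R.occs) : π = π' ∧ p = p' := by
  obtain ⟨E, hE, hp⟩ := h₁
  obtain ⟨E', hE', hp'⟩ := h₂
  obtain ⟨s, hs⟩ := Multiset.exists_cons_of_mem hE
  simp only at hp hp'
  rw [EV_eq_bind, hs, Multiset.cons_bind, Multiset.nodup_add] at h
  simp only at hE'
  rw [hs, Multiset.mem_cons] at hE'
  rcases hE' with hE' | hE'
  · simp only [Prod.mk.injEq] at hE'
    obtain ⟨rfl, rfl⟩ := hE'
    exact ⟨rfl, ETree.has_path_unique h.1 hp hp'⟩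
  · refine (Multiset.disjoint_left.1 h.2.2 (ETree.mem_EV_iff.2 ⟨p, hp⟩) ?_).elim
    exact Multiset.mem_bind.2 ⟨_, hE', ETree.mem_EV_iff.2 ⟨p', hp'⟩⟩

theorem roots_subst (σ : ℕ → L.Term ℕ) (R : RawProof L) :
    (R.subst σ).roots = R.roots.map fun x => (x.1.subst σ, x.2.subst σ) := by
  simp [roots, subst, Place.subst]

theorem places_subst (σ : ℕ → L.Term ℕ) (R : RawProof L) :
    (R.subst σ).places = Place.subst σ '' R.places := by
  ext π
  simp only [places, roots_subst, Multiset.mem_map, Set.mem_ofPred_eq, Set.mem_image, Prod.exists,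
    Prod.mk.injEq]
  grind

theorem occs_subst (σ : ℕ → L.Term ℕ) (R : RawProof L) :
    (R.subst σ).occs = occSubst σ '' R.occs := by
  ext ⟨π, p, a⟩
  simp only [occs, roots_subst, Multiset.mem_map, Set.mem_ofPred_eq, Set.mem_image, Prod.exists,
    Prod.mk.injEq, occSubst]
  constructor
  · rintro ⟨_, ⟨π₀, E, hE, rfl, rfl⟩, hp⟩
    obtain ⟨q, b, hq, rfl, rfl⟩ := ETree.has_subst.1 hp
    exact ⟨π₀, q, b, ⟨E, hE, hq⟩, rfl, rfl, rfl⟩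
  · rintro ⟨π₀, q, b, ⟨E, hE, hq⟩, rfl, rfl, rfl⟩
    exact ⟨_, ⟨π₀, E, hE, rfl, rfl⟩, ETree.has_subst.2 ⟨q, b, hq, rfl, rfl⟩⟩

theorem EV_subst (σ : ℕ → L.Term ℕ) (R : RawProof L) :
    (R.subst σ).EV = R.EV.map (ETree.substVar σ) := by
  simp [EV_eq_bind, roots_subst, Multiset.bind_map, Multiset.map_bind, ETree.EV_subst]

theorem eval_Dp_iff {R : RawProof L}
    {val : (l : ℕ) → L.Relations l → (Fin l → L.Term ℕ) → Prop} :
    (∃ A ∈ R.Dp, A.eval val) ↔ (∃ E ∈ R.trees, E.Dp.eval val) ∨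
      ∃ C ∈ R.cuts, C.1.Dp.eval val ∧ C.2.Dp.eval val := by
  simp only [Dp, Multiset.mem_add, Multiset.mem_map]
  constructor
  · rintro ⟨_, ⟨E, hE, rfl⟩ | ⟨C, hC, rfl⟩, h⟩
    · exact Or.inl ⟨E, hE, h⟩
    · exact Or.inr ⟨C, hC, h⟩
  · rintro (⟨E, hE, h⟩ | ⟨C, hC, h⟩)
    · exact ⟨_, Or.inl ⟨E, hE, rfl⟩, h⟩
    · exact ⟨_, Or.inr ⟨C, hC, rfl⟩, h⟩

/-- The valuation is pulled back along `σ`; joining subtrees by `⊔` is harmless because the deep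
formula of a merge is a disjunction, as is that of an existential tree. -/
theorem eval_Dp_subst (σ : ℕ → L.Term ℕ) {R : RawProof L}
    {val : (l : ℕ) → L.Relations l → (Fin l → L.Term ℕ) → Prop} :
    (∃ A ∈ (R.subst σ).Dp, A.eval val) ↔
      ∃ A ∈ R.Dp, A.eval fun l R ts => val l R fun i => (ts i).subst σ := by
  simp only [eval_Dp_iff, subst, Multiset.mem_map]
  simp [ETree.eval_subst]

/-! ## Levels of variables -/

/-- The level of every eigenvariable exceeds the levels of the variables on which it depends. -/
def IsLevel (R : RawProof L) (lev : ℕ → ℕ) : Prop :=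
  ∀ o ∈ R.occs, ∀ y ∈ o.1.formula.deps o.2.1, lev y < lev o.2.2

/-- Being at the same place and path, `a` and `b` depend on the same variables, so the minimum of
their levels still exceeds the levels of all of these. Lowering levels is no problem for other
eigenvariables that depend on `a` or `b`. -/
theorem exists_isLevel_merge {R R' : RawProof L} (hR : R.EV.Nodup) {lev : ℕ → ℕ}
    (h : R.IsLevel lev) {π : Place L} {p : Path L} {a b : ℕ} (ha : (π, p, a) ∈ R.occs)
    (hb : (π, p, b) ∈ R.occs)
    (hR' : R'.occs = occSubst (ren fun x => if x = b then a else x) '' R.occs) :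
    ∃ lev, R'.IsLevel lev := by
  refine ⟨fun x => if x = a ∨ x = b then min (lev a) (lev b) else lev x, ?_⟩
  set lev' : ℕ → ℕ := fun x => if x = a ∨ x = b then min (lev a) (lev b) else lev x with hlev
  have hren : ∀ x, lev' (if x = b then a else x) = lev' x := by
    intro x
    by_cases hx : x = b <;> simp [hlev, hx]
  have hle : ∀ x, lev' x ≤ lev x := by
    intro x
    simp only [hlev]
    split_ifs with hx
    · rcases hx with rfl | rfl <;> simp
    · rfl
  intro o' ho' y' hy'
  rw [hR'] at ho'
  obtain ⟨⟨π₁, p₁, c⟩, ho, rfl⟩ := ho'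
  simp only [occSubst, Place.formula_subst] at hy' ⊢
  obtain ⟨y, hy, hyy⟩ := NNF.mem_deps_subst hy'
  simp only [ren, Term.varFinset, Finset.mem_singleton] at hyy
  subst hyy
  change lev' (if y = b then a else y) < lev' (if c = b then a else c)
  rw [hren, hren]
  refine (hle y).trans_lt ?_
  by_cases hc : c = a ∨ c = b
  · have key : π₁ = π ∧ p₁ = p := by
      rcases hc with rfl | rfl
      · exact occs_unique hR ho ha
      · exact occs_unique hR ho hb
    obtain ⟨rfl, rfl⟩ := key
    simp only [hlev, if_pos hc]
    exact lt_min (h _ ha y hy) (h _ hb y hy)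
  · simp only [hlev, if_neg hc]
    exact h _ ho y hy

/-! ## Merging -/

/-- The properties that are invariant under merge reduction. -/
structure Mergeable (R : RawProof L) : Prop where
  wf : ∀ x ∈ R.roots, x.2.MWF
  regular : R.EV.Nodup
  positive : ∀ A B, Place.pos A B ∈ R.places → A.positive = true
  closed : ∀ A, Place.tree A ∈ R.places → A.fv = ∅
  level : ∃ lev, R.IsLevel lev
  tautology : ∀ val, ∃ A ∈ R.Dp, A.eval val

/-- `R'` has the places and the occurrences of `R`, up to a renaming of variables. -/
structure Renames (ρ : ℕ → ℕ) (R R' : RawProof L) : Prop where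
  places : R'.places = Place.subst (ren ρ) '' R.places
  occs : R'.occs = occSubst (ren ρ) '' R.occs

theorem Renames.trans {ρ τ : ℕ → ℕ} {P Q R : RawProof L} (h₁ : Renames ρ P Q)
    (h₂ : Renames τ Q R) : Renames (τ ∘ ρ) P R := by
  refine ⟨?_, ?_⟩
  · rw [h₂.places, h₁.places, Set.image_image]
    congr 1
    funext π
    exact Place.subst_subst _ _ π
  · rw [h₂.occs, h₁.occs, Set.image_image]
    congr 1
    funext o
    exact occSubst_ren_ren _ _ o

theorem Renames.of_eq {R R' : RawProof L} (h₁ : R'.places = R.places) (h₂ : R'.occs = R.occs) :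
    Renames id R R' := by
  refine ⟨?_, ?_⟩
  · have : Place.subst (ren (L := L) id) = id := funext Place.subst_var
    rw [h₁, this, Set.image_id]
  · have : occSubst (ren (L := L) id) = id := funext occSubst_id
    rw [h₂, this, Set.image_id]

theorem Renames.positive {ρ : ℕ → ℕ} {R R' : RawProof L} (h : Renames ρ R R')
    (hR : ∀ A B, Place.pos A B ∈ R.places → A.positive = true) (A B : NNF L 0)
    (hA : Place.pos A B ∈ R'.places) : A.positive = true := by
  rw [h.places] at hA
  obtain ⟨π, hπ, hA⟩ := hA
  cases π with
  | pos A₀ B₀ =>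
    simp only [Place.subst, Place.pos.injEq] at hA
    rw [← hA.1, NNF.positive_subst]
    exact hR _ _ hπ
  | _ => simp [Place.subst] at hA

/-- Closed formulas are fixed by renamings, which is why merging preserves the shallow sequent. -/
theorem Renames.tree_iff {ρ : ℕ → ℕ} {R R' : RawProof L} (h : Renames ρ R R')
    (hR : ∀ A, Place.tree A ∈ R.places → A.fv = ∅) (A : NNF L 0) :
    Place.tree A ∈ R'.places ↔ Place.tree A ∈ R.places := by
  rw [h.places]
  constructor
  · rintro ⟨π, hπ, hA⟩
    cases π with
    | tree A₀ =>
      simp only [Place.subst, Place.tree.injEq, NNF.subst_eq_self (hR _ hπ)] at hA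
      exact hA ▸ hπ
    | _ => simp [Place.subst] at hA
  · intro hA
    exact ⟨_, hA, by rw [Place.subst, NNF.subst_eq_self (hR _ hA)]⟩

/-- The measure that decreases in merge reduction. -/
def nodes (R : RawProof L) : ℕ :=
  (R.roots.map fun x => x.2.nodes).sum + Multiset.card R.trees + Multiset.card R.cuts

theorem InTree.exists_roots {S : ETree L → ETree L → Prop} (hS : ∀ E E', S E E' → E'.Sh = E.Sh)
    {P Q : RawProof L} (h : InTree S P Q) :
    ∃ π E E' s, S E E' ∧ P.roots = (π, E) ::ₘ s ∧ Q.roots = (π, E') ::ₘ s ∧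
      Multiset.card Q.trees = Multiset.card P.trees ∧
      Multiset.card Q.cuts = Multiset.card P.cuts := by
  cases h with
  | @tree E E' cuts trees h =>
    exact ⟨_, E, E', _, h, by simp [roots]; rfl, by simp [roots, hS _ _ h], by simp, by simp⟩
  | @pos E E' F cuts trees h =>
    exact ⟨_, E, E', _, h, by simp [roots]; exact Multiset.cons_swap _ _ _,
      by simp [roots, hS _ _ h]; exact Multiset.cons_swap _ _ _, by simp, by simp⟩
  | @neg E E' F cuts trees h =>
    exact ⟨_, E, E', _, h, by simp [roots]; rfl, by simp [roots, hS _ _ h], by simp, by simp⟩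

theorem InTree.eval_Dp {S : ETree L → ETree L → Prop}
    {val : (l : ℕ) → L.Relations l → (Fin l → L.Term ℕ) → Prop}
    (hS : ∀ E E', S E E' → E.Dp.eval val → E'.Dp.eval val) {P Q : RawProof L}
    (h : InTree S P Q) : (∃ A ∈ P.Dp, A.eval val) → ∃ A ∈ Q.Dp, A.eval val := by
  cases h with
  | tree _ _ h | pos _ _ _ h | neg _ _ _ h =>
    have := hS _ _ h
    simp only [eval_Dp_iff, Multiset.mem_cons, exists_eq_or_imp]
    grind

theorem nodes_subst_le (σ : ℕ → L.Term ℕ) (R : RawProof L) : (R.subst σ).nodes ≤ R.nodes := by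
  simp only [nodes, roots_subst, Multiset.map_map, Function.comp_def]
  have h : (R.roots.map fun x => (x.2.subst σ).nodes).sum ≤ (R.roots.map fun x => x.2.nodes).sum :=
    Multiset.sum_map_le_sum_map _ _ fun x _ => ETree.nodes_subst_le σ x.2
  simpa [subst] using h

/-- Places and occurrences are sets labelled by formulas, terms and eigenvariables, so they do not
notice whether two trees at one place are separate or merged. Only the rule for `∀` changes them,
namely by its renaming. -/
theorem MergeStep.spec {R R' : RawProof L} (h : MergeStep R R') (hR : R.Mergeable) :
    R'.Mergeable ∧ (∃ ρ, Renames ρ R R') ∧ R'.nodes < R.nodes := by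
  cases h with
  | loc h =>
    have hM := ETree.mergeHeaded_localRule (L := L)
    obtain ⟨π, E, E', s, hE, hs, hs', hc, hc'⟩ := h.exists_roots fun _ _ h => h.Sh_eq hM
    have hpl : R'.places = R.places := by
      ext x
      simp [places, hs, hs', exists_or]
    have hoc : R'.occs = R.occs := by
      ext ⟨x, p, a⟩
      simp only [occs, hs, hs', Multiset.mem_cons, Set.mem_ofPred_eq, or_and_right, exists_or,
        Prod.mk.injEq]
      refine or_congr ?_ Iff.rfl
      have := hE.has_iff (p := p) (a := a)
      grind
    refine ⟨⟨?_, ?_, ?_, ?_, ?_, ?_⟩, ⟨id, .of_eq hpl hoc⟩, ?_⟩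
    · intro x hx
      rw [hs', Multiset.mem_cons] at hx
      have hwf := hR.wf
      rw [hs] at hwf
      rcases hx with rfl | hx
      · exact (hwf _ (Multiset.mem_cons_self _ _)).ctx_local hE
      · exact hwf _ (Multiset.mem_cons_of_mem hx)
    · have := hR.regular
      rw [EV_eq_bind, hs, Multiset.cons_bind] at this
      rwa [EV_eq_bind, hs', Multiset.cons_bind, hE.EV_eq]
    · rw [hpl]
      exact hR.positive
    · rw [hpl]
      exact hR.closed
    · obtain ⟨lev, hlev⟩ := hR.level
      exact ⟨lev, by rw [IsLevel, hoc]; exact hlev⟩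
    · exact fun val => h.eval_Dp (fun _ _ h => h.eval fun _ _ h => h.eval) (hR.tautology val)
    · have := hE.nodes_lt fun _ _ h => h.nodes_lt
      simp only [nodes, hs, hs', hc, hc', Multiset.map_cons, Multiset.sum_cons]
      omega
  | @all _ Q a b h =>
    have hM := ETree.mergeHeaded_allRule (L := L) a b
    obtain ⟨π, E, E', s, hE, hs, hs', hc, hc'⟩ := h.exists_roots fun _ _ h => h.Sh_eq hM
    obtain ⟨p, hp, hq, hiff⟩ := hE.has_all
    have hpl : Q.places = R.places := by
      ext x
      simp [places, hs, hs', exists_or]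
    have hoc : R.occs = insert (π, p, b) Q.occs := by
      ext ⟨x, q, c⟩
      simp only [occs, hs, hs', Multiset.mem_cons, Set.mem_ofPred_eq, or_and_right, exists_or,
        Prod.mk.injEq, Set.mem_insert_iff]
      rw [← or_assoc]
      refine or_congr ?_ Iff.rfl
      have := hiff q c
      grind
    have haQ : (π, p, a) ∈ Q.occs := ⟨E', by simp [hs'], hp⟩
    have ha : (π, p, a) ∈ R.occs := by
      rw [hoc]
      exact Set.mem_insert_of_mem _ haQ
    have hb : (π, p, b) ∈ R.occs := by
      rw [hoc]
      exact Set.mem_insert _ _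
    have hren : Renames (fun x => if x = b then a else x) R
        (Q.subst (single b (Term.var a))) := by
      refine ⟨?_, ?_⟩
      · rw [places_subst, hpl, single_eq_ren]
      -- After the renaming, the lost occurrence of `b` coincides with the one of `a`, which is
      -- still there.
      · rw [occs_subst, hoc, single_eq_ren, Set.image_insert_eq, Set.insert_eq_of_mem]
        refine ⟨_, haQ, ?_⟩
        simp [occSubst, ETree.substVar, ren]
    have hEV : R.EV = b ::ₘ Q.EV := by
      rw [EV_eq_bind, EV_eq_bind, hs, hs', Multiset.cons_bind, Multiset.cons_bind, hE.EV_cons,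
        Multiset.cons_add]
    have hnd := hR.regular
    rw [hEV, Multiset.nodup_cons] at hnd
    refine ⟨⟨?_, ?_, hren.positive hR.positive, ?_, ?_, ?_⟩, ⟨_, hren⟩, ?_⟩
    · intro x hx
      rw [roots_subst, hs', Multiset.map_cons, Multiset.mem_cons] at hx
      have hwf := hR.wf
      rw [hs] at hwf
      rcases hx with rfl | hx
      · exact (hwf _ (Multiset.mem_cons_self _ _)).ctx_all hE
      · obtain ⟨y, hy, rfl⟩ := Multiset.mem_map.1 hx
        exact (hwf _ (Multiset.mem_cons_of_mem hy)).subst fun c _ => ETree.single_isVar a b c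
    · rw [EV_subst, single_eq_ren]
      -- The only `∀`-expansion with the eigenvariable `b` has been removed by the local rewriting,
      -- so the renaming moves no remaining eigenvariable.
      have : Q.EV.map (ETree.substVar (ren (L := L) fun x => if x = b then a else x)) = Q.EV := by
        conv_rhs => rw [← Multiset.map_id Q.EV]
        refine Multiset.map_congr rfl fun x hx => ?_
        have hxb : x ≠ b := fun h => hnd.1 (h ▸ hx)
        simp [ETree.substVar, ren, hxb]
      rw [this]
      exact hnd.2
    · intro A hA
      exact hR.closed A ((hren.tree_iff hR.closed A).1 hA)
    · obtain ⟨lev, hlev⟩ := hR.level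
      exact exists_isLevel_merge hR.regular hlev ha hb hren.occs
    · intro val
      rw [eval_Dp_subst]
      exact h.eval_Dp (fun _ _ h => h.eval fun _ _ h => h.eval) (hR.tautology _)
    · have := hE.nodes_lt fun _ _ h => h.nodes_lt
      refine (nodes_subst_le _ _).trans_lt ?_
      simp only [nodes, hs, hs', hc, hc', Multiset.map_cons, Multiset.sum_cons]
      omega
  | trees E F cuts trees hS =>
    obtain ⟨s, hs, hs'⟩ : ∃ s, RawProof.roots ⟨cuts, E ::ₘ F ::ₘ trees⟩ =
          (Place.tree E.Sh, E) ::ₘ (Place.tree E.Sh, F) ::ₘ s ∧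
        RawProof.roots ⟨cuts, E.merge F ::ₘ trees⟩ = (Place.tree E.Sh, E.merge F) ::ₘ s :=
      ⟨_, by simp [roots, hS]; rfl, by simp [roots, ETree.Sh, hS]⟩
    have hpl : RawProof.places ⟨cuts, E.merge F ::ₘ trees⟩ =
        RawProof.places ⟨cuts, E ::ₘ F ::ₘ trees⟩ := by
      ext x
      simp [places, hs, hs', exists_or]
    have hoc : RawProof.occs ⟨cuts, E.merge F ::ₘ trees⟩ =
        RawProof.occs ⟨cuts, E ::ₘ F ::ₘ trees⟩ := by
      ext ⟨x, p, a⟩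
      simp only [occs, hs, hs', Multiset.mem_cons, Set.mem_ofPred_eq, or_and_right, exists_or,
        Prod.mk.injEq]
      rw [← or_assoc]
      refine or_congr ?_ Iff.rfl
      simp [ETree.Has]
      grind
    have hwf := hR.wf
    rw [hs] at hwf
    refine ⟨⟨?_, ?_, ?_, ?_, ?_, ?_⟩, ⟨id, .of_eq hpl hoc⟩, ?_⟩
    · intro x hx
      rw [hs', Multiset.mem_cons] at hx
      rcases hx with rfl | hx
      · exact ⟨hwf (Place.tree E.Sh, E) (by simp), hwf (Place.tree E.Sh, F) (by simp), hS⟩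
      · exact hwf _ (by simp [hx])
    · have := hR.regular
      rw [EV_eq_bind, hs] at this
      rw [EV_eq_bind, hs']
      simpa [ETree.EV, add_assoc] using this
    · rw [hpl]
      exact hR.positive
    · rw [hpl]
      exact hR.closed
    · obtain ⟨lev, hlev⟩ := hR.level
      exact ⟨lev, by rw [IsLevel, hoc]; exact hlev⟩
    · intro val
      have := hR.tautology val
      simp only [eval_Dp_iff, Multiset.mem_cons, exists_eq_or_imp, ETree.Dp, PForm.eval] at this ⊢
      grind
    · simp [nodes, hs, hs', ETree.nodes, add_assoc]
  | cuts C D cuts trees hS hS' =>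
    obtain ⟨E, F⟩ := C
    obtain ⟨E', F'⟩ := D
    simp only at hS hS'
    obtain ⟨s, hs, hs'⟩ : ∃ s, RawProof.roots ⟨(E, F) ::ₘ (E', F') ::ₘ cuts, trees⟩ =
          (Place.neg E.Sh F.Sh, F) ::ₘ (Place.neg E.Sh F.Sh, F') ::ₘ
            (Place.pos E.Sh F.Sh, E) ::ₘ (Place.pos E.Sh F.Sh, E') ::ₘ s ∧
        RawProof.roots ⟨(E.merge E', F.merge F') ::ₘ cuts, trees⟩ =
          (Place.neg E.Sh F.Sh, F.merge F') ::ₘ (Place.pos E.Sh F.Sh, E.merge E') ::ₘ s :=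
      ⟨_, by simp [roots, hS, hS']; rfl, by simp [roots, ETree.Sh, hS, hS']⟩
    have hpl : RawProof.places ⟨(E.merge E', F.merge F') ::ₘ cuts, trees⟩ =
        RawProof.places ⟨(E, F) ::ₘ (E', F') ::ₘ cuts, trees⟩ := by
      ext x
      simp [places, hs, hs', exists_or]
    have hoc : RawProof.occs ⟨(E.merge E', F.merge F') ::ₘ cuts, trees⟩ =
        RawProof.occs ⟨(E, F) ::ₘ (E', F') ::ₘ cuts, trees⟩ := by
      ext ⟨x, p, a⟩
      simp only [occs, hs, hs', Multiset.mem_cons, Set.mem_ofPred_eq, or_and_right, exists_or,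
        Prod.mk.injEq]
      rw [← or_assoc, ← or_assoc, ← or_assoc, ← or_assoc]
      refine or_congr ?_ Iff.rfl
      simp [ETree.Has]
      grind
    have hwf := hR.wf
    rw [hs] at hwf
    refine ⟨⟨?_, ?_, ?_, ?_, ?_, ?_⟩, ⟨id, .of_eq hpl hoc⟩, ?_⟩
    · intro x hx
      rw [hs', Multiset.mem_cons, Multiset.mem_cons] at hx
      rcases hx with rfl | rfl | hx
      · exact ⟨hwf (Place.neg E.Sh F.Sh, F) (by simp), hwf (Place.neg E.Sh F.Sh, F') (by simp), hS'⟩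
      · exact ⟨hwf (Place.pos E.Sh F.Sh, E) (by simp), hwf (Place.pos E.Sh F.Sh, E') (by simp), hS⟩
      · exact hwf _ (by simp [hx])
    · have := hR.regular
      rw [EV_eq_bind, hs] at this
      rw [EV_eq_bind, hs']
      simpa [ETree.EV, add_assoc] using this
    · rw [hpl]
      exact hR.positive
    · rw [hpl]
      exact hR.closed
    · obtain ⟨lev, hlev⟩ := hR.level
      exact ⟨lev, by rw [IsLevel, hoc]; exact hlev⟩
    · intro val
      have := hR.tautology val
      simp only [eval_Dp_iff, Multiset.mem_cons, exists_eq_or_imp, ETree.Dp, PForm.eval] at this ⊢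
      grind
    · simp [nodes, hs, hs', ETree.nodes, add_assoc]

theorem Mergeable.exists_normalForm {R : RawProof L} (hR : R.Mergeable) :
    ∃ Q ρ, MergesTo R Q ∧ Q.Mergeable ∧ Renames ρ R Q := by
  induction hn : R.nodes using Nat.strong_induction_on generalizing R with
  | _ n ih =>
    by_cases h : ∃ R', MergeStep R R'
    · obtain ⟨R', h⟩ := h
      obtain ⟨hR', ⟨ρ, hρ⟩, hlt⟩ := h.spec hR
      obtain ⟨Q, τ, ⟨h₁, h₂⟩, hQ, hτ⟩ := ih _ (hn ▸ hlt) hR' rfl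
      exact ⟨Q, _, ⟨h₁.head h, h₂⟩, hQ, hρ.trans hτ⟩
    · exact ⟨R, id, ⟨.refl, fun Q' hQ' => h ⟨Q', hQ'⟩⟩, hR, .of_eq rfl rfl⟩

/-! ## Normal forms -/

theorem exists_inTree {S : ETree L → ETree L → Prop} {R : RawProof L} {x : Place L × ETree L}
    (hx : x ∈ R.roots) {E' : ETree L} (h : S x.2 E') : ∃ R', InTree S R R' := by
  obtain ⟨cuts, trees⟩ := R
  rcases mem_roots.1 hx with ⟨E, hE, rfl⟩ | ⟨⟨E, F⟩, hE, rfl⟩ | ⟨⟨E, F⟩, hE, rfl⟩ <;>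
    obtain ⟨s, hs⟩ := Multiset.exists_cons_of_mem hE <;> simp only at hs <;> subst hs
  · exact ⟨_, .tree _ _ h⟩
  · exact ⟨_, .pos _ _ _ h⟩
  · exact ⟨_, .neg _ _ _ h⟩

theorem nodup_map_of_forall {α β : Type*} {s : Multiset α} {f : α → β}
    (h : ∀ x y t, s = x ::ₘ y ::ₘ t → f x ≠ f y) : (s.map f).Nodup := by
  classical
  rw [Multiset.nodup_iff_ne_cons_cons]
  intro b t hb
  obtain ⟨x, hx, hfx, hx'⟩ := (Multiset.map_eq_cons f s _ b).2 hb
  obtain ⟨y, hy, hfy, -⟩ := (Multiset.map_eq_cons f _ _ b).2 hx'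
  refine h x y ((s.erase x).erase y) ?_ (hfx.trans hfy.symm)
  rw [Multiset.cons_erase hy, Multiset.cons_erase hx]

section Normal

variable {R : RawProof L}

theorem nodup_trees_of_normal (hn : ∀ R', ¬ MergeStep R R') : (R.trees.map ETree.Sh).Nodup := by
  refine nodup_map_of_forall fun E F t ht hS => ?_
  obtain ⟨cuts, trees⟩ := R
  simp only at ht
  subst ht
  exact hn _ (.trees E F cuts t hS)

theorem nodup_cuts_of_normal (hn : ∀ R', ¬ MergeStep R R') :
    (R.cuts.map fun C => (C.1.Sh, C.2.Sh)).Nodup := by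
  refine nodup_map_of_forall fun C D t ht hS => ?_
  obtain ⟨cuts, trees⟩ := R
  simp only at ht
  subst ht
  simp only [Prod.mk.injEq] at hS
  exact hn _ (.cuts C D t trees hS.1 hS.2)

theorem wf_of_normal (hR : R.Mergeable) (hn : ∀ R', ¬ MergeStep R R')
    {x : Place L × ETree L} (hx : x ∈ R.roots) : x.2.WF := by
  rcases (hR.wf x hx).wf_or_step with h | ⟨E', h⟩ | ⟨a, b, E', h⟩
  · exact h
  · obtain ⟨R', h⟩ := exists_inTree hx h
    exact (hn _ (.loc h)).elim
  · obtain ⟨R', h⟩ := exists_inTree hx h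
    exact (hn _ (.all a b h)).elim

/-- In a normal form at most one tree stands at each place, and this tree is merge-free, so that the
path determines the eigenvariable. -/
theorem has_unique_of_normal (hR : R.Mergeable) (hn : ∀ R', ¬ MergeStep R R')
    {π : Place L} {p : Path L} {a b : ℕ} (ha : (π, p, a) ∈ R.occs)
    (hb : (π, p, b) ∈ R.occs) : a = b := by
  obtain ⟨E, hE, ha⟩ := ha
  obtain ⟨F, hF, hb⟩ := hb
  suffices E = F by
    subst this
    exact (wf_of_normal hR hn hE).has_unique ha hb
  simp only [mem_roots, Prod.mk.injEq] at hE hF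
  rcases hE with ⟨E, hE, rfl, rfl⟩ | ⟨C, hC, rfl, rfl⟩ | ⟨C, hC, rfl, rfl⟩
  · rcases hF with ⟨F, hF, hS, rfl⟩ | ⟨D, hD, hS, rfl⟩ | ⟨D, hD, hS, rfl⟩
    · exact Multiset.inj_on_of_nodup_map (nodup_trees_of_normal hn) _ hE _ hF
        (Place.tree.inj hS).symm
    all_goals cases hS
  · rcases hF with ⟨F, hF, hS, rfl⟩ | ⟨D, hD, hS, rfl⟩ | ⟨D, hD, hS, rfl⟩
    · cases hS
    · obtain ⟨h₁, h₂⟩ := Place.pos.inj hS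
      rw [Multiset.inj_on_of_nodup_map (nodup_cuts_of_normal hn) C hC D hD (by rw [h₁, h₂])]
    · cases hS
  · rcases hF with ⟨F, hF, hS, rfl⟩ | ⟨D, hD, hS, rfl⟩ | ⟨D, hD, hS, rfl⟩
    · cases hS
    · cases hS
    · obtain ⟨h₁, h₂⟩ := Place.neg.inj hS
      rw [Multiset.inj_on_of_nodup_map (nodup_cuts_of_normal hn) C hC D hD (by rw [h₁, h₂])]

theorem isPreProof_of_normal (hR : R.Mergeable) (hn : ∀ R', ¬ MergeStep R R')
    (hd : ∀ A B, Place.pos A B ∈ R.places → B = A.dual) :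
    R.IsPreProof where
  tree_wf E hE := wf_of_normal hR hn (x := (Place.tree E.Sh, E)) (mem_roots.2 (Or.inl ⟨E, hE, rfl⟩))
  cut_wf C hC :=
    ⟨wf_of_normal hR hn (mem_roots.2 (Or.inr (Or.inl ⟨C, hC, rfl⟩))),
      wf_of_normal hR hn (mem_roots.2 (Or.inr (Or.inr ⟨C, hC, rfl⟩)))⟩
  cut_dual C hC := hd _ _ (pos_mem_places.2 ⟨C, hC, rfl, rfl⟩)
  cut_positive C hC := hR.positive _ _ (pos_mem_places.2 ⟨C, hC, rfl, rfl⟩)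
  trees_distinct := nodup_trees_of_normal hn
  cuts_distinct := by
    -- Irreducibility only separates cuts by their pairs of formulas; duality makes the second
    -- formula a function of the first.
    have h : R.cuts.map (fun C => (C.1.Sh, C.2.Sh)) =
        (R.cuts.map fun C => C.1.Sh).map fun A => (A, A.dual) := by
      rw [Multiset.map_map]
      refine Multiset.map_congr rfl fun C hC => ?_
      simp [hd _ _ (pos_mem_places.2 ⟨C, hC, rfl, rfl⟩)]
    have := nodup_cuts_of_normal hn
    rw [h] at this
    exact this.of_map _
  regular := hR.regular
  closed A hA := by
    obtain ⟨E, hE, rfl⟩ := Multiset.mem_map.1 hA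
    exact hR.closed _ (tree_mem_places.2 ⟨E, hE, rfl⟩)

end Normal

/-- Expansion pre-proofs with a tautological deep sequent and levels of variables. -/
structure IsLeveled (P : RawProof L) : Prop where
  preProof : P.IsPreProof
  level : ∃ lev, P.IsLevel lev
  tautology : ∀ val, ∃ A ∈ P.Dp, A.eval val

end RawProof

end ExpansionCut

namespace ExpansionCut

open FirstOrder FirstOrder.Language

variable {L : FirstOrder.Language.{u, v}}

/-! ## Cuts with a given pair of trees -/

section mkCut

variable {E F : ETree L}

theorem mkCut_cases (E F : ETree L) : mkCut E F = (E, F) ∨ mkCut E F = (F, E) := by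
  rw [mkCut]
  split_ifs <;> simp

theorem mkCut_positive (h : F.Sh.positive = !E.Sh.positive) :
    (mkCut E F).1.Sh.positive = true := by
  rw [mkCut]
  split_ifs with hE
  · exact hE
  · simpa [h] using hE

/-- Duality is formulated under a substitution because the cut created by a quantifier reduction
need only become dual after the renaming that merging induces. -/
theorem mkCut_dual {σ : ℕ → L.Term ℕ} (h : F.Sh.subst σ = (E.Sh.subst σ).dual) :
    (mkCut E F).2.Sh.subst σ = ((mkCut E F).1.Sh.subst σ).dual := by
  rcases mkCut_cases E F with h' | h' <;> simp [h', h]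

theorem mkCut_eval {val : (l : ℕ) → L.Relations l → (Fin l → L.Term ℕ) → Prop} :
    ((mkCut E F).1.Dp.eval val ∧ (mkCut E F).2.Dp.eval val) ↔
      E.Dp.eval val ∧ F.Dp.eval val := by
  rcases mkCut_cases E F with h' | h' <;> simp [h', and_comm]

theorem mkCut_apply_dual (h : F.Sh = E.Sh.dual) {w : NNF L 0 → ℕ}
    (hw : ∀ A, w A.dual = w A) : w (mkCut E F).1.Sh = w E.Sh := by
  rcases mkCut_cases E F with h' | h' <;> simp [h', h, hw]

end mkCut

/-- This bounds the measure of a normal form `s` by that of a list `t` of old cut-formulas: however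
many copies a reduction has produced, each formula is counted once. -/
theorem sum_map_le_of_nodup {α : Type*} {s t : Multiset α} (w : α → ℕ) (hs : s.Nodup)
    (h : ∀ x ∈ s, w x ≠ 0 → x ∈ t) : (s.map w).sum ≤ (t.map w).sum := by
  classical
  have hle : s.filter (fun x => w x ≠ 0) ≤ t :=
    (Multiset.le_iff_subset (hs.filter _)).2 fun x hx => by
      obtain ⟨h₁, h₂⟩ := Multiset.mem_filter.1 hx
      exact h x h₁ h₂
  obtain ⟨u, rfl⟩ := Multiset.le_iff_exists_add.1 hle
  have hz : ((s.filter fun x => ¬ w x ≠ 0).map w).sum = 0 := by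
    refine Multiset.sum_eq_zero fun x hx => ?_
    obtain ⟨y, hy, rfl⟩ := Multiset.mem_map.1 hx
    simpa using (Multiset.mem_filter.1 hy).2
  conv_lhs => rw [← Multiset.filter_add_not (fun x => w x ≠ 0) s]
  rw [Multiset.map_add, Multiset.sum_add, hz, Multiset.map_add, Multiset.sum_add]
  omega

namespace RawProof

/-- The cut-formulas. -/
def cutFormulas (R : RawProof L) : Multiset (NNF L 0) := R.cuts.map fun C => C.1.Sh

theorem IsLeveled.mergeable {P : RawProof L} (h : P.IsLeveled) : P.Mergeable where
  wf x hx := by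
    rcases mem_roots.1 hx with ⟨E, hE, rfl⟩ | ⟨C, hC, rfl⟩ | ⟨C, hC, rfl⟩
    · exact (h.preProof.tree_wf E hE).mwf
    · exact (h.preProof.cut_wf C hC).1.mwf
    · exact (h.preProof.cut_wf C hC).2.mwf
  regular := h.preProof.regular
  positive A B hA := by
    obtain ⟨C, hC, rfl, rfl⟩ := pos_mem_places.1 hA
    exact h.preProof.cut_positive C hC
  closed A hA := by
    obtain ⟨E, hE, rfl⟩ := tree_mem_places.1 hA
    exact h.preProof.closed _ (Multiset.mem_map_of_mem _ hE)
  level := h.level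
  tautology := h.tautology

theorem Renames.mem_cutFormulas {ρ : ℕ → ℕ} {R Q : RawProof L} (h : Renames ρ R Q) {A : NNF L 0}
    (hA : A ∈ Q.cutFormulas) : ∃ B ∈ R.cutFormulas, A = B.subst (ren ρ) := by
  obtain ⟨C, hC, rfl⟩ := Multiset.mem_map.1 hA
  have := pos_mem_places.2 ⟨C, hC, rfl, rfl⟩
  rw [h.places] at this
  obtain ⟨π, hπ, hA⟩ := this
  cases π with
  | pos A₀ B₀ =>
    obtain ⟨D, hD, rfl, rfl⟩ := pos_mem_places.1 hπ
    exact ⟨_, Multiset.mem_map_of_mem _ hD, (Place.pos.inj hA).1.symm⟩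
  | _ => simp [Place.subst] at hA

/-- The properties of a normal form of a reduct in which cut-formulas are dual. -/
theorem Mergeable.normalForm_isLeveled {R Q : RawProof L} {ρ : ℕ → ℕ} (hQ : Q.Mergeable)
    (hn : ∀ Q', ¬ MergeStep Q Q') (h : Renames ρ R Q)
    (hd : ∀ C ∈ R.cuts, C.2.Sh.subst (ren ρ) = (C.1.Sh.subst (ren ρ)).dual) : Q.IsLeveled where
  preProof := isPreProof_of_normal hQ hn fun A B hA => by
    rw [h.places] at hA
    obtain ⟨π, hπ, hA⟩ := hA
    cases π with
    | pos A₀ B₀ =>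
      obtain ⟨D, hD, rfl, rfl⟩ := pos_mem_places.1 hπ
      obtain ⟨rfl, rfl⟩ := Place.pos.inj hA
      exact hd D hD
    | _ => simp [Place.subst] at hA
  level := hQ.level
  tautology := hQ.tautology

theorem Sh_eq_of_places {P Q : RawProof L} (hP : P.IsPreProof) (hQ : Q.IsPreProof)
    (h : ∀ A, Place.tree A ∈ Q.places ↔ Place.tree A ∈ P.places) : Q.Sh = P.Sh := by
  refine (Multiset.Nodup.ext hQ.trees_distinct hP.trees_distinct).2 fun A => ?_
  simpa [tree_mem_places] using h A

/-- Which of the two places is the positive one depends on polarity, but dependencies only involve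
the formula of a place. -/
theorem roots_cons_mkCut (E F : ETree L) (cuts : Multiset (Cut L)) (trees : Multiset (ETree L)) :
    ∃ π₁ π₂ : Place L, π₁.formula = E.Sh ∧ π₂.formula = F.Sh ∧
      RawProof.roots ⟨mkCut E F ::ₘ cuts, trees⟩ =
        (π₁, E) ::ₘ (π₂, F) ::ₘ RawProof.roots ⟨cuts, trees⟩ := by
  rcases mkCut_cases E F with h | h
  · refine ⟨.pos E.Sh F.Sh, .neg E.Sh F.Sh, rfl, rfl, ?_⟩
    simp only [h, roots, Multiset.map_cons, Multiset.add_cons, Multiset.cons_add]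
    exact Multiset.cons_swap _ _ _
  · refine ⟨.neg F.Sh E.Sh, .pos F.Sh E.Sh, rfl, rfl, ?_⟩
    simp only [h, roots, Multiset.map_cons, Multiset.add_cons, Multiset.cons_add]

theorem roots_cons_cut (E F : ETree L) (cuts : Multiset (Cut L)) (trees : Multiset (ETree L)) :
    RawProof.roots ⟨(E, F) ::ₘ cuts, trees⟩ =
      (.pos E.Sh F.Sh, E) ::ₘ (.neg E.Sh F.Sh, F) ::ₘ RawProof.roots ⟨cuts, trees⟩ := by
  simp only [roots, Multiset.map_cons, Multiset.add_cons, Multiset.cons_add]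
  exact Multiset.cons_swap _ _ _

/-! ## Reduction of propositional cuts -/

/-- A reduction step between levelled pre-proofs in which the cut-formulas do not become more
complex. -/
structure Progress (P Q : RawProof L) : Prop where
  leveled : Q.IsLeveled
  Sh_eq : Q.Sh = P.Sh
  step : CutStep P Q
  qd_le : ∀ r, (∀ A ∈ P.cutFormulas, A.qd ≤ r) → ∀ A ∈ Q.cutFormulas, A.qd ≤ r

/-- The old levels can be kept: the first step of a path into the cut enters a component without
adding terms, and `NNF.top` passes through it, so the dependencies are the same before and after the
split. -/
theorem exists_progress_or {E₁ E₂ F₁ F₂ : ETree L} {cuts : Multiset (Cut L)}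
    {trees : Multiset (ETree L)}
    (hP : IsLeveled ⟨(ETree.or E₁ E₂, ETree.and F₁ F₂) ::ₘ cuts, trees⟩) :
    ∃ Q, Progress ⟨(ETree.or E₁ E₂, ETree.and F₁ F₂) ::ₘ cuts, trees⟩ Q ∧
      (Q.cutFormulas.map NNF.size).sum <
        ((cutFormulas ⟨(ETree.or E₁ E₂, ETree.and F₁ F₂) ::ₘ cuts, trees⟩).map NNF.size).sum ∧
      ∀ r, (Q.cutFormulas.map (NNF.weight r)).sum ≤
        ((cutFormulas ⟨(ETree.or E₁ E₂, ETree.and F₁ F₂) ::ₘ cuts, trees⟩).map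
          (NNF.weight r)).sum := by
  have hpre := hP.preProof
  have hM := hP.mergeable
  have hdual := hpre.cut_dual _ (Multiset.mem_cons_self _ _)
  simp only [ETree.Sh, NNF.dual, NNF.and.injEq] at hdual
  obtain ⟨hd₁, hd₂⟩ := hdual
  set R : RawProof L := ⟨mkCut E₁ F₁ ::ₘ mkCut E₂ F₂ ::ₘ cuts, trees⟩ with hRdef
  obtain ⟨π₁, π₁', hf₁, hf₁', hr₁⟩ := roots_cons_mkCut E₁ F₁ (mkCut E₂ F₂ ::ₘ cuts) trees
  obtain ⟨π₂, π₂', hf₂, hf₂', hr₂⟩ := roots_cons_mkCut E₂ F₂ cuts trees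
  rw [hr₂] at hr₁
  have hroots := roots_cons_cut (ETree.or E₁ E₂) (ETree.and F₁ F₂) cuts trees
  have hRdual : ∀ C ∈ R.cuts, C.2.Sh = C.1.Sh.dual := by
    intro C hC
    simp only [hRdef, Multiset.mem_cons] at hC
    rcases hC with rfl | rfl | hC
    · simpa [NNF.subst_var] using mkCut_dual (σ := Term.var) (by simpa [NNF.subst_var] using hd₁)
    · simpa [NNF.subst_var] using mkCut_dual (σ := Term.var) (by simpa [NNF.subst_var] using hd₂)
    · exact hpre.cut_dual C (Multiset.mem_cons_of_mem hC)
  have hR : R.Mergeable := by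
    refine ⟨?_, ?_, ?_, ?_, ?_, ?_⟩
    · have h := hM.wf
      simp only [hroots, Multiset.mem_cons, forall_eq_or_imp, ETree.MWF] at h
      intro x hx
      simp only [hRdef, hr₁, Multiset.mem_cons] at hx
      rcases hx with rfl | rfl | rfl | rfl | hx
      · exact h.1.1
      · exact h.2.1.1
      · exact h.1.2
      · exact h.2.1.2
      · exact h.2.2 x hx
    · have h := hM.regular
      rw [EV_eq_bind, hroots] at h
      rw [EV_eq_bind, hRdef, hr₁]
      simp only [Multiset.cons_bind, ETree.EV] at h ⊢
      convert h using 1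
      abel
    · intro A B hA
      obtain ⟨C, hC, rfl, rfl⟩ := pos_mem_places.1 hA
      simp only [hRdef, Multiset.mem_cons] at hC
      rcases hC with rfl | rfl | hC
      · exact mkCut_positive (by rw [hd₁, NNF.positive_dual])
      · exact mkCut_positive (by rw [hd₂, NNF.positive_dual])
      · exact hpre.cut_positive C (Multiset.mem_cons_of_mem hC)
    · intro A hA
      obtain ⟨E, hE, rfl⟩ := tree_mem_places.1 hA
      exact hM.closed _ (tree_mem_places.2 ⟨E, hE, rfl⟩)
    · obtain ⟨lev, hlev⟩ := hM.level
      refine ⟨lev, ?_⟩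
      rintro ⟨π, p, a⟩ ⟨E, hE, hp⟩ y hy
      simp only [hRdef, hr₁, Multiset.mem_cons, Prod.mk.injEq] at hE hp hy
      rcases hE with ⟨rfl, rfl⟩ | ⟨rfl, rfl⟩ | ⟨rfl, rfl⟩ | ⟨rfl, rfl⟩ | hE
      · refine hlev (_, Step.left :: p, a) ⟨ETree.or E E₂, by rw [hroots]; simp; exact Or.inl rfl,
          Or.inl ⟨p, rfl, hp⟩⟩ y ?_
        rw [hf₁] at hy
        simpa [NNF.deps, Path.vars, Step.vars, NNF.top, Place.formula, ETree.Sh] using hy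
      · refine hlev (_, Step.left :: p, a) ⟨ETree.and E F₂, by rw [hroots]; simp; exact Or.inl rfl,
          Or.inl ⟨p, rfl, hp⟩⟩ y ?_
        rw [hf₁'] at hy
        simpa [NNF.deps, Path.vars, Step.vars, NNF.top, Place.formula, ETree.Sh] using hy
      · refine hlev (_, Step.right :: p, a) ⟨ETree.or E₁ E, by rw [hroots]; simp; exact Or.inl rfl,
          Or.inr ⟨p, rfl, hp⟩⟩ y ?_
        rw [hf₂] at hy
        simpa [NNF.deps, Path.vars, Step.vars, NNF.top, Place.formula, ETree.Sh] using hy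
      · refine hlev (_, Step.right :: p, a) ⟨ETree.and F₁ E, by rw [hroots]; simp; exact Or.inl rfl,
          Or.inr ⟨p, rfl, hp⟩⟩ y ?_
        rw [hf₂'] at hy
        simpa [NNF.deps, Path.vars, Step.vars, NNF.top, Place.formula, ETree.Sh] using hy
      · exact hlev (π, p, a) ⟨E, by rw [hroots]; simp [hE], hp⟩ y hy
    · intro val
      have h := hM.tautology val
      rw [eval_Dp_iff] at h ⊢
      simp only [hRdef, Multiset.mem_cons, exists_eq_or_imp, mkCut_eval]
      simp only [Multiset.mem_cons, exists_eq_or_imp, ETree.Dp, PForm.eval] at h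
      grind
  obtain ⟨Q, ρ, hQ, hQM, hρ⟩ := hR.exists_normalForm
  have hQL : Q.IsLeveled := hQM.normalForm_isLeveled hQ.2 hρ fun C hC => by
    rw [hRdual C hC, NNF.dual_subst]
  have hform : R.cutFormulas =
      (mkCut E₁ F₁).1.Sh ::ₘ (mkCut E₂ F₂).1.Sh ::ₘ cuts.map fun C => C.1.Sh := by
    simp [cutFormulas, hRdef]
  have hsum : ∀ w : NNF L 0 → ℕ, (∀ σ A, w (A.subst σ) = w A) → (∀ A, w A.dual = w A) →
      (Q.cutFormulas.map w).sum ≤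
        w E₁.Sh + w E₂.Sh + ((cuts.map fun C => C.1.Sh).map w).sum := by
    intro w hw hw'
    -- Merging can only shorten the list of cut-formulas, apart from a renaming to which `w` is
    -- insensitive.
    refine (sum_map_le_of_nodup (t := R.cutFormulas.map (NNF.subst (ren ρ))) w
      hQL.preProof.cuts_distinct fun A hA _ => ?_).trans ?_
    · obtain ⟨B, hB, rfl⟩ := hρ.mem_cutFormulas hA
      exact Multiset.mem_map_of_mem _ hB
    · rw [Multiset.map_map]
      simp [hw, hform, mkCut_apply_dual hd₁ hw', mkCut_apply_dual hd₂ hw', add_assoc]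
  refine ⟨Q, ⟨hQL, ?_, ⟨hpre, hQL.preProof, .prop _ _ _ _ _ _ _ hQ⟩, ?_⟩, ?_, ?_⟩
  · refine Sh_eq_of_places hpre hQL.preProof fun A => ?_
    rw [hρ.tree_iff hR.closed, tree_mem_places, tree_mem_places]
  · intro r hr A hA
    obtain ⟨B, hB, rfl⟩ := hρ.mem_cutFormulas hA
    rw [NNF.qd_subst]
    simp only [cutFormulas, Multiset.map_cons, Multiset.mem_cons, forall_eq_or_imp, ETree.Sh,
      NNF.qd, max_le_iff] at hr
    simp only [hform, Multiset.mem_cons] at hB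
    rcases hB with rfl | rfl | hB
    · rw [mkCut_apply_dual hd₁ (w := NNF.qd) NNF.qd_dual]
      exact hr.1.1
    · rw [mkCut_apply_dual hd₂ (w := NNF.qd) NNF.qd_dual]
      exact hr.1.2
    · exact hr.2 B hB
  · refine (hsum NNF.size NNF.size_subst NNF.size_dual).trans_lt ?_
    simp [cutFormulas, ETree.Sh, NNF.size]
  · intro r
    refine (hsum (NNF.weight r) (NNF.weight_subst r) (NNF.weight_dual r)).trans ?_
    simp [cutFormulas, ETree.Sh, NNF.weight]

theorem exists_progress_atom {l : ℕ} {S : L.Relations l} {ts : Fin l → L.Term ℕ}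
    {cuts : Multiset (Cut L)} {trees : Multiset (ETree L)}
    (hP : IsLeveled ⟨(ETree.lit true S ts, ETree.lit false S ts) ::ₘ cuts, trees⟩) :
    Progress ⟨(ETree.lit true S ts, ETree.lit false S ts) ::ₘ cuts, trees⟩ ⟨cuts, trees⟩ := by
  have hpre := hP.preProof
  have hroots := roots_cons_cut (ETree.lit true S ts) (ETree.lit false S ts) cuts trees
  have hQ : IsPreProof ⟨cuts, trees⟩ := by
    refine ⟨hpre.tree_wf, fun C hC => hpre.cut_wf C (Multiset.mem_cons_of_mem hC),
      fun C hC => hpre.cut_dual C (Multiset.mem_cons_of_mem hC),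
      fun C hC => hpre.cut_positive C (Multiset.mem_cons_of_mem hC), hpre.trees_distinct,
      ?_, ?_, hpre.closed⟩
    · have := hpre.cuts_distinct
      rw [Multiset.map_cons] at this
      exact (Multiset.nodup_cons.1 this).2
    · simpa [EV, ETree.EV] using hpre.regular
  have hQL : IsLeveled ⟨cuts, trees⟩ := by
    refine ⟨hQ, ?_, ?_⟩
    · obtain ⟨lev, hlev⟩ := hP.level
      refine ⟨lev, ?_⟩
      rintro ⟨π, p, a⟩ ⟨E, hE, hp⟩ y hy
      exact hlev (π, p, a) ⟨E, by rw [hroots]; simp [hE], hp⟩ y hy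
    · intro val
      have h := hP.tautology val
      rw [eval_Dp_iff] at h ⊢
      simp only [Multiset.mem_cons, exists_eq_or_imp, ETree.Dp, PForm.eval] at h
      grind
  exact ⟨hQL, rfl, ⟨hpre, hQ, .atom _ _ _ _⟩,
    fun r hr A hA => hr A (by simpa [cutFormulas] using Or.inr (by simpa [cutFormulas] using hA))⟩

/-- A levelled pre-proof all of whose cut-formulas are quantified can be reached by reducing
propositional cuts. -/
theorem exists_reduces_quantified {P : RawProof L} (hP : P.IsLeveled) :
    ∃ Q, Q.IsLeveled ∧ Q.Sh = P.Sh ∧ P.Reduces Q ∧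
      (∀ r, (∀ A ∈ P.cutFormulas, A.qd ≤ r) → ∀ A ∈ Q.cutFormulas, A.qd ≤ r) ∧
      (∀ r, (Q.cutFormulas.map (NNF.weight r)).sum ≤ (P.cutFormulas.map (NNF.weight r)).sum) ∧
      ∀ C ∈ Q.cuts, ∃ A, C.1.Sh = NNF.ex A := by
  induction hn : (P.cutFormulas.map NNF.size).sum using Nat.strong_induction_on generalizing P with
  | _ n ih =>
    by_cases h : ∀ C ∈ P.cuts, ∃ A, C.1.Sh = NNF.ex A
    · exact ⟨P, hP, rfl, .refl, fun _ h => h, fun _ => le_rfl, h⟩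
    push Not at h
    obtain ⟨⟨E, F⟩, hC, hne⟩ := h
    suffices ∃ Q, Progress P Q ∧
        (Q.cutFormulas.map NNF.size).sum < (P.cutFormulas.map NNF.size).sum ∧
        ∀ r, (Q.cutFormulas.map (NNF.weight r)).sum ≤ (P.cutFormulas.map (NNF.weight r)).sum by
      obtain ⟨Q, hQ, hlt, hw⟩ := this
      obtain ⟨Q', h₁, h₂, h₃, h₄, h₅, h₆⟩ := ih _ (hn ▸ hlt) hQ.leveled rfl
      exact ⟨Q', h₁, h₂.trans hQ.Sh_eq, h₃.head hQ.step, fun r hr => h₄ r (hQ.qd_le r hr),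
        fun r => (h₅ r).trans (hw r), h₆⟩
    obtain ⟨cuts, hcuts⟩ := Multiset.exists_cons_of_mem hC
    obtain ⟨_, trees⟩ := P
    simp only at hcuts
    subst hcuts
    have hwf := hP.preProof.cut_wf _ hC
    have hd := hP.preProof.cut_dual _ hC
    have hpos := hP.preProof.cut_positive _ hC
    simp only at hwf hd hpos hne
    cases E with
    | lit b S ts =>
      obtain rfl : b = true := hpos
      obtain rfl : F = ETree.lit false S ts := hwf.2.eq_lit_of_Sh hd
      refine ⟨_, exists_progress_atom hP, ?_, fun r => ?_⟩ <;>
        simp [cutFormulas, ETree.Sh, NNF.size, NNF.weight]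
    | or E₁ E₂ =>
      obtain ⟨F₁, F₂, rfl, -, -⟩ := hwf.2.eq_and_of_Sh hd
      exact exists_progress_or hP
    | and E₁ E₂ => simp [ETree.Sh, NNF.positive] at hpos
    | ex A => exact (hne A rfl).elim
    | exp G t E =>
      obtain ⟨A, hA, -⟩ := hwf.1.2.2.2
      exact (hne A (ETree.Sh_of_exBody hA)).elim
    | all A a E => simp [ETree.Sh, NNF.positive] at hpos
    | merge => exact hwf.1.elim

end RawProof

end ExpansionCut

namespace ExpansionCut

open FirstOrder FirstOrder.Language

variable {L : FirstOrder.Language.{u, v}}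

namespace ETree

/-! ## Variables, expansions and long disjunctions -/

theorem fv_Sh_subset_vars {E : ETree L} : E.Sh.fv ⊆ E.vars := by
  induction E with
  | lit b R ts => simp [Sh, NNF.fv, vars, varFinsetLeft_relabel_inl]
  | and E F ihE ihF | or E F ihE ihF => exact Set.union_subset_union ihE ihF
  | ex => exact subset_rfl
  | exp F t E ihF _ =>
    exact ihF.trans (Set.subset_union_left.trans Set.subset_union_left)
  | all => exact Set.subset_union_left.trans Set.subset_union_left
  | merge E F ihE _ => exact ihE.trans Set.subset_union_left

theorem Has.vars_subset {E : ETree L} {p : Path L} {a : ℕ} (h : E.Has p a) :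
    (∀ y ∈ Path.vars p, y ∈ E.vars) ∧ a ∈ E.vars := by
  induction E generalizing p with
  | lit | ex => exact h.elim
  | and E F ihE ihF | or E F ihE ihF =>
    rcases h with ⟨q, rfl, h⟩ | ⟨q, rfl, h⟩
    · obtain ⟨h₁, h₂⟩ := ihE h
      simp only [Path.vars, Step.vars, Finset.empty_union]
      exact ⟨fun y hy => Or.inl (h₁ y hy), Or.inl h₂⟩
    · obtain ⟨h₁, h₂⟩ := ihF h
      simp only [Path.vars, Step.vars, Finset.empty_union]
      exact ⟨fun y hy => Or.inr (h₁ y hy), Or.inr h₂⟩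
  | exp F t E ihF ihE =>
    rcases h with h | ⟨q, rfl, h⟩
    · obtain ⟨h₁, h₂⟩ := ihF h
      exact ⟨fun y hy => Or.inl (Or.inl (h₁ y hy)), Or.inl (Or.inl h₂)⟩
    · obtain ⟨h₁, h₂⟩ := ihE h
      simp only [Path.vars, Step.vars, Finset.mem_union]
      refine ⟨fun y hy => ?_, Or.inr h₂⟩
      rcases hy with hy | hy
      · exact Or.inl (Or.inr hy)
      · exact Or.inr (h₁ y hy)
  | all A c E ih =>
    rcases h with ⟨rfl, rfl⟩ | ⟨q, rfl, h⟩
    · exact ⟨by simp [Path.vars], Or.inl (Or.inr rfl)⟩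
    · obtain ⟨h₁, h₂⟩ := ih h
      simp only [Path.vars, Step.vars, Finset.empty_union]
      exact ⟨fun y hy => Or.inr (h₁ y hy), Or.inr h₂⟩
  | merge E F ihE ihF =>
    rcases h with h | h
    · obtain ⟨h₁, h₂⟩ := ihE h
      exact ⟨fun y hy => Or.inl (h₁ y hy), Or.inl h₂⟩
    · obtain ⟨h₁, h₂⟩ := ihF h
      exact ⟨fun y hy => Or.inr (h₁ y hy), Or.inr h₂⟩

theorem Has.deps_subset {E : ETree L} {p : Path L} {a : ℕ} (h : E.Has p a) :
    E.Sh.deps p ⊆ E.vars := by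
  rintro y (hy | hy)
  · exact h.vars_subset.1 y hy
  · exact fv_Sh_subset_vars (NNF.fv_top_subset _ _ hy)

theorem EV_subset_vars {E : ETree L} {a : ℕ} (h : a ∈ E.EV) : a ∈ E.vars := by
  obtain ⟨p, hp⟩ := mem_EV_iff.1 h
  exact hp.vars_subset.2

theorem vars_finite (E : ETree L) : E.vars.Finite := by
  induction E with
  | lit b R ts =>
    refine (Finset.finite_toSet (Finset.univ.biUnion fun i => (ts i).varFinset)).subset ?_
    intro x hx
    simpa [vars] using hx
  | and E F ihE ihF | or E F ihE ihF | merge E F ihE ihF => exact ihE.union ihF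
  | ex A => exact A.fv_finite
  | exp F t E ihF ihE => exact (ihF.union (Finset.finite_toSet t.varFinset)).union ihE
  | all A a E ih => exact (A.fv_finite.union (Set.finite_singleton a)).union ih

section expansions

variable {F : ETree L} {A : NNF L 1}

theorem vars_of_mem_expansions {t : L.Term ℕ} {G : ETree L} (h : (t, G) ∈ F.expansions) :
    (∀ y ∈ t.varFinset, y ∈ F.vars) ∧ G.vars ⊆ F.vars := by
  induction F with
  | exp F s E ihF _ =>
    simp only [expansions, List.mem_append, List.mem_singleton, Prod.mk.injEq] at h
    rcases h with h | ⟨rfl, rfl⟩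
    · obtain ⟨h₁, h₂⟩ := ihF h
      exact ⟨fun y hy => Or.inl (Or.inl (h₁ y hy)),
        h₂.trans (Set.subset_union_left.trans Set.subset_union_left)⟩
    · exact ⟨fun y hy => Or.inl (Or.inr hy), Set.subset_union_right⟩
  | _ => simp [expansions] at h

theorem WF.of_mem_expansions (hF : F.WF) (hA : F.exBody = some A) {t : L.Term ℕ} {G : ETree L}
    (h : (t, G) ∈ F.expansions) : G.WF ∧ G.Sh = A.inst t := by
  induction F with
  | exp F s E ihF _ =>
    obtain ⟨h₁, h₂, -, B, hB, hS⟩ := hF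
    simp only [exBody] at hA
    obtain rfl : B = A := Option.some.inj (hB.symm.trans hA)
    simp only [expansions, List.mem_append, List.mem_singleton, Prod.mk.injEq] at h
    rcases h with h | ⟨rfl, rfl⟩
    · exact ihF h₁ hA h
    · exact ⟨h₂, hS⟩
  | _ => simp [expansions] at h

theorem EV_eq_sum_expansions (hA : F.exBody = some A) :
    F.EV = (F.expansions.map fun x => x.2.EV).sum := by
  induction F with
  | ex => simp [expansions, EV]
  | exp F s E ihF _ => simp [expansions, EV, ihF hA]
  | _ => simp [exBody] at hA

theorem eval_iff_expansions (hA : F.exBody = some A)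
    {val : (l : ℕ) → L.Relations l → (Fin l → L.Term ℕ) → Prop} :
    F.Dp.eval val ↔ ∃ x ∈ F.expansions, x.2.Dp.eval val := by
  induction F with
  | ex => simp [expansions, Dp, PForm.eval]
  | exp F s E ihF _ => simp [expansions, Dp, PForm.eval, ihF hA, or_and_right, exists_or]
  | _ => simp [exBody] at hA

theorem has_of_mem_expansions {t : L.Term ℕ} {G : ETree L} (h : (t, G) ∈ F.expansions)
    {p : Path L} {a : ℕ} (hp : G.Has p a) : F.Has (Step.ex t :: p) a := by
  induction F with
  | exp F s E ihF _ =>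
    simp only [expansions, List.mem_append, List.mem_singleton, Prod.mk.injEq] at h
    rcases h with h | ⟨rfl, rfl⟩
    · exact Or.inl (ihF h)
    · exact Or.inr ⟨p, rfl, hp⟩
  | _ => simp [expansions] at h

end expansions

section bigOr

theorem EV_bigOr (E : ETree L) (l : List (ETree L)) :
    (bigOr E l).EV = E.EV + (l.map EV).sum := by
  induction l generalizing E with
  | nil => simp [bigOr]
  | cons F l ih => simp [bigOr, EV, ih]

theorem EV_bigAnd (E : ETree L) (l : List (ETree L)) :
    (bigAnd E l).EV = E.EV + (l.map EV).sum := by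
  induction l generalizing E with
  | nil => simp [bigAnd]
  | cons F l ih => simp [bigAnd, EV, ih]

theorem MWF.bigOr {E : ETree L} {l : List (ETree L)} (h : ∀ G ∈ E :: l, G.MWF) :
    (bigOr E l).MWF := by
  induction l generalizing E with
  | nil => exact h E (by simp)
  | cons F l ih => exact ⟨h E (by simp), ih fun G hG => h G (List.mem_cons_of_mem _ hG)⟩

theorem MWF.bigAnd {E : ETree L} {l : List (ETree L)} (h : ∀ G ∈ E :: l, G.MWF) :
    (bigAnd E l).MWF := by
  induction l generalizing E with
  | nil => exact h E (by simp)
  | cons F l ih => exact ⟨h E (by simp), ih fun G hG => h G (List.mem_cons_of_mem _ hG)⟩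

/-- The path selects a component and `NNF.top` follows it. Thus eigenvariables in one disjunct
acquire no dependency on the variables of the other disjuncts, here the other expansion terms. -/
theorem Has.of_bigOr {E : ETree L} {l : List (ETree L)} {p : Path L} {a : ℕ}
    (h : (bigOr E l).Has p a) :
    ∃ G ∈ E :: l, ∃ q, G.Has q a ∧ (bigOr E l).Sh.deps p = G.Sh.deps q := by
  induction l generalizing E p with
  | nil => exact ⟨E, by simp, p, h, rfl⟩
  | cons F l ih =>
    rcases h with ⟨q, rfl, h⟩ | ⟨q, rfl, h⟩
    · exact ⟨E, by simp, q, h, by simp [bigOr, Sh, NNF.deps, NNF.top, Path.vars, Step.vars]⟩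
    · obtain ⟨G, hG, q', h', hd⟩ := ih h
      refine ⟨G, List.mem_cons_of_mem _ hG, q', h', hd ▸ ?_⟩
      simp [bigOr, Sh, NNF.deps, NNF.top, Path.vars, Step.vars]

theorem Has.of_bigAnd {E : ETree L} {l : List (ETree L)} {p : Path L} {a : ℕ}
    (h : (bigAnd E l).Has p a) :
    ∃ G ∈ E :: l, ∃ q, G.Has q a ∧ (bigAnd E l).Sh.deps p = G.Sh.deps q := by
  induction l generalizing E p with
  | nil => exact ⟨E, by simp, p, h, rfl⟩
  | cons F l ih =>
    rcases h with ⟨q, rfl, h⟩ | ⟨q, rfl, h⟩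
    · exact ⟨E, by simp, q, h, by simp [bigAnd, Sh, NNF.deps, NNF.top, Path.vars, Step.vars]⟩
    · obtain ⟨G, hG, q', h', hd⟩ := ih h
      refine ⟨G, List.mem_cons_of_mem _ hG, q', h', hd ▸ ?_⟩
      simp [bigAnd, Sh, NNF.deps, NNF.top, Path.vars, Step.vars]

theorem eval_bigOr {val : (l : ℕ) → L.Relations l → (Fin l → L.Term ℕ) → Prop} {E : ETree L}
    {l : List (ETree L)} (h : ∃ G ∈ E :: l, G.Dp.eval val) : (bigOr E l).Dp.eval val := by
  induction l generalizing E with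
  | nil => simpa [bigOr] using h
  | cons F l ih =>
    obtain ⟨G, hG, h⟩ := h
    rcases List.mem_cons.1 hG with rfl | hG
    · exact Or.inl h
    · exact Or.inr (ih ⟨G, hG, h⟩)

theorem eval_bigAnd {val : (l : ℕ) → L.Relations l → (Fin l → L.Term ℕ) → Prop} {E : ETree L}
    {l : List (ETree L)} (h : ∀ G ∈ E :: l, G.Dp.eval val) : (bigAnd E l).Dp.eval val := by
  induction l generalizing E with
  | nil => exact h E (by simp)
  | cons F l ih => exact ⟨h E (by simp), ih fun G hG => h G (List.mem_cons_of_mem _ hG)⟩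

theorem bigAnd_dual {σ : ℕ → L.Term ℕ} {E F : ETree L} {l : List (ETree L × ETree L)}
    (h : ∀ x ∈ (E, F) :: l, x.2.Sh.subst σ = (x.1.Sh.subst σ).dual) :
    (bigAnd F (l.map Prod.snd)).Sh.subst σ = ((bigOr E (l.map Prod.fst)).Sh.subst σ).dual := by
  induction l generalizing E F with
  | nil => exact h (E, F) (by simp)
  | cons x l ih =>
    simp only [List.map_cons, bigOr, bigAnd, Sh, NNF.subst, NNF.dual, NNF.and.injEq]
    exact ⟨h (E, F) (by simp), ih fun y hy => h y (List.mem_cons_of_mem _ hy)⟩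

theorem bigAnd_positive {E F : ETree L} {l : List (ETree L × ETree L)}
    (h : F.Sh.positive = !E.Sh.positive) :
    (bigAnd F (l.map Prod.snd)).Sh.positive = !(bigOr E (l.map Prod.fst)).Sh.positive := by
  cases l with
  | nil => exact h
  | cons x l => rfl

theorem qd_bigOr_lt {r : ℕ} {E : ETree L} {l : List (ETree L)} (h : ∀ G ∈ E :: l, G.Sh.qd < r) :
    (bigOr E l).Sh.qd < r := by
  induction l generalizing E with
  | nil => exact h E (by simp)
  | cons F l ih =>
    exact max_lt (h E (by simp)) (ih fun G hG => h G (List.mem_cons_of_mem _ hG))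

theorem qd_bigAnd_lt {r : ℕ} {E : ETree L} {l : List (ETree L)} (h : ∀ G ∈ E :: l, G.Sh.qd < r) :
    (bigAnd E l).Sh.qd < r := by
  induction l generalizing E with
  | nil => exact h E (by simp)
  | cons F l ih =>
    exact max_lt (h E (by simp)) (ih fun G hG => h G (List.mem_cons_of_mem _ hG))

end bigOr

end ETree

namespace RawProof

/-! ## The cut between a disjunction and a conjunction -/

section disjunctionCut

variable {l : List (ETree L × ETree L)} {C : Cut L}

theorem mem_disjunctionCut (h : C ∈ disjunctionCut l) : ∃ E F l', l = (E, F) :: l' ∧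
    C = mkCut (ETree.bigOr E (l'.map Prod.fst)) (ETree.bigAnd F (l'.map Prod.snd)) := by
  cases l with
  | nil => simp [disjunctionCut] at h
  | cons x l => exact ⟨x.1, x.2, l, rfl, Multiset.mem_singleton.1 h⟩

theorem positive_of_mem_disjunctionCut (h : C ∈ disjunctionCut l)
    (hl : ∀ x ∈ l, x.2.Sh.positive = !x.1.Sh.positive) : C.1.Sh.positive = true := by
  obtain ⟨E, F, l, rfl, rfl⟩ := mem_disjunctionCut h
  exact mkCut_positive (ETree.bigAnd_positive (hl _ (List.mem_cons_self ..)))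

theorem dual_of_mem_disjunctionCut {σ : ℕ → L.Term ℕ} (h : C ∈ disjunctionCut l)
    (hl : ∀ x ∈ l, x.2.Sh.subst σ = (x.1.Sh.subst σ).dual) :
    C.2.Sh.subst σ = (C.1.Sh.subst σ).dual := by
  obtain ⟨E, F, l, rfl, rfl⟩ := mem_disjunctionCut h
  exact mkCut_dual (ETree.bigAnd_dual hl)

theorem qd_lt_of_mem_disjunctionCut {r : ℕ} (h : C ∈ disjunctionCut l)
    (hl : ∀ x ∈ l, x.1.Sh.qd < r ∧ x.2.Sh.qd < r) : C.1.Sh.qd < r := by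
  obtain ⟨E, F, l, rfl, rfl⟩ := mem_disjunctionCut h
  rcases mkCut_cases (ETree.bigOr E (l.map Prod.fst)) (ETree.bigAnd F (l.map Prod.snd)) with h' | h'
  all_goals rw [h']
  · exact ETree.qd_bigOr_lt (by simpa using ⟨(hl _ (List.mem_cons_self ..)).1,
      fun a b hb => (hl _ (List.mem_cons_of_mem _ hb)).1⟩)
  · exact ETree.qd_bigAnd_lt (by simpa using ⟨(hl _ (List.mem_cons_self ..)).2,
      fun a b hb => (hl _ (List.mem_cons_of_mem _ hb)).2⟩)

theorem mwf_of_mem_disjunctionCut (h : C ∈ disjunctionCut l)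
    (hl : ∀ x ∈ l, x.1.MWF ∧ x.2.MWF) : C.1.MWF ∧ C.2.MWF := by
  obtain ⟨E, F, l, rfl, rfl⟩ := mem_disjunctionCut h
  have h₁ : (ETree.bigOr E (l.map Prod.fst)).MWF :=
    ETree.MWF.bigOr (by simpa using ⟨(hl _ (List.mem_cons_self ..)).1,
      fun a b hb => (hl _ (List.mem_cons_of_mem _ hb)).1⟩)
  have h₂ : (ETree.bigAnd F (l.map Prod.snd)).MWF :=
    ETree.MWF.bigAnd (by simpa using ⟨(hl _ (List.mem_cons_self ..)).2,
      fun a b hb => (hl _ (List.mem_cons_of_mem _ hb)).2⟩)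
  rcases mkCut_cases (ETree.bigOr E (l.map Prod.fst)) (ETree.bigAnd F (l.map Prod.snd)) with h' | h'
  all_goals rw [h']
  · exact ⟨h₁, h₂⟩
  · exact ⟨h₂, h₁⟩

theorem has_of_mem_disjunctionCut (h : C ∈ disjunctionCut l) {G : ETree L}
    (hG : G = C.1 ∨ G = C.2) {p : Path L} {a : ℕ} (hp : G.Has p a) :
    ∃ x ∈ l, ∃ q, (x.1.Has q a ∧ G.Sh.deps p = x.1.Sh.deps q) ∨
      (x.2.Has q a ∧ G.Sh.deps p = x.2.Sh.deps q) := by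
  obtain ⟨E, F, l, rfl, rfl⟩ := mem_disjunctionCut h
  have hG' : G = ETree.bigOr E (l.map Prod.fst) ∨ G = ETree.bigAnd F (l.map Prod.snd) := by
    rcases mkCut_cases (ETree.bigOr E (l.map Prod.fst)) (ETree.bigAnd F (l.map Prod.snd))
      with h' | h' <;> rw [h'] at hG <;> tauto
  rcases hG' with rfl | rfl
  · obtain ⟨G, hG, q, hq⟩ := hp.of_bigOr
    obtain ⟨x, hx, rfl⟩ := List.mem_map.1 (show G ∈ ((E, F) :: l).map Prod.fst by simpa using hG)
    exact ⟨x, hx, q, Or.inl hq⟩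
  · obtain ⟨G, hG, q, hq⟩ := hp.of_bigAnd
    obtain ⟨x, hx, rfl⟩ := List.mem_map.1 (show G ∈ ((E, F) :: l).map Prod.snd by simpa using hG)
    exact ⟨x, hx, q, Or.inr hq⟩

theorem EV_disjunctionCut (l : List (ETree L × ETree L)) :
    ((disjunctionCut l).bind fun C => C.1.EV + C.2.EV) =
      (l.map fun x => x.1.EV).sum + (l.map fun x => x.2.EV).sum := by
  cases l with
  | nil => simp [disjunctionCut]
  | cons x l =>
    have h₁ := ETree.EV_bigOr x.1 (l.map Prod.fst)
    have h₂ := ETree.EV_bigAnd x.2 (l.map Prod.snd)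
    simp only [List.map_map, Function.comp_def] at h₁ h₂
    simp only [disjunctionCut, Multiset.singleton_bind, List.map_cons, List.sum_cons]
    rw [← h₁, ← h₂]
    rcases mkCut_cases (ETree.bigOr x.1 (l.map Prod.fst)) (ETree.bigAnd x.2 (l.map Prod.snd))
      with h' | h' <;> rw [h']
    exact add_comm _ _

theorem eval_disjunctionCut {val : (l : ℕ) → L.Relations l → (Fin l → L.Term ℕ) → Prop}
    (h₁ : ∃ x ∈ l, x.1.Dp.eval val) (h₂ : ∀ x ∈ l, x.2.Dp.eval val) :
    ∃ C ∈ disjunctionCut l, C.1.Dp.eval val ∧ C.2.Dp.eval val := by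
  cases l with
  | nil => simp at h₁
  | cons x l =>
    refine ⟨_, Multiset.mem_singleton_self _, mkCut_eval.2 ⟨ETree.eval_bigOr ?_,
      ETree.eval_bigAnd ?_⟩⟩
    · obtain ⟨y, hy, h⟩ := h₁
      refine ⟨y.1, ?_, h⟩
      simpa using List.mem_map_of_mem (f := Prod.fst) hy
    · intro G hG
      obtain ⟨y, hy, rfl⟩ := List.mem_map.1 (show G ∈ (x :: l).map Prod.snd by simpa using hG)
      exact h₂ y hy

end disjunctionCut

/-! ## Fresh renamings -/

theorem exists_freshRenamings (n : ℕ) {S V : Set ℕ} (hV : V.Finite) (hS : S ⊆ V) :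
    ∃ η : Fin n → ℕ → ℕ, FreshRenamings η S V := by
  classical
  obtain ⟨B, hB⟩ := hV.bddAbove
  have hlt : ∀ x ∈ V, x < B + 1 := fun x hx => Nat.lt_succ_of_le (hB hx)
  -- All variables of `V` are below `B + 1`, so the `i`-th copies fill the block with quotient `i +
  -- 1` modulo division by `B + 1`; block `0` is left to `V`.
  refine ⟨fun i x => if x ∈ S then x + (B + 1) * (i + 1) else x, ?_, ?_, ?_⟩
  · intro i x hx
    simp [hx]
  · intro i x hx hxV
    simp only [hx, if_true] at hxV
    have := hlt _ hxV
    nlinarith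
  · intro i j x hx y hy h
    simp only [hx, hy, if_true] at h
    have hx' := hlt x (hS hx)
    have hy' := hlt y (hS hy)
    have h₁ : (x + (B + 1) * (i + 1)) / (B + 1) = i + 1 := by
      rw [Nat.add_mul_div_left _ _ (by omega), Nat.div_eq_of_lt hx', zero_add]
    have h₂ : (y + (B + 1) * (j + 1)) / (B + 1) = j + 1 := by
      rw [Nat.add_mul_div_left _ _ (by omega), Nat.div_eq_of_lt hy', zero_add]
    have hij : (i : ℕ) = j := by
      rw [h, h₂] at h₁
      omega
    refine ⟨Fin.ext hij, ?_⟩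
    rw [hij] at h
    omega

theorem vars_finite (P : RawProof L) : P.vars.Finite := by
  have h : P.vars = (⋃ E ∈ {E | E ∈ P.trees}, E.vars) ∪
      ⋃ C ∈ {C | C ∈ P.cuts}, (C.1.vars ∪ C.2.vars) := by
    ext x
    simp [vars]
  rw [h]
  exact ((Multiset.finite_toSet P.trees).biUnion fun E _ => E.vars_finite).union
    ((Multiset.finite_toSet P.cuts).biUnion fun C _ => C.1.vars_finite.union C.2.vars_finite)

theorem vars_subset_of_mem_roots {P : RawProof L} {x : Place L × ETree L} (hx : x ∈ P.roots) :
    x.2.vars ⊆ P.vars := by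
  intro y hy
  rcases mem_roots.1 hx with ⟨E, hE, rfl⟩ | ⟨C, hC, rfl⟩ | ⟨C, hC, rfl⟩
  · exact Or.inl ⟨E, hE, hy⟩
  · exact Or.inr ⟨C, hC, Or.inl hy⟩
  · exact Or.inr ⟨C, hC, Or.inr hy⟩

end RawProof

end ExpansionCut

namespace ExpansionCut

open FirstOrder FirstOrder.Language

variable {L : FirstOrder.Language.{u, v}}

namespace RawProof

/-! ## Reduction of quantified cuts -/

/-- The substitution that renames the variables and then replaces `a` by `t`. -/
def copySubst (a : ℕ) (t : L.Term ℕ) (η : ℕ → ℕ) : ℕ → L.Term ℕ := fun x => single a t (η x)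

/-- The copy of a tree under a renaming followed by the replacement of `a` by `t`. -/
noncomputable def copyTree (a : ℕ) (t : L.Term ℕ) (η : ℕ → ℕ) (G : ETree L) : ETree L :=
  (G.subst (ren η)).subst (single a t)

/-- The copy of a collection under a renaming followed by the replacement of `a` by `t`. -/
noncomputable def copy (a : ℕ) (t : L.Term ℕ) (η : ℕ → ℕ) (R : RawProof L) : RawProof L :=
  (R.subst (ren η)).subst (single a t)

section copy

variable {a : ℕ} {t : L.Term ℕ} {η : ℕ → ℕ} {G : ETree L}

theorem Sh_copyTree : (copyTree a t η G).Sh = G.Sh.subst (copySubst a t η) := by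
  simp only [copyTree, ETree.Sh_subst, NNF.subst_subst]
  rfl

theorem roots_copy (R : RawProof L) : (copy a t η R).roots =
    R.roots.map fun x => (x.1.subst (copySubst a t η), copyTree a t η x.2) := by
  simp only [copy, roots_subst, Multiset.map_map, Function.comp_def, Place.subst_subst]
  rfl

/-- The hypothesis keeps the replacement of `a` by `t` away from the renamed eigenvariables, which
therefore remain variables. -/
theorem EV_copyTree (h : ∀ x ∈ G.EV, η x ≠ a) : (copyTree a t η G).EV = G.EV.map η := by
  rw [copyTree, ETree.EV_subst, ETree.EV_subst, Multiset.map_map]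
  refine Multiset.map_congr rfl fun x hx => ?_
  have : single a t (η x) = Term.var (η x) := by simp [single, h x hx]
  exact ETree.substVar_eq this

theorem EV_copy {R : RawProof L} (h : ∀ x ∈ R.EV, η x ≠ a) :
    (copy a t η R).EV = R.EV.map η := by
  rw [copy, EV_subst, EV_subst, Multiset.map_map]
  refine Multiset.map_congr rfl fun x hx => ?_
  have : single a t (η x) = Term.var (η x) := by simp [single, h x hx]
  exact ETree.substVar_eq this

theorem mwf_copyTree (hG : G.MWF) (h : ∀ x ∈ G.EV, η x ≠ a) : (copyTree a t η G).MWF := by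
  refine (hG.subst fun x _ => ⟨_, rfl⟩).subst fun y hy => ?_
  rw [ETree.EV_subst] at hy
  obtain ⟨x, hx, rfl⟩ := Multiset.mem_map.1 hy
  exact ⟨η x, by simp [single, h x hx]⟩

theorem has_copyTree (h : ∀ x ∈ G.EV, η x ≠ a) {p : Path L} {b : ℕ} :
    (copyTree a t η G).Has p b ↔
      ∃ q c, G.Has q c ∧ p = Path.subst (copySubst a t η) q ∧ b = η c := by
  simp only [copyTree, ETree.has_subst]
  have key : ∀ {q c}, G.Has q c →
      ETree.substVar (single a t) (ETree.substVar (ren (L := L) η) c) = η c := by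
    intro q c hc
    have : single a t (η c) = Term.var (η c) := by
      simp [single, h c (ETree.mem_EV_iff.2 ⟨q, hc⟩)]
    exact ETree.substVar_eq this
  constructor
  · rintro ⟨_, _, ⟨q, c, hc, rfl, rfl⟩, rfl, rfl⟩
    exact ⟨q, c, hc, Path.subst_subst _ _ _, key hc⟩
  · rintro ⟨q, c, hc, rfl, rfl⟩
    exact ⟨_, _, ⟨q, c, hc, rfl, rfl⟩, (Path.subst_subst (ren η) (single a t) q).symm, (key hc).symm⟩

end copy

theorem sum_bind {ι α β : Type*} (s : Finset ι) (f : ι → Multiset α) (g : α → Multiset β) :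
    (∑ i ∈ s, f i).bind g = ∑ i ∈ s, (f i).bind g := by
  classical
  induction s using Finset.induction_on with
  | empty => simp
  | insert i s hi ih => simp [Finset.sum_insert hi, Multiset.add_bind, ih]

section quantReduct

variable {P : RawProof L} {l : List (L.Term ℕ × ETree L)} {a : ℕ} {E : ETree L}
  {η : Fin l.length → ℕ → ℕ}

/-- The pairs of trees from which the new cut is formed. -/
noncomputable def cutPairs (l : List (L.Term ℕ × ETree L)) (a : ℕ) (E : ETree L)
    (η : Fin l.length → ℕ → ℕ) : List (ETree L × ETree L) :=
  List.ofFn fun i => ((l.get i).2, copyTree a (l.get i).1 (η i) E)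

theorem mem_cutPairs {x : ETree L × ETree L} :
    x ∈ cutPairs l a E η ↔ ∃ i, ((l.get i).2, copyTree a (l.get i).1 (η i) E) = x := by
  rw [cutPairs, List.mem_ofFn]

theorem mem_cuts_quantReduct {C : Cut L} : C ∈ (quantReduct P l a E η).cuts ↔
    C ∈ P.cuts ∨ C ∈ disjunctionCut (cutPairs l a E η) ∨
      ∃ i, C ∈ (copy a (l.get i).1 (η i) P).cuts := by
  simp only [quantReduct, Multiset.mem_add, Multiset.mem_sum, Finset.mem_univ, true_and, or_assoc]
  rfl

theorem mem_trees_quantReduct {G : ETree L} : G ∈ (quantReduct P l a E η).trees ↔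
    G ∈ P.trees ∨ ∃ i, G ∈ (copy a (l.get i).1 (η i) P).trees := by
  simp only [quantReduct, Multiset.mem_add, Multiset.mem_sum, Finset.mem_univ, true_and]
  rfl

theorem mem_roots_quantReduct {x : Place L × ETree L} : x ∈ (quantReduct P l a E η).roots ↔
    x ∈ P.roots ∨
      (∃ C ∈ disjunctionCut (cutPairs l a E η),
        x = (Place.pos C.1.Sh C.2.Sh, C.1) ∨ x = (Place.neg C.1.Sh C.2.Sh, C.2)) ∨
      ∃ i, x ∈ (copy a (l.get i).1 (η i) P).roots := by
  simp only [mem_roots, mem_cuts_quantReduct, mem_trees_quantReduct]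
  constructor
  · rintro (⟨G, hG | ⟨i, hG⟩, rfl⟩ | ⟨C, hC | hC | ⟨i, hC⟩, rfl⟩ | ⟨C, hC | hC | ⟨i, hC⟩, rfl⟩)
    · exact Or.inl (Or.inl ⟨G, hG, rfl⟩)
    · exact Or.inr (Or.inr ⟨i, Or.inl ⟨G, hG, rfl⟩⟩)
    · exact Or.inl (Or.inr (Or.inl ⟨C, hC, rfl⟩))
    · exact Or.inr (Or.inl ⟨C, hC, Or.inl rfl⟩)
    · exact Or.inr (Or.inr ⟨i, Or.inr (Or.inl ⟨C, hC, rfl⟩)⟩)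
    · exact Or.inl (Or.inr (Or.inr ⟨C, hC, rfl⟩))
    · exact Or.inr (Or.inl ⟨C, hC, Or.inr rfl⟩)
    · exact Or.inr (Or.inr ⟨i, Or.inr (Or.inr ⟨C, hC, rfl⟩)⟩)
  · rintro ((⟨G, hG, rfl⟩ | ⟨C, hC, rfl⟩ | ⟨C, hC, rfl⟩) | ⟨C, hC, rfl | rfl⟩ |
      ⟨i, ⟨G, hG, rfl⟩ | ⟨C, hC, rfl⟩ | ⟨C, hC, rfl⟩⟩)
    · exact Or.inl ⟨G, Or.inl hG, rfl⟩
    · exact Or.inr (Or.inl ⟨C, Or.inl hC, rfl⟩)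
    · exact Or.inr (Or.inr ⟨C, Or.inl hC, rfl⟩)
    · exact Or.inr (Or.inl ⟨C, Or.inr (Or.inl hC), rfl⟩)
    · exact Or.inr (Or.inr ⟨C, Or.inr (Or.inl hC), rfl⟩)
    · exact Or.inl ⟨G, Or.inr ⟨i, hG⟩, rfl⟩
    · exact Or.inr (Or.inl ⟨C, Or.inr (Or.inr ⟨i, hC⟩), rfl⟩)
    · exact Or.inr (Or.inr ⟨C, Or.inr (Or.inr ⟨i, hC⟩), rfl⟩)

theorem EV_quantReduct (h : ∀ i, ∀ x ∈ P.EV + E.EV, η i x ≠ a) :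
    (quantReduct P l a E η).EV =
      P.EV + (l.map fun x => x.2.EV).sum + ∑ i, (P.EV + E.EV).map (η i) := by
  have hP : ∀ i, (copy a (l.get i).1 (η i) P).EV = P.EV.map (η i) := fun i =>
    EV_copy fun x hx => h i x (Multiset.mem_add.2 (Or.inl hx))
  have hE : ∀ i, (copyTree a (l.get i).1 (η i) E).EV = E.EV.map (η i) := fun i =>
    EV_copyTree fun x hx => h i x (Multiset.mem_add.2 (Or.inr hx))
  have h₁ : ((cutPairs l a E η).map fun x => x.1.EV).sum = (l.map fun x => x.2.EV).sum := by
    rw [cutPairs, List.map_ofFn]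
    congr 1
    conv_rhs => rw [← List.ofFn_get l, List.map_ofFn]
    rfl
  have h₂ : ((cutPairs l a E η).map fun x => x.2.EV).sum = ∑ i, E.EV.map (η i) := by
    rw [cutPairs, List.map_ofFn, List.sum_ofFn]
    simp [← hE]
  have hsum : ∑ i, P.EV.map (η i) =
      ∑ i, ((copy a (l.get i).1 (η i) P).trees.bind ETree.EV) +
        ∑ i, ((copy a (l.get i).1 (η i) P).cuts.bind fun C => C.1.EV + C.2.EV) := by
    rw [← Finset.sum_add_distrib]
    exact Finset.sum_congr rfl fun i _ => (hP i).symm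
  have hD := EV_disjunctionCut (cutPairs l a E η)
  rw [h₁, h₂] at hD
  have hmap : ∀ i, (P.EV + E.EV).map (η i) = P.EV.map (η i) + E.EV.map (η i) := fun i =>
    Multiset.map_add _ _ _
  simp only [hmap, Finset.sum_add_distrib]
  rw [hsum]
  change ((P.trees + ∑ i, (copy a (l.get i).1 (η i) P).trees).bind ETree.EV) +
    ((P.cuts + disjunctionCut (cutPairs l a E η) +
      ∑ i, (copy a (l.get i).1 (η i) P).cuts).bind fun C => C.1.EV + C.2.EV) = _
  rw [Multiset.add_bind, Multiset.add_bind, Multiset.add_bind, sum_bind, sum_bind, hD]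
  have : P.EV = P.trees.bind ETree.EV + P.cuts.bind fun C => C.1.EV + C.2.EV := rfl
  rw [this]
  abel

end quantReduct

/-- A cut on a quantified formula, a family of fresh renamings, and levels of the variables; `K`
separates the variables on which the cut-formula may depend from the eigenvariables of the cut. -/
structure QuantRedex (F : ETree L) (A : NNF L 1) (a : ℕ) (E : ETree L)
    (cuts : Multiset (Cut L)) (trees : Multiset (ETree L))
    (η : Fin F.expansions.length → ℕ → ℕ) (lev : ℕ → ℕ) (K : ℕ) : Prop where
  leveled : IsLeveled ⟨(F, ETree.all A.dual a E) ::ₘ cuts, trees⟩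
  isLevel : IsLevel ⟨(F, ETree.all A.dual a E) ::ₘ cuts, trees⟩ lev
  body : F.exBody = some A
  fresh : FreshRenamings η {x | x ∈ (⟨cuts, trees⟩ : RawProof L).EV + E.EV}
    (vars ⟨(F, ETree.all A.dual a E) ::ₘ cuts, trees⟩)
  low : ∀ y ∈ A.fv, lev y < K
  high : ∀ b, b ∈ F.EV ∨ b = a ∨ b ∈ E.EV → K ≤ lev b

namespace QuantRedex

variable {F : ETree L} {A : NNF L 1} {a : ℕ} {E : ETree L} {cuts : Multiset (Cut L)}
  {trees : Multiset (ETree L)} {η : Fin F.expansions.length → ℕ → ℕ} {lev : ℕ → ℕ} {K : ℕ}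

theorem mem_roots_iff {x : Place L × ETree L} :
    x ∈ RawProof.roots ⟨(F, ETree.all A.dual a E) ::ₘ cuts, trees⟩ ↔
      x = (.pos F.Sh (NNF.all A.dual), F) ∨ x = (.neg F.Sh (NNF.all A.dual), .all A.dual a E) ∨
        x ∈ RawProof.roots ⟨cuts, trees⟩ := by
  rw [roots_cons_cut, Multiset.mem_cons, Multiset.mem_cons]
  rfl

theorem roots_vars {x : Place L × ETree L} (hx : x ∈ RawProof.roots ⟨cuts, trees⟩) :
    x.2.vars ⊆ vars ⟨(F, ETree.all A.dual a E) ::ₘ cuts, trees⟩ :=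
  vars_subset_of_mem_roots (mem_roots_iff.2 (Or.inr (Or.inr hx)))

theorem F_vars : F.vars ⊆ vars ⟨(F, ETree.all A.dual a E) ::ₘ cuts, trees⟩ :=
  vars_subset_of_mem_roots (mem_roots_iff.2 (Or.inl rfl))

theorem E_vars : E.vars ⊆ vars ⟨(F, ETree.all A.dual a E) ::ₘ cuts, trees⟩ := by
  refine Set.Subset.trans ?_
    (vars_subset_of_mem_roots (mem_roots_iff.2 (Or.inr (Or.inl rfl))))
  exact Set.subset_union_right

theorem a_mem_vars : a ∈ vars ⟨(F, ETree.all A.dual a E) ::ₘ cuts, trees⟩ := by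
  refine vars_subset_of_mem_roots (mem_roots_iff.2 (Or.inr (Or.inl rfl))) ?_
  exact Or.inl (Or.inr rfl)

theorem EV_subset_vars {x : ℕ} (hx : x ∈ (⟨cuts, trees⟩ : RawProof L).EV + E.EV) :
    x ∈ vars ⟨(F, ETree.all A.dual a E) ::ₘ cuts, trees⟩ := by
  rcases Multiset.mem_add.1 hx with hx | hx
  · rw [EV_eq_bind, Multiset.mem_bind] at hx
    obtain ⟨y, hy, hx⟩ := hx
    exact roots_vars hy (ETree.EV_subset_vars hx)
  · exact E_vars (ETree.EV_subset_vars hx)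

theorem EV_eq : EV ⟨(F, ETree.all A.dual a E) ::ₘ cuts, trees⟩ =
    a ::ₘ ((⟨cuts, trees⟩ : RawProof L).EV + F.EV + E.EV) := by
  simp only [EV_eq_bind, roots_cons_cut, Multiset.cons_bind, ETree.EV]
  simp only [Multiset.cons_add, Multiset.add_cons]
  congr 1
  abel

theorem nodup (h : QuantRedex F A a E cuts trees η lev K)
    : (a ::ₘ ((⟨cuts, trees⟩ : RawProof L).EV + F.EV + E.EV)).Nodup := by
  rw [← EV_eq]
  exact h.leveled.preProof.regular

theorem a_notMem (h : QuantRedex F A a E cuts trees η lev K)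
    : a ∉ (⟨cuts, trees⟩ : RawProof L).EV + E.EV := by
  have := (Multiset.nodup_cons.1 h.nodup).1
  simp only [Multiset.mem_add] at this ⊢
  tauto

theorem eta_ne (h : QuantRedex F A a E cuts trees η lev K)
    (i : Fin F.expansions.length) {x : ℕ}
    (hx : x ∈ (⟨cuts, trees⟩ : RawProof L).EV + E.EV) : η i x ≠ a := fun h' =>
  h.fresh.fresh i x hx (h' ▸ a_mem_vars)

theorem copySubst_of_mem (h : QuantRedex F A a E cuts trees η lev K)
    (i : Fin F.expansions.length) {x : ℕ}
    (hx : x ∈ (⟨cuts, trees⟩ : RawProof L).EV + E.EV) (t : L.Term ℕ) :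
    copySubst a t (η i) x = Term.var (η i x) := by
  simp [copySubst, single, h.eta_ne i hx]

theorem copySubst_of_notMem (h : QuantRedex F A a E cuts trees η lev K)
    (i : Fin F.expansions.length) {x : ℕ}
    (hx : x ∉ (⟨cuts, trees⟩ : RawProof L).EV + E.EV) (hxa : x ≠ a) (t : L.Term ℕ) :
    copySubst a t (η i) x = Term.var x := by
  simp [copySubst, single, h.fresh.fixed i x hx, hxa]

theorem copySubst_self (h : QuantRedex F A a E cuts trees η lev K)
    (i : Fin F.expansions.length) (t : L.Term ℕ) :
    copySubst a t (η i) a = t := by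
  simp [copySubst, single, h.fresh.fixed i a h.a_notMem]

/-- The renamed eigenvariables avoid all variables of the redex and those of the other copies. The
originals remain in the context and in the subtrees of `F`. -/
theorem regular_reduct (h : QuantRedex F A a E cuts trees η lev K)
    : (quantReduct ⟨cuts, trees⟩ F.expansions a E η).EV.Nodup := by
  classical
  rw [EV_quantReduct fun i x hx => h.eta_ne i hx, ← ETree.EV_eq_sum_expansions h.body]
  have hnd := (Multiset.nodup_cons.1 h.nodup).2
  set X := (⟨cuts, trees⟩ : RawProof L).EV + E.EV with hX
  have hXnd : X.Nodup := by
    rw [add_right_comm] at hnd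
    exact (Multiset.nodup_add.1 hnd).1
  refine Multiset.nodup_add.2 ⟨(Multiset.nodup_add.1 hnd).1, ?_, ?_⟩
  -- Generalizing to partial sums allows adding the copies one at a time.
  · suffices ∀ s : Finset (Fin F.expansions.length), (∑ i ∈ s, X.map (η i)).Nodup from this _
    intro s
    induction s using Finset.induction_on with
    | empty => simp
    | insert i s hi ih =>
      rw [Finset.sum_insert hi]
      refine Multiset.nodup_add.2 ⟨?_, ih, ?_⟩
      · exact hXnd.map_on fun x hx y hy hxy => (h.fresh.injective i i x hx y hy hxy).2
      · rw [Multiset.disjoint_left]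
        intro z hz hz'
        obtain ⟨x, hx, rfl⟩ := Multiset.mem_map.1 hz
        obtain ⟨j, hj, hz'⟩ := Multiset.mem_sum.1 hz'
        obtain ⟨y, hy, hxy⟩ := Multiset.mem_map.1 hz'
        exact hi ((h.fresh.injective j i y hy x hx hxy).1 ▸ hj)
  · rw [Multiset.disjoint_left]
    intro z hz hz'
    obtain ⟨i, -, hz'⟩ := Multiset.mem_sum.1 hz'
    obtain ⟨x, hx, rfl⟩ := Multiset.mem_map.1 hz'
    refine h.fresh.fresh i x hx ?_
    rcases Multiset.mem_add.1 hz with hz | hz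
    · exact EV_subset_vars (Multiset.mem_add.2 (Or.inl hz))
    · exact F_vars (ETree.EV_subset_vars hz)

/-- Copies are new variables from which the original can be recovered, so their levels can be
prescribed without touching those of the redex. -/
theorem exists_lev (h : QuantRedex F A a E cuts trees η lev K)
    (g : ℕ → ℕ) : ∃ lev' : ℕ → ℕ,
    (∀ i, ∀ x ∈ (⟨cuts, trees⟩ : RawProof L).EV + E.EV, lev' (η i x) = g x) ∧
      ∀ y ∈ vars ⟨(F, ETree.all A.dual a E) ::ₘ cuts, trees⟩, lev' y = lev y := by
  classical
  refine ⟨fun y => if hy : ∃ x ∈ (⟨cuts, trees⟩ : RawProof L).EV + E.EV, ∃ i, η i x = y then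
    g hy.choose else lev y, ?_, ?_⟩
  · intro i x hx
    have hy : ∃ x' ∈ (⟨cuts, trees⟩ : RawProof L).EV + E.EV, ∃ j, η j x' = η i x := ⟨x, hx, i, rfl⟩
    obtain ⟨h₁, j, h₂⟩ := hy.choose_spec
    simp only [dif_pos hy]
    rw [(h.fresh.injective j i _ h₁ x hx h₂).2]
  · intro y hy
    refine dif_neg ?_
    rintro ⟨x, hx, i, rfl⟩
    exact h.fresh.fresh i x hx hy

/-- For a quantified cut-formula `NNF.top` stops at the root, so every eigenvariable of the cut
depends on all its free variables. Together with the next two lemmas this yields the field `high`.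
-/
theorem lev_of_has_F (hl : IsLevel ⟨(F, ETree.all A.dual a E) ::ₘ cuts, trees⟩ lev)
    (hb : F.exBody = some A) {p : Path L} {b y : ℕ} (hp : F.Has p b)
    (hy : y ∈ Path.vars p ∨ y ∈ A.fv) : lev y < lev b := by
  refine hl (.pos F.Sh (NNF.all A.dual), p, b) ⟨F, mem_roots_iff.2 (Or.inl rfl), hp⟩ y ?_
  rcases hy with hy | hy
  · exact Or.inl hy
  · refine Or.inr ?_
    simpa [Place.formula, ETree.Sh_of_exBody hb, NNF.top, NNF.fv] using hy

theorem lev_of_has_E (hl : IsLevel ⟨(F, ETree.all A.dual a E) ::ₘ cuts, trees⟩ lev)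
    {p : Path L} {b y : ℕ} (hp : E.Has p b)
    (hy : y ∈ Path.vars p ∨ y ∈ A.fv) : lev y < lev b := by
  refine hl (.neg F.Sh (NNF.all A.dual), Step.all :: p, b)
    ⟨_, mem_roots_iff.2 (Or.inr (Or.inl rfl)), Or.inr ⟨p, rfl, hp⟩⟩ y ?_
  rcases hy with hy | hy
  · exact Or.inl (by simpa [Path.vars, Step.vars] using hy)
  · refine Or.inr ?_
    simpa [Place.formula, NNF.top, NNF.fv] using hy

theorem lev_lt_eigenvariable (hl : IsLevel ⟨(F, ETree.all A.dual a E) ::ₘ cuts, trees⟩ lev)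
    {y : ℕ} (hy : y ∈ A.fv) : lev y < lev a := by
  refine hl (.neg F.Sh (NNF.all A.dual), [], a)
    ⟨_, mem_roots_iff.2 (Or.inr (Or.inl rfl)), Or.inl ⟨rfl, rfl⟩⟩ y (Or.inr ?_)
  simpa [Place.formula, NNF.top, NNF.fv] using hy

theorem E_Sh (h : QuantRedex F A a E cuts trees η lev K)
    : E.Sh = A.dual.inst (Term.var a) :=
  (h.leveled.preProof.cut_wf _ (Multiset.mem_cons_self _ _)).2.2

theorem expansion_spec (h : QuantRedex F A a E cuts trees η lev K)
    (i : Fin F.expansions.length) :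
    (F.expansions.get i).2.WF ∧ (F.expansions.get i).2.Sh = A.inst (F.expansions.get i).1 :=
  (h.leveled.preProof.cut_wf _ (Multiset.mem_cons_self _ _)).1.of_mem_expansions h.body
    (List.get_mem _ _)

/-- Variables of the redex keep their levels, and copies of an eigenvariable of level `m` get the
level `f m`. The replacement of `a` by a term is absorbed because `a` has level at least `K`, and
`f` lifts all such levels beyond the variables of the expansion terms. -/
theorem level_reduct (h : QuantRedex F A a E cuts trees η lev K)
    : ∃ lev', (quantReduct ⟨cuts, trees⟩ F.expansions a E η).IsLevel lev' := by
  -- A strict bound on the levels of all variables in the expansion terms.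
  set N : ℕ := (Finset.univ.biUnion fun i : Fin F.expansions.length =>
    (F.expansions.get i).1.varFinset).sup fun y => lev y + 1 with hN
  have hNlt : ∀ i, ∀ y ∈ (F.expansions.get i).1.varFinset, lev y < N := fun i y hy =>
    Finset.le_sup (f := fun y => lev y + 1)
      (Finset.mem_biUnion.2 ⟨i, Finset.mem_univ i, hy⟩)
  set f : ℕ → ℕ := fun m => if m < K then m else m + N with hf
  have hfmono : ∀ {m m'}, m < m' → f m < f m' := by
    intro m m' hm
    simp only [hf]
    split_ifs <;> omega
  have hfle : ∀ m, m ≤ f m := by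
    intro m
    simp only [hf]
    split_ifs <;> omega
  have hfN : ∀ {m}, K ≤ m → N ≤ f m := by
    intro m hm
    simp only [hf]
    split_ifs <;> omega
  obtain ⟨lev', hη, hV⟩ := h.exists_lev fun x => f (lev x)
  have htV : ∀ i, ∀ y ∈ (F.expansions.get i).1.varFinset,
      y ∈ vars ⟨(F, ETree.all A.dual a E) ::ₘ cuts, trees⟩ := fun i y hy =>
    F_vars ((ETree.vars_of_mem_expansions (List.get_mem _ i)).1 y hy)
  -- Whatever replaces `y` in a copy has level at most `f (lev y)`; as `f` is strictly monotone,
  -- this carries the inequalities between levels over to the copy.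
  have hcopy : ∀ i y, y ∈ vars ⟨(F, ETree.all A.dual a E) ::ₘ cuts, trees⟩ →
      ∀ z ∈ (copySubst a (F.expansions.get i).1 (η i) y).varFinset, lev' z ≤ f (lev y) := by
    intro i y hy z hz
    by_cases hyS : y ∈ (⟨cuts, trees⟩ : RawProof L).EV + E.EV
    · rw [h.copySubst_of_mem i hyS, Term.varFinset, Finset.mem_singleton] at hz
      rw [hz, hη i y hyS]
    · by_cases hya : y = a
      · subst hya
        rw [h.copySubst_self] at hz
        rw [hV z (htV i z hz)]
        exact (hNlt i z hz).le.trans (hfN (h.high y (Or.inr (Or.inl rfl))))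
      · rw [h.copySubst_of_notMem i hyS hya, Term.varFinset, Finset.mem_singleton] at hz
        rw [hz, hV y hy]
        exact hfle _
  refine ⟨lev', ?_⟩
  rintro ⟨π, p, b⟩ ⟨G, hG, hp⟩ y hy
  simp only at hG hp hy ⊢
  rw [formula_of_mem_roots hG] at hy
  simp only at hy
  rcases mem_roots_quantReduct.1 hG with hG | ⟨C, hC, hG⟩ | ⟨i, hG⟩
  · have hvars := roots_vars (F := F) (A := A) (a := a) (E := E) hG
    rw [hV y (hvars (hp.deps_subset hy)), hV b (hvars hp.vars_subset.2)]
    refine h.isLevel (π, p, b) ⟨G, mem_roots_iff.2 (Or.inr (Or.inr hG)), hp⟩ y ?_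
    rw [formula_of_mem_roots hG]
    exact hy
  · have hG' : G = C.1 ∨ G = C.2 := by
      rcases hG with hG | hG
      · exact Or.inl (Prod.mk.inj hG).2
      · exact Or.inr (Prod.mk.inj hG).2
    obtain ⟨x, hx, q, hq⟩ := has_of_mem_disjunctionCut hC hG' hp
    obtain ⟨i, rfl⟩ := mem_cutPairs.1 hx
    rcases hq with ⟨hq, hd⟩ | ⟨hq, hd⟩
    · rw [hd] at hy
      have hFb := ETree.has_of_mem_expansions (List.get_mem F.expansions i) hq
      have hFd : y ∈ Path.vars (Step.ex (F.expansions.get i).1 :: q) ∨ y ∈ A.fv := by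
        rcases hy with hy | hy
        · exact Or.inl (Finset.mem_union_right _ hy)
        · have := NNF.fv_top_subset _ _ hy
          rw [(h.expansion_spec i).2] at this
          rcases NNF.mem_fv_inst this with hy | hy
          · exact Or.inr hy
          · exact Or.inl (Finset.mem_union_left _ hy)
      have hyV : y ∈ F.vars := by
        rcases hFd with hy | hy
        · exact hFb.vars_subset.1 y hy
        · refine ETree.fv_Sh_subset_vars ?_
          rw [ETree.Sh_of_exBody h.body]
          exact hy
      rw [hV y (F_vars hyV), hV b (F_vars hFb.vars_subset.2)]
      exact lev_of_has_F h.isLevel h.body hFb hFd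
    · rw [hd] at hy
      obtain ⟨q, c, hqc, rfl, rfl⟩ := (has_copyTree fun x hx => h.eta_ne i
        (Multiset.mem_add.2 (Or.inr hx))).1 hq
      have hcS := ETree.mem_EV_iff.2 ⟨q, hqc⟩
      rw [Sh_copyTree] at hy
      obtain ⟨z, hz, hyz⟩ := NNF.mem_deps_subst hy
      rw [hη i c (Multiset.mem_add.2 (Or.inr hcS))]
      -- `a` may enter through the shallow formula of `E`, a dependency that was not recorded while
      -- `E` stood below the `∀`-expansion; the bound `K ≤ lev c` takes the place of the missing
      -- comparison.
      by_cases hza : z = a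
      · subst hza
        rw [h.copySubst_self] at hyz
        rw [hV y (htV i y hyz)]
        exact (hNlt i y hyz).trans_le (hfN (h.high c (Or.inr (Or.inr hcS))))
      · refine (hcopy i z (E_vars (hqc.deps_subset hz)) y hyz).trans_lt (hfmono ?_)
        refine lev_of_has_E h.isLevel hqc ?_
        rcases hz with hz | hz
        · exact Or.inl hz
        · have := NNF.fv_top_subset _ _ hz
          rw [h.E_Sh] at this
          rcases NNF.mem_fv_inst this with hz | hz
          · exact Or.inr (by simpa using hz)
          · exact (hza (by simpa using hz)).elim
  · rw [roots_copy] at hG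
    obtain ⟨⟨π₀, G₀⟩, hG₀, hG⟩ := Multiset.mem_map.1 hG
    obtain ⟨rfl, rfl⟩ := Prod.mk.inj hG
    have hS : ∀ x ∈ G₀.EV, x ∈ (⟨cuts, trees⟩ : RawProof L).EV + E.EV := fun x hx =>
      Multiset.mem_add.2 (Or.inl (by
        rw [EV_eq_bind]
        exact Multiset.mem_bind.2 ⟨_, hG₀, hx⟩))
    obtain ⟨q, c, hq, rfl, rfl⟩ := (has_copyTree fun x hx => h.eta_ne i (hS x hx)).1 hp
    have hcS := hS c (ETree.mem_EV_iff.2 ⟨q, hq⟩)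
    rw [Sh_copyTree] at hy
    obtain ⟨z, hz, hyz⟩ := NNF.mem_deps_subst hy
    rw [hη i c hcS]
    refine (hcopy i z (roots_vars hG₀ (hq.deps_subset hz)) y hyz).trans_lt (hfmono ?_)
    refine h.isLevel (π₀, q, c) ⟨G₀, mem_roots_iff.2 (Or.inr (Or.inr hG₀)), hq⟩ z ?_
    rw [formula_of_mem_roots hG₀]
    exact hz

/-- If some copy of the context is true, that suffices. Otherwise the tautology, read through each
copying substitution, makes each copy of `E` true, hence also the new conjunction; and the original
tautology gives either a true formula of the context or a true `Eᵢ`, hence a true new disjunction.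
-/
theorem tautology_reduct (h : QuantRedex F A a E cuts trees η lev K)
    (val : (l : ℕ) → L.Relations l → (Fin l → L.Term ℕ) → Prop) :
    ∃ B ∈ (quantReduct ⟨cuts, trees⟩ F.expansions a E η).Dp, B.eval val := by
  have hcopy : ∀ i, (∃ B ∈ (copy a (F.expansions.get i).1 (η i) ⟨cuts, trees⟩).Dp, B.eval val) ∨
      (copyTree a (F.expansions.get i).1 (η i) E).Dp.eval val := by
    intro i
    rw [copy, eval_Dp_subst, eval_Dp_subst, copyTree, ETree.eval_subst, ETree.eval_subst]
    have := h.leveled.tautology fun l R ts =>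
      val l R fun j => ((ts j).subst (ren (η i))).subst (single a (F.expansions.get i).1)
    rw [eval_Dp_iff] at this ⊢
    simp only [Multiset.mem_cons, exists_eq_or_imp, ETree.Dp] at this
    grind
  by_cases hc : ∃ i, ∃ B ∈ (copy a (F.expansions.get i).1 (η i) ⟨cuts, trees⟩).Dp, B.eval val
  · obtain ⟨i, hi⟩ := hc
    rw [eval_Dp_iff] at hi ⊢
    rcases hi with ⟨G, hG, h'⟩ | ⟨C, hC, h'⟩
    · exact Or.inl ⟨G, mem_trees_quantReduct.2 (Or.inr ⟨i, hG⟩), h'⟩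
    · exact Or.inr ⟨C, mem_cuts_quantReduct.2 (Or.inr (Or.inr ⟨i, hC⟩)), h'⟩
  · have hE : ∀ i, (copyTree a (F.expansions.get i).1 (η i) E).Dp.eval val := fun i =>
      (hcopy i).resolve_left fun h' => hc ⟨i, h'⟩
    have hP := h.leveled.tautology val
    rw [eval_Dp_iff] at hP ⊢
    rcases hP with ⟨G, hG, h'⟩ | ⟨C, hC, h'⟩
    · exact Or.inl ⟨G, mem_trees_quantReduct.2 (Or.inl hG), h'⟩
    · rcases Multiset.mem_cons.1 hC with rfl | hC
      · obtain ⟨C, hC, h''⟩ := eval_disjunctionCut (l := cutPairs F.expansions a E η)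
          (val := val) (by
            obtain ⟨x, hx, hx'⟩ := (ETree.eval_iff_expansions h.body).1 h'.1
            obtain ⟨i, rfl⟩ := List.get_of_mem hx
            exact ⟨_, mem_cutPairs.2 ⟨i, rfl⟩, hx'⟩) (by
            intro x hx
            obtain ⟨i, rfl⟩ := mem_cutPairs.1 hx
            exact hE i)
        exact Or.inr ⟨C, mem_cuts_quantReduct.2 (Or.inr (Or.inl hC)), h''⟩
      · exact Or.inr ⟨C, mem_cuts_quantReduct.2 (Or.inl hC), h'⟩

theorem tree_mem_places_reduct (h : QuantRedex F A a E cuts trees η lev K)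
    (B : NNF L 0) :
    Place.tree B ∈ (quantReduct ⟨cuts, trees⟩ F.expansions a E η).places ↔
      Place.tree B ∈ places ⟨(F, ETree.all A.dual a E) ::ₘ cuts, trees⟩ := by
  rw [tree_mem_places, tree_mem_places]
  constructor
  · rintro ⟨G, hG, rfl⟩
    rcases mem_trees_quantReduct.1 hG with hG | ⟨i, hG⟩
    · exact ⟨G, hG, rfl⟩
    · simp only [copy, subst, Multiset.map_map, Multiset.mem_map] at hG
      obtain ⟨G, hG', rfl⟩ := hG
      refine ⟨G, hG', ?_⟩
      have := h.leveled.preProof.closed _ (Multiset.mem_map_of_mem _ hG')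
      simp only [Function.comp_apply, ETree.Sh_subst]
      rw [NNF.subst_subst, NNF.subst_eq_self this]
  · rintro ⟨G, hG, rfl⟩
    exact ⟨G, mem_trees_quantReduct.2 (Or.inl hG), rfl⟩

theorem mergeable_reduct (h : QuantRedex F A a E cuts trees η lev K)
    : (quantReduct ⟨cuts, trees⟩ F.expansions a E η).Mergeable := by
  have hM := h.leveled.mergeable
  refine ⟨?_, h.regular_reduct, ?_, ?_, h.level_reduct, h.tautology_reduct⟩
  · intro x hx
    rcases mem_roots_quantReduct.1 hx with hx | ⟨C, hC, hx⟩ | ⟨i, hx⟩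
    · exact hM.wf x (mem_roots_iff.2 (Or.inr (Or.inr hx)))
    · have := mwf_of_mem_disjunctionCut hC (by
        intro y hy
        obtain ⟨i, rfl⟩ := mem_cutPairs.1 hy
        refine ⟨(h.expansion_spec i).1.mwf, mwf_copyTree ?_ fun x hx =>
          h.eta_ne i (Multiset.mem_add.2 (Or.inr hx))⟩
        exact (h.leveled.preProof.cut_wf _ (Multiset.mem_cons_self _ _)).2.1.mwf)
      rcases hx with rfl | rfl
      · exact this.1
      · exact this.2
    · rw [roots_copy] at hx
      obtain ⟨y, hy, rfl⟩ := Multiset.mem_map.1 hx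
      refine mwf_copyTree (hM.wf y (mem_roots_iff.2 (Or.inr (Or.inr hy)))) fun x hx =>
        h.eta_ne i (Multiset.mem_add.2 (Or.inl ?_))
      rw [EV_eq_bind]
      exact Multiset.mem_bind.2 ⟨_, hy, hx⟩
  · intro B B' hB
    obtain ⟨C, hC, rfl, rfl⟩ := pos_mem_places.1 hB
    rcases mem_cuts_quantReduct.1 hC with hC | hC | ⟨i, hC⟩
    · exact h.leveled.preProof.cut_positive C (Multiset.mem_cons_of_mem hC)
    · refine positive_of_mem_disjunctionCut hC fun y hy => ?_
      obtain ⟨i, rfl⟩ := mem_cutPairs.1 hy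
      simp only
      rw [Sh_copyTree, NNF.positive_subst, h.E_Sh, (h.expansion_spec i).2,
        NNF.positive_inst _ (F.expansions.get i).1, ← NNF.dual_inst, NNF.positive_dual]
    · simp only [copy, subst, Multiset.map_map, Multiset.mem_map] at hC
      obtain ⟨C, hC', rfl⟩ := hC
      simpa using h.leveled.preProof.cut_positive C (Multiset.mem_cons_of_mem hC')
  · intro B hB
    exact hM.closed B ((h.tree_mem_places_reduct B).1 hB)

end QuantRedex

end RawProof

end ExpansionCut

/-! ### Merging copies back: duality of the new cut and decrease of the measure. -/

namespace ExpansionCut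

open FirstOrder FirstOrder.Language

variable {L : FirstOrder.Language.{u, v}}

theorem Place.subst_congr {σ τ : ℕ → L.Term ℕ} {A B : NNF L 0} (hAB : B.fv = A.fv)
    (h : ∀ x ∈ A.fv, σ x = τ x) :
    (Place.pos A B).subst σ = (Place.pos A B).subst τ ∧
      (Place.neg A B).subst σ = (Place.neg A B).subst τ := by
  simp only [Place.subst, A.subst_congr h, B.subst_congr (hAB ▸ h), and_self]

namespace RawProof

namespace QuantRedex

variable {F : ETree L} {A : NNF L 1} {a : ℕ} {E : ETree L} {cuts : Multiset (Cut L)}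
  {trees : Multiset (ETree L)} {η : Fin F.expansions.length → ℕ → ℕ} {lev : ℕ → ℕ} {K : ℕ}
  {Q : RawProof L} {ρ : ℕ → ℕ}

theorem mem_occs_reduct (h : QuantRedex F A a E cuts trees η lev K)
    (i : Fin F.expansions.length) {π : Place L} {p : Path L} {b : ℕ}
    (hb : (π, p, b) ∈ RawProof.occs ⟨cuts, trees⟩) :
    (π, p, b) ∈ (quantReduct ⟨cuts, trees⟩ F.expansions a E η).occs ∧
      (π.subst (copySubst a (F.expansions.get i).1 (η i)),
        Path.subst (copySubst a (F.expansions.get i).1 (η i)) p, η i b) ∈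
        (quantReduct ⟨cuts, trees⟩ F.expansions a E η).occs := by
  obtain ⟨G, hG, hp⟩ := hb
  refine ⟨⟨G, mem_roots_quantReduct.2 (Or.inl hG), hp⟩,
    ⟨copyTree a (F.expansions.get i).1 (η i) G, mem_roots_quantReduct.2 (Or.inr (Or.inr ⟨i, ?_⟩)),
      (has_copyTree fun x hx => h.eta_ne i (Multiset.mem_add.2 (Or.inl ?_))).2
        ⟨p, b, hp, rfl, rfl⟩⟩⟩
  · rw [roots_copy]
    exact Multiset.mem_map.2 ⟨_, hG, rfl⟩
  · rw [EV_eq_bind]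
    exact Multiset.mem_bind.2 ⟨_, hG, hx⟩

/-- Merging identifies the variables of low level with their copies. -/
theorem subst_copySubst (h : QuantRedex F A a E cuts trees η lev K)
    (hex : ∀ C ∈ cuts, ∃ B, C.1.Sh = NNF.ex B) (hQ : Q.Mergeable)
    (hn : ∀ Q', ¬ MergeStep Q Q')
    (hρ : Renames ρ (quantReduct ⟨cuts, trees⟩ F.expansions a E η) Q)
    (i : Fin F.expansions.length) {y : ℕ}
    (hyV : y ∈ vars ⟨(F, ETree.all A.dual a E) ::ₘ cuts, trees⟩) (hy : lev y < K) :
    (copySubst a (F.expansions.get i).1 (η i) y).subst (ren ρ) = ren ρ y := by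
  induction hm : lev y using Nat.strong_induction_on generalizing y with
  | _ m ih =>
    subst hm
    by_cases hyS : y ∈ (⟨cuts, trees⟩ : RawProof L).EV + E.EV
    · rw [h.copySubst_of_mem i hyS]
      -- The level of `y` is too low for an eigenvariable of the reduced cut, so `y` belongs to the
      -- context, of which original and copy are both present.
      have hyP : y ∈ (⟨cuts, trees⟩ : RawProof L).EV :=
        (Multiset.mem_add.1 hyS).resolve_right fun h' =>
          hy.not_ge (h.high y (Or.inr (Or.inr h')))
      obtain ⟨π, p, ho⟩ := RawProof.mem_EV_iff.1 hyP
      obtain ⟨h₁, h₂⟩ := h.mem_occs_reduct i ho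
      have h₁' := Set.mem_image_of_mem (occSubst (ren ρ)) h₁
      have h₂' := Set.mem_image_of_mem (occSubst (ren ρ)) h₂
      rw [← hρ.occs] at h₁' h₂'
      simp only [occSubst, Place.subst_subst, Path.subst_subst] at h₁' h₂'
      obtain ⟨G, hG, hp⟩ := ho
      simp only at hG hp
      have hfG := formula_of_mem_roots hG
      simp only at hfG
      -- The induction hypothesis applies to all variables on which `y` depends.
      have hlow : ∀ z ∈ π.formula.deps p,
          (copySubst a (F.expansions.get i).1 (η i) z).subst (ren ρ) = ren ρ z := by
        intro z hz
        have hlt : lev z < lev y :=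
          h.isLevel (π, p, y) ⟨G, mem_roots_iff.2 (Or.inr (Or.inr hG)), hp⟩ z hz
        rw [hfG] at hz
        exact ih _ hlt (roots_vars hG (hp.deps_subset hz)) (hlt.trans hy) rfl
      have hpath : Path.subst
          (fun x => (copySubst a (F.expansions.get i).1 (η i) x).subst (ren ρ)) p =
            Path.subst (ren ρ) p :=
        Path.subst_congr p fun z hz => hlow z (Or.inl hz)
      have hplace : π.subst
          (fun x => (copySubst a (F.expansions.get i).1 (η i) x).subst (ren ρ)) =
            π.subst (ren ρ) := by
        rcases mem_roots.1 hG with ⟨G', hG', hπ⟩ | ⟨C, hC, hπ⟩ | ⟨C, hC, hπ⟩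
        · obtain ⟨rfl, rfl⟩ := Prod.mk.inj hπ
          have := h.leveled.preProof.closed _ (Multiset.mem_map_of_mem _ hG')
          rw [Place.subst, Place.subst, NNF.subst_eq_self this, NNF.subst_eq_self this]
        · obtain ⟨rfl, rfl⟩ := Prod.mk.inj hπ
          have hd := h.leveled.preProof.cut_dual C (Multiset.mem_cons_of_mem hC)
          -- As the cut-formula is quantified, `y` depends on all its free variables. For a
          -- propositional cut-formula the dependencies need not cover the whole place.
          obtain ⟨B, hB⟩ := hex C hC
          refine (Place.subst_congr (by rw [hd, NNF.fv_dual]) fun z hz => hlow z (Or.inr ?_)).1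
          simpa [Place.formula, hB, NNF.top] using hz
        · obtain ⟨rfl, rfl⟩ := Prod.mk.inj hπ
          have hd := h.leveled.preProof.cut_dual C (Multiset.mem_cons_of_mem hC)
          obtain ⟨B, hB⟩ := hex C hC
          refine (Place.subst_congr (by rw [hd, NNF.fv_dual]) fun z hz => hlow z (Or.inr ?_)).2
          simpa [Place.formula, hd, hB, NNF.top, NNF.dual, NNF.fv] using hz
      rw [hpath, hplace] at h₂'
      -- Original and copy now have the same place and path, so the normal form cannot keep them
      -- apart.
      have heq := has_unique_of_normal hQ hn h₁' h₂'
      change Term.var (ρ (η i y)) = Term.var (ρ y)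
      exact congrArg Term.var heq.symm
    · have hya : y ≠ a := by
        rintro rfl
        exact hy.not_ge (h.high y (Or.inr (Or.inl rfl)))
      rw [h.copySubst_of_notMem i hyS hya]
      rfl

/-- In the new cut, the copies of `E` carry renamed free variables of `A`, and the `Eᵢ` do not.
These variables have levels below `K`, so `ρ` identifies them with their copies. -/
theorem dual_reduct (h : QuantRedex F A a E cuts trees η lev K)
    (hex : ∀ C ∈ cuts, ∃ B, C.1.Sh = NNF.ex B) (hQ : Q.Mergeable)
    (hn : ∀ Q', ¬ MergeStep Q Q')
    (hρ : Renames ρ (quantReduct ⟨cuts, trees⟩ F.expansions a E η) Q) {C : Cut L}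
    (hC : C ∈ (quantReduct ⟨cuts, trees⟩ F.expansions a E η).cuts) :
    C.2.Sh.subst (ren ρ) = (C.1.Sh.subst (ren ρ)).dual := by
  rcases mem_cuts_quantReduct.1 hC with hC | hC | ⟨i, hC⟩
  · rw [h.leveled.preProof.cut_dual C (Multiset.mem_cons_of_mem hC), NNF.dual_subst]
  · refine dual_of_mem_disjunctionCut hC fun x hx => ?_
    obtain ⟨i, rfl⟩ := mem_cutPairs.1 hx
    simp only
    have hA : A.dual.subst
        (fun x => (copySubst a (F.expansions.get i).1 (η i) x).subst (ren ρ)) =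
          A.dual.subst (ren ρ) := by
      refine NNF.subst_congr _ fun y hy => h.subst_copySubst hex hQ hn hρ i ?_ ?_
      · refine F_vars (ETree.fv_Sh_subset_vars ?_)
        rw [ETree.Sh_of_exBody h.body]
        simpa [NNF.fv] using hy
      · exact h.low y (by simpa using hy)
    rw [Sh_copyTree, h.E_Sh, NNF.subst_subst, NNF.subst_inst, hA, (h.expansion_spec i).2,
      NNF.subst_inst, NNF.dual_inst, NNF.dual_subst]
    simp only [Term.subst, h.copySubst_self]
  · simp only [copy, subst, Multiset.map_map, Multiset.mem_map] at hC
    obtain ⟨C, hC', rfl⟩ := hC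
    simp [h.leveled.preProof.cut_dual C (Multiset.mem_cons_of_mem hC'), NNF.dual_subst]

/-- By `hlow`, the free variables of the other cut-formulas of the same depth are among those
identified with their copies. These cuts therefore merge with their copies, while the reduced cut
disappears from the count. -/
theorem exists_progress (h : QuantRedex F A a E cuts trees η lev K)
    (hex : ∀ C ∈ cuts, ∃ B, C.1.Sh = NNF.ex B)
    (hlow : ∀ C ∈ cuts, C.1.Sh.qd = A.qd + 1 → ∀ y ∈ C.1.Sh.fv, lev y < K) :
    ∃ Q, Progress ⟨(F, ETree.all A.dual a E) ::ₘ cuts, trees⟩ Q ∧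
      (Q.cutFormulas.map (NNF.weight (A.qd + 1))).sum <
        ((cutFormulas ⟨(F, ETree.all A.dual a E) ::ₘ cuts, trees⟩).map
          (NNF.weight (A.qd + 1))).sum := by
  have hR := h.mergeable_reduct
  obtain ⟨Q, ρ, hQ, hQM, hρ⟩ := hR.exists_normalForm
  have hQL : Q.IsLeveled := hQM.normalForm_isLeveled hQ.2 hρ fun C hC =>
    h.dual_reduct hex hQM hQ.2 hρ hC
  have hpre := h.leveled.preProof
  have hFSh : F.Sh = NNF.ex A := ETree.Sh_of_exBody h.body
  have hD : ∀ C ∈ disjunctionCut (cutPairs F.expansions a E η), C.1.Sh.qd < A.qd + 1 := by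
    intro C hC
    refine qd_lt_of_mem_disjunctionCut hC fun x hx => ?_
    obtain ⟨i, rfl⟩ := mem_cutPairs.1 hx
    refine ⟨?_, ?_⟩
    · simp only
      rw [(h.expansion_spec i).2, NNF.qd_inst]
      exact Nat.lt_succ_self _
    · simp only
      rw [Sh_copyTree, NNF.qd_subst, h.E_Sh, NNF.qd_inst, NNF.qd_dual]
      exact Nat.lt_succ_self _
  refine ⟨Q, ⟨hQL, ?_, ⟨hpre, hQL.preProof, .quant _ A _ _ _ _ η _ h.body h.fresh hQ⟩, ?_⟩, ?_⟩
  · refine Sh_eq_of_places hpre hQL.preProof fun B => ?_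
    rw [hρ.tree_iff hR.closed, h.tree_mem_places_reduct]
  · intro r hr B hB
    simp only [cutFormulas, Multiset.map_cons, Multiset.mem_cons, forall_eq_or_imp, hFSh, NNF.qd]
      at hr
    obtain ⟨B, hB', rfl⟩ := hρ.mem_cutFormulas hB
    rw [NNF.qd_subst]
    obtain ⟨C, hC, rfl⟩ := Multiset.mem_map.1 hB'
    rcases mem_cuts_quantReduct.1 hC with hC | hC | ⟨i, hC⟩
    · exact hr.2 _ (Multiset.mem_map_of_mem _ hC)
    · exact (hD C hC).le.trans hr.1
    · simp only [copy, subst, Multiset.map_map, Multiset.mem_map] at hC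
      obtain ⟨C, hC', rfl⟩ := hC
      simpa using hr.2 _ (Multiset.mem_map_of_mem _ hC')
  -- The list `t` omits the reduced cut and all copies; its weight is smaller by the `1` contributed
  -- by `F.Sh`.
  · refine (sum_map_le_of_nodup (t := (cuts.map fun C => C.1.Sh).map (NNF.subst (ren ρ)))
      (NNF.weight (A.qd + 1)) hQL.preProof.cuts_distinct fun B hB hw => ?_).trans_lt ?_
    · obtain ⟨B, hB', rfl⟩ := hρ.mem_cutFormulas hB
      rw [NNF.weight_subst] at hw
      obtain ⟨C, hC, rfl⟩ := Multiset.mem_map.1 hB'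
      rcases mem_cuts_quantReduct.1 hC with hC | hC | ⟨i, hC⟩
      · exact Multiset.mem_map_of_mem _ (Multiset.mem_map_of_mem _ hC)
      · exact (hw (NNF.weight_eq_zero (hD C hC))).elim
      · simp only [copy, subst, Multiset.map_map, Multiset.mem_map] at hC
        obtain ⟨C, hC', rfl⟩ := hC
        simp only [Function.comp_apply, ETree.Sh_subst, NNF.weight_subst] at hw ⊢
        obtain ⟨B, hBC⟩ := hex C hC'
        have hqd : C.1.Sh.qd = A.qd + 1 := by
          rw [hBC] at hw ⊢
          simp only [NNF.weight, ne_eq, ite_eq_right_iff, one_ne_zero, imp_false, not_not] at hw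
          exact hw
        -- The copied cut-formula has the same image under `ρ` as its original.
        refine Multiset.mem_map.2 ⟨_, Multiset.mem_map_of_mem _ hC', ?_⟩
        rw [NNF.subst_subst, NNF.subst_subst]
        refine NNF.subst_congr _ fun y hy => ?_
        refine ((h.subst_copySubst hex hQM hQ.2 hρ i ?_ (hlow C hC' hqd y hy)).symm.trans ?_)
        · exact roots_vars (mem_roots.2 (Or.inr (Or.inl ⟨C, hC', rfl⟩)))
            (ETree.fv_Sh_subset_vars hy)
        · rfl
    · rw [Multiset.map_map, Multiset.map_map]
      simp [cutFormulas, hFSh, NNF.weight]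

end QuantRedex

/-! ### Choice of the redex and termination. -/

/-- A reduction step on a quantified cut-formula of maximal quantifier depth. -/
theorem exists_progress_quantified {P : RawProof L} (hP : P.IsLeveled)
    (hex : ∀ C ∈ P.cuts, ∃ B, C.1.Sh = NNF.ex B) {r : ℕ} {C₀ : Cut L} (hC₀ : C₀ ∈ P.cuts)
    (hr : C₀.1.Sh.qd = r) :
    ∃ Q, Progress P Q ∧ (Q.cutFormulas.map (NNF.weight r)).sum <
      (P.cutFormulas.map (NNF.weight r)).sum := by
  obtain ⟨lev, hlev⟩ := hP.level
  have hfin : {C | C ∈ P.cuts ∧ C.1.Sh.qd = r}.Finite :=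
    (Multiset.finite_toSet P.cuts).subset fun C hC => hC.1
  -- Maximality ensures that the bound `K` for this cut-formula also bounds the free variables of
  -- all other cut-formulas of depth `r`.
  obtain ⟨⟨F, G⟩, ⟨hC, hqd⟩, hmax⟩ := Set.exists_max_image _
    (fun C : Cut L => C.1.Sh.fv_finite.toFinset.sup fun y => lev y + 1) hfin ⟨C₀, hC₀, hr⟩
  obtain ⟨cuts, hcuts⟩ := Multiset.exists_cons_of_mem hC
  obtain ⟨_, trees⟩ := P
  simp only at hcuts hex hC hqd hmax
  subst hcuts
  obtain ⟨A, hA⟩ := hex _ hC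
  simp only at hA
  have hwf := hP.preProof.cut_wf _ hC
  have hd := hP.preProof.cut_dual _ hC
  simp only [hA, NNF.dual] at hwf hd
  obtain ⟨a, E, rfl⟩ := hwf.2.eq_all_of_Sh hd
  have hbody := hwf.1.exBody_of_Sh hA
  set K := F.Sh.fv_finite.toFinset.sup fun y => lev y + 1 with hK
  -- `K` is the least strict bound for the levels of the free variables of `A`, so it is at most the
  -- level of any eigenvariable depending on them all.
  have hKle : ∀ m, (∀ y ∈ A.fv, lev y < m) → K ≤ m := by
    intro m hm
    refine Finset.sup_le fun y hy => hm y ?_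
    simpa [hA, NNF.fv] using hy
  obtain ⟨η, hη⟩ := exists_freshRenamings F.expansions.length
    (S := {x | x ∈ (⟨cuts, trees⟩ : RawProof L).EV + E.EV})
    (vars_finite ⟨(F, ETree.all A.dual a E) ::ₘ cuts, trees⟩)
    fun x hx => QuantRedex.EV_subset_vars hx
  have hlt : ∀ C ∈ (F, ETree.all A.dual a E) ::ₘ cuts, C.1.Sh.qd = r →
      ∀ y ∈ C.1.Sh.fv, lev y < K := by
    intro C hC' hCr y hy
    refine lt_of_lt_of_le (Nat.lt_succ_self _) ((Finset.le_sup (f := fun y => lev y + 1)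
      (C.1.Sh.fv_finite.mem_toFinset.2 hy)).trans (hmax C ⟨hC', hCr⟩))
  have hredex : QuantRedex F A a E cuts trees η lev K := by
    refine ⟨hP, hlev, hbody, hη, ?_, ?_⟩
    · intro y hy
      refine hlt _ hC hqd y ?_
      simpa [hA, NNF.fv] using hy
    · rintro b (hb | rfl | hb)
      · obtain ⟨p, hp⟩ := ETree.mem_EV_iff.1 hb
        exact hKle _ fun y hy => QuantRedex.lev_of_has_F hlev hbody hp (Or.inr hy)
      · exact hKle _ fun y hy => QuantRedex.lev_lt_eigenvariable hlev hy
      · obtain ⟨p, hp⟩ := ETree.mem_EV_iff.1 hb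
        exact hKle _ fun y hy => QuantRedex.lev_of_has_E hlev hp (Or.inr hy)
  have hqd' : A.qd + 1 = r := by
    rw [← hqd, hA]
    rfl
  rw [← hqd']
  exact hredex.exists_progress (fun C hC => hex C (Multiset.mem_cons_of_mem hC))
    fun C hC hCr => hlt C (Multiset.mem_cons_of_mem hC) (hCr.trans hqd')

/-- Every levelled pre-proof reduces to a cut-free one. -/
theorem IsLeveled.exists_reduces_cutFree {P : RawProof L} (hP : P.IsLeveled) :
    ∃ Q, Q.IsLeveled ∧ Q.CutFree ∧ Q.Sh = P.Sh ∧ P.Reduces Q := by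
  obtain ⟨r, hr⟩ : ∃ r, ∀ A ∈ P.cutFormulas, A.qd ≤ r :=
    -- The sum serves as a crude upper bound for the maximum.
    ⟨(P.cutFormulas.map NNF.qd).sum, fun A hA =>
      Multiset.single_le_sum (fun _ _ => Nat.zero_le _) _ (Multiset.mem_map_of_mem _ hA)⟩
  induction r generalizing P with
  -- An existential cut-formula has depth at least `1`, so nothing remains after the propositional
  -- reductions.
  | zero =>
    obtain ⟨Q, h₁, h₂, h₃, h₄, -, h₆⟩ := exists_reduces_quantified hP
    refine ⟨Q, h₁, Multiset.eq_zero_of_forall_notMem fun C hC => ?_, h₂, h₃⟩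
    obtain ⟨A, hA⟩ := h₆ C hC
    have := h₄ 0 hr _ (Multiset.mem_map_of_mem _ hC)
    rw [hA] at this
    simp [NNF.qd] at this
  | succ r ihr =>
    induction hm : (P.cutFormulas.map (NNF.weight (r + 1))).sum using Nat.strong_induction_on
      generalizing P with
    | _ m ihm =>
      obtain ⟨Q, h₁, h₂, h₃, h₄, h₅, h₆⟩ := exists_reduces_quantified hP
      -- Either a cut of maximal depth remains and the inner measure drops, or the depth bound
      -- itself can be lowered.
      by_cases hq : ∃ C ∈ Q.cuts, C.1.Sh.qd = r + 1
      · obtain ⟨C, hC, hCr⟩ := hq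
        obtain ⟨Q', hQ', hlt⟩ := exists_progress_quantified h₁ h₆ hC hCr
        obtain ⟨Q'', h₁'', h₂'', h₃'', h₄''⟩ := ihm _
          (hm ▸ hlt.trans_le (h₅ (r + 1))) hQ'.leveled (hQ'.qd_le _ (h₄ _ hr)) rfl
        exact ⟨Q'', h₁'', h₂'', h₃''.trans (hQ'.Sh_eq.trans h₂),
          h₃.trans (h₄''.head hQ'.step)⟩
      · obtain ⟨Q', h₁', h₂', h₃', h₄'⟩ := ihr h₁ fun A hA => by
          obtain ⟨C, hC, rfl⟩ := Multiset.mem_map.1 hA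
          exact Nat.le_of_lt_succ (lt_of_le_of_ne (h₄ _ hr _ hA) fun h' => hq ⟨C, hC, h'⟩)
        exact ⟨Q', h₁', h₂', h₃'.trans h₂, h₃.trans h₄'⟩

end RawProof

end ExpansionCut

namespace ExpansionCut

open FirstOrder FirstOrder.Language

variable {L : FirstOrder.Language.{u, v}}

namespace ETree

/-! ## Positions and paths -/

/-- The variables in the terms of the `∃`-expansion at a position and of the `∃`-expansions that
dominate it. -/
def termVars : ETree L → List Bool → Finset ℕ
  | exp _ t _, [] => t.varFinset
  | and E _, false :: p => E.termVars p
  | and _ F, true :: p => F.termVars p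
  | or E _, false :: p => E.termVars p
  | or _ F, true :: p => F.termVars p
  | exp F _ _, false :: p => F.termVars p
  | exp _ t E, true :: p => t.varFinset ∪ E.termVars p
  | all _ _ E, true :: p => E.termVars p
  | merge E _, false :: p => E.termVars p
  | merge _ F, true :: p => F.termVars p
  | _, _ => ∅

/-- The dependency relation speaks of positions, levels speak of paths. This and the next lemma
translate between them: both see the same terms above a `∀`-expansion. -/
theorem has_of_sub {E : ETree L} {p : List Bool} {A : NNF L 1} {a : ℕ} {G : ETree L}
    (h : E.sub p = some (all A a G)) : ∃ π, E.Has π a ∧ Path.vars π = E.termVars p := by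
  induction E generalizing p with
  | lit | ex => rcases p with _ | ⟨_ | _, p⟩ <;> simp [sub] at h
  | and E F ihE ihF | or E F ihE ihF =>
    rcases p with _ | ⟨_ | _, p⟩
    · simp [sub] at h
    · obtain ⟨π, hπ, hv⟩ := ihE h
      exact ⟨Step.left :: π, Or.inl ⟨π, rfl, hπ⟩, by simp [Path.vars, Step.vars, termVars, hv]⟩
    · obtain ⟨π, hπ, hv⟩ := ihF h
      exact ⟨Step.right :: π, Or.inr ⟨π, rfl, hπ⟩, by simp [Path.vars, Step.vars, termVars, hv]⟩
  | exp F t E ihF ihE =>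
    rcases p with _ | ⟨_ | _, p⟩
    · simp [sub] at h
    · obtain ⟨π, hπ, hv⟩ := ihF h
      exact ⟨π, Or.inl hπ, hv⟩
    · obtain ⟨π, hπ, hv⟩ := ihE h
      exact ⟨Step.ex t :: π, Or.inr ⟨π, rfl, hπ⟩, by simp [Path.vars, Step.vars, termVars, hv]⟩
  | all B b E ih =>
    rcases p with _ | ⟨_ | _, p⟩
    · simp only [sub, Option.some.injEq, all.injEq] at h
      exact ⟨[], Or.inl ⟨rfl, h.2.1.symm⟩, rfl⟩
    · simp [sub] at h
    · obtain ⟨π, hπ, hv⟩ := ih h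
      exact ⟨Step.all :: π, Or.inr ⟨π, rfl, hπ⟩, by simp [Path.vars, Step.vars, termVars, hv]⟩
  | merge E F ihE ihF =>
    rcases p with _ | ⟨_ | _, p⟩
    · simp [sub] at h
    · obtain ⟨π, hπ, hv⟩ := ihE h
      exact ⟨π, Or.inl hπ, hv⟩
    · obtain ⟨π, hπ, hv⟩ := ihF h
      exact ⟨π, Or.inr hπ, hv⟩

theorem Has.exists_sub {E : ETree L} {π : Path L} {a : ℕ} (h : E.Has π a) :
    ∃ p, (∃ A G, E.sub p = some (all A a G)) ∧ Path.vars π = E.termVars p := by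
  induction E generalizing π with
  | lit | ex => exact h.elim
  | and E F ihE ihF | or E F ihE ihF =>
    rcases h with ⟨π, rfl, h⟩ | ⟨π, rfl, h⟩
    · obtain ⟨p, hp, hv⟩ := ihE h
      exact ⟨false :: p, hp, by simp [Path.vars, Step.vars, termVars, hv]⟩
    · obtain ⟨p, hp, hv⟩ := ihF h
      exact ⟨true :: p, hp, by simp [Path.vars, Step.vars, termVars, hv]⟩
  | exp F t E ihF ihE =>
    rcases h with h | ⟨π, rfl, h⟩
    · obtain ⟨p, hp, hv⟩ := ihF h
      exact ⟨false :: p, hp, hv⟩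
    · obtain ⟨p, hp, hv⟩ := ihE h
      exact ⟨true :: p, hp, by simp [Path.vars, Step.vars, termVars, hv]⟩
  | all B b E ih =>
    rcases h with ⟨rfl, rfl⟩ | ⟨π, rfl, h⟩
    · exact ⟨[], ⟨B, E, rfl⟩, rfl⟩
    · obtain ⟨p, hp, hv⟩ := ih h
      exact ⟨true :: p, hp, by simp [Path.vars, Step.vars, termVars, hv]⟩
  | merge E F ihE ihF =>
    rcases h with h | h
    · obtain ⟨p, hp, hv⟩ := ihE h
      exact ⟨false :: p, hp, hv⟩
    · obtain ⟨p, hp, hv⟩ := ihF h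
      exact ⟨true :: p, hp, hv⟩

theorem exists_sub_of_mem_termVars {E : ETree L} {p : List Bool} {y : ℕ}
    (h : y ∈ E.termVars p) :
    ∃ q t, (∃ F G, E.sub q = some (exp F t G)) ∧ y ∈ t.varFinset ∧
      (p = q ∨ ∃ q', p = q ++ true :: q') := by
  -- The claim for an immediate component passes to the whole tree, by prefixing the direction `b`
  -- to both positions.
  have lift : ∀ {D G : ETree L} {b : Bool} {p : List Bool},
      (∀ q, D.sub (b :: q) = G.sub q) →
      (∃ q t, (∃ F G', G.sub q = some (exp F t G')) ∧ y ∈ t.varFinset ∧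
        (p = q ∨ ∃ q', p = q ++ true :: q')) →
      ∃ q t, (∃ F G', D.sub q = some (exp F t G')) ∧ y ∈ t.varFinset ∧
        (b :: p = q ∨ ∃ q', b :: p = q ++ true :: q') := by
    rintro D G b p hD ⟨q, t, hq, hy, h⟩
    refine ⟨b :: q, t, by rwa [hD], hy, ?_⟩
    simpa using h
  induction E generalizing p with
  | lit | ex => rcases p with _ | ⟨_ | _, p⟩ <;> simp [termVars] at h
  | and E F ihE ihF | or E F ihE ihF | merge E F ihE ihF =>
    rcases p with _ | ⟨_ | _, p⟩
    · simp [termVars] at h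
    · exact lift (fun _ => rfl) (ihE h)
    · exact lift (fun _ => rfl) (ihF h)
  | exp F t E ihF ihE =>
    rcases p with _ | ⟨_ | _, p⟩
    · exact ⟨[], t, ⟨F, E, rfl⟩, h, Or.inl rfl⟩
    · exact lift (fun _ => rfl) (ihF h)
    · rcases Finset.mem_union.1 h with h | h
      · exact ⟨[], t, ⟨F, E, rfl⟩, h, Or.inr ⟨p, rfl⟩⟩
      · exact lift (fun _ => rfl) (ihE h)
  | all B b E ih =>
    rcases p with _ | ⟨_ | _, p⟩
    · simp [termVars] at h
    · simp [termVars] at h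
    · exact lift (fun _ => rfl) (ih h)

theorem subset_termVars {E F G : ETree L} {p : List Bool} {t : L.Term ℕ}
    (h : E.sub p = some (exp F t G)) : t.varFinset ⊆ E.termVars p := by
  induction E generalizing p with
  | lit | ex => rcases p with _ | ⟨_ | _, p⟩ <;> simp [sub] at h
  | and E F ihE ihF | or E F ihE ihF | merge E F ihE ihF =>
    rcases p with _ | ⟨_ | _, p⟩
    · simp [sub] at h
    · exact ihE h
    · exact ihF h
  | exp F t E ihF ihE =>
    rcases p with _ | ⟨_ | _, p⟩
    · simp only [sub, Option.some.injEq, exp.injEq] at h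
      rw [← h.2.1]
      exact subset_rfl
    · exact ihF h
    · exact (ihE h).trans Finset.subset_union_right
  | all B b E ih =>
    rcases p with _ | ⟨_ | _, p⟩
    · simp [sub] at h
    · simp [sub] at h
    · exact ih h

theorem termVars_subset_append (E : ETree L) (p q : List Bool) :
    E.termVars p ⊆ E.termVars (p ++ true :: q) := by
  induction E generalizing p with
  | lit | ex => rcases p with _ | ⟨_ | _, p⟩ <;> simp [termVars]
  | and E F ihE ihF | or E F ihE ihF | merge E F ihE ihF =>
    rcases p with _ | ⟨_ | _, p⟩
    · simp [termVars]
    · exact ihE p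
    · exact ihF p
  | exp F t E ihF ihE =>
    rcases p with _ | ⟨_ | _, p⟩
    · exact Finset.subset_union_left
    · exact ihF p
    · exact Finset.union_subset_union_right (ihE p)
  | all B b E ih =>
    rcases p with _ | ⟨_ | _, p⟩
    · simp [termVars]
    · simp [termVars]
    · exact ih p

theorem finite_positions (E : ETree L) : {p | E.sub p ≠ none}.Finite := by
  have key : ∀ {D G H : ETree L}, {p | G.sub p ≠ none}.Finite → {p | H.sub p ≠ none}.Finite →
      (∀ p, D.sub (false :: p) ≠ none → G.sub p ≠ none) →
      (∀ p, D.sub (true :: p) ≠ none → H.sub p ≠ none) → {p | D.sub p ≠ none}.Finite := by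
    intro D G H hG hH h₁ h₂
    refine (((hG.image (List.cons false)).union (hH.image (List.cons true))).insert []).subset ?_
    rintro (_ | ⟨_ | _, p⟩) hp
    · exact Or.inl rfl
    · exact Or.inr (Or.inl ⟨p, h₁ p hp, rfl⟩)
    · exact Or.inr (Or.inr ⟨p, h₂ p hp, rfl⟩)
  induction E with
  | lit | ex =>
    refine (Set.finite_singleton []).subset ?_
    rintro (_ | ⟨_ | _, p⟩) hp
    · rfl
    · exact (hp rfl).elim
    · exact (hp rfl).elim
  | and E F ihE ihF | or E F ihE ihF | merge E F ihE ihF =>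
    exact key ihE ihF (fun _ h => h) fun _ h => h
  | exp F t E ihF ihE => exact key ihF ihE (fun _ h => h) fun _ h => h
  | all B b E ih => exact key ih ih (fun _ h => (h rfl).elim) fun _ h => h

end ETree

/-! ### Acyclicity and levels. -/

namespace RawProof

variable {P : RawProof L}

theorem ExpansionAt.sub_ne_none {r : Root L} {p : List Bool} (h : P.ExpansionAt r p) :
    r.In P ∧ r.content.sub p ≠ none := by
  rcases h with ⟨a, hr, A, E, h⟩ | ⟨t, hr, F, E, h⟩ <;> simp [hr, h]

/-- The cuts and the positions of a collection. -/
def positions (P : RawProof L) : Set (Node L) :=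
  Node.cut '' {C | C ∈ P.cuts} ∪
    ⋃ r ∈ {r : Root L | r.In P}, Node.expansion r '' {p | r.content.sub p ≠ none}

theorem expansion_mem_positions {r : Root L} {p : List Bool} (h : P.ExpansionAt r p) :
    Node.expansion r p ∈ P.positions := by
  obtain ⟨hr, hp⟩ := h.sub_ne_none
  exact Or.inr (Set.mem_biUnion (show r ∈ {r : Root L | r.In P} from hr) ⟨p, hp, rfl⟩)

theorem finite_positions (P : RawProof L) : P.positions.Finite := by
  have hc : {C | C ∈ P.cuts}.Finite := Multiset.finite_toSet P.cuts
  have ht : {E | E ∈ P.trees}.Finite := Multiset.finite_toSet P.trees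
  refine (hc.image _).union (Set.Finite.biUnion ?_ fun r _ => r.content.finite_positions.image _)
  refine ((ht.image Root.tree).union ((hc.image Root.pos).union (hc.image Root.neg))).subset ?_
  rintro (E | C | C) h
  · exact Or.inl ⟨E, h, rfl⟩
  · exact Or.inr (Or.inl ⟨C, h, rfl⟩)
  · exact Or.inr (Or.inr ⟨C, h, rfl⟩)

theorem Lt.mem_positions {x y : Node L} (h : P.Lt x y) : x ∈ P.positions := by
  obtain ⟨z, hz, -⟩ := Relation.TransGen.head'_iff.1 h
  cases hz with
  | term k => exact expansion_mem_positions (Or.inl ⟨_, k⟩)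
  | dominates k => exact expansion_mem_positions k
  | in_pos k => exact Or.inl ⟨_, k, rfl⟩
  | in_neg k => exact Or.inl ⟨_, k, rfl⟩
  | cut_formula k => exact expansion_mem_positions (Or.inl ⟨_, k⟩)

/-- The `∀`-expansions with a given eigenvariable together with everything on which they
depend. -/
def lowerNodes (P : RawProof L) (y : ℕ) : Set (Node L) :=
  {z | ∃ r p, P.AllAt r p y ∧ (z = Node.expansion r p ∨ P.Lt z (Node.expansion r p))}

theorem finite_lowerNodes (P : RawProof L) (y : ℕ) : (P.lowerNodes y).Finite := by
  refine P.finite_positions.subset ?_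
  rintro z ⟨r, p, h, rfl | hz⟩
  · exact expansion_mem_positions (Or.inl ⟨y, h⟩)
  · exact hz.mem_positions

/-- By acyclicity, the node of `a` itself is not below that of `y`. If `y` is no eigenvariable, then
`h` is vacuous and the smaller set is empty. -/
theorem lowerNodes_ssubset (hP : ∀ x, ¬ P.Lt x x) {s : Root L} {q : List Bool} {a y : ℕ}
    (ha : P.AllAt s q a)
    (h : ∀ r p, P.AllAt r p y → P.Lt (Node.expansion r p) (Node.expansion s q)) :
    P.lowerNodes y ⊂ P.lowerNodes a := by
  refine (Set.ssubset_iff_of_subset ?_).2 ⟨Node.expansion s q, ⟨s, q, ha, Or.inl rfl⟩, ?_⟩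
  · rintro z ⟨r, p, hy, rfl | hz⟩
    · exact ⟨s, q, ha, Or.inr (h r p hy)⟩
    · exact ⟨s, q, ha, Or.inr (Relation.TransGen.trans hz (h r p hy))⟩
  · rintro ⟨r, p, hy, hz | hz⟩
    · exact hP _ (hz ▸ h r p hy)
    · exact hP _ (Relation.TransGen.trans hz (h r p hy))

theorem lt_of_mem_termVars {s : Root L} {q : List Bool} {a y : ℕ} (ha : P.AllAt s q a)
    (hy : y ∈ s.content.termVars q) {r : Root L} {p : List Bool} (h : P.AllAt r p y) :
    P.Lt (Node.expansion r p) (Node.expansion s q) := by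
  obtain ⟨q₀, t, hq₀, hyt, rfl | ⟨q', rfl⟩⟩ := ETree.exists_sub_of_mem_termVars hy
  · exact .single (.term h ⟨ha.1, hq₀⟩ hyt)
  · exact .tail (.single (.term h ⟨ha.1, hq₀⟩ hyt))
      (.dominates (Or.inr ⟨t, ha.1, hq₀⟩) (Or.inl ⟨a, ha⟩))

/-- The level of a variable is the number of nodes at or below its `∀`-expansions. A dependency
through a term is one of the dependency relation; a dependency through the shallow formula passes
through the cut, and there is none in the end-sequent, whose formulas are closed. -/
theorem IsProof.isLeveled (hP : P.IsProof) : P.IsLeveled := by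
  refine ⟨hP.preProof, ⟨fun y => (P.lowerNodes y).ncard, ?_⟩, hP.tautology⟩
  rintro ⟨π, p, a⟩ ⟨E, hE, hp⟩ y hy
  refine Set.ncard_lt_ncard ?_ (P.finite_lowerNodes a)
  simp only at hE hp hy
  obtain ⟨q, hq, hv⟩ := hp.exists_sub
  have hfv : y ∈ Path.vars p ∨ y ∈ E.Sh.fv := by
    have := formula_of_mem_roots hE
    simp only at this
    rw [this] at hy
    exact hy.imp_right fun h => NNF.fv_top_subset _ _ h
  rw [hv] at hfv
  rcases mem_roots.1 hE with ⟨E, hE', h⟩ | ⟨C, hC, h⟩ | ⟨C, hC, h⟩ <;>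
    obtain ⟨rfl, rfl⟩ := Prod.mk.inj h
  · have ha : P.AllAt (Root.tree E) q a := ⟨hE', hq⟩
    rw [hP.preProof.closed _ (Multiset.mem_map_of_mem _ hE')] at hfv
    exact lowerNodes_ssubset hP.acyclic ha fun _ _ =>
      lt_of_mem_termVars ha (hfv.resolve_right id)
  · have ha : P.AllAt (Root.pos C) q a := ⟨hC, hq⟩
    exact lowerNodes_ssubset hP.acyclic ha fun r p h => hfv.elim
      (fun hy => lt_of_mem_termVars ha hy h)
      fun hy => .tail (.single (.cut_formula h hC hy)) (.in_pos hC (Or.inl ⟨a, ha⟩))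
  · have ha : P.AllAt (Root.neg C) q a := ⟨hC, hq⟩
    rw [hP.preProof.cut_dual C hC, NNF.fv_dual] at hfv
    exact lowerNodes_ssubset hP.acyclic ha fun r p h => hfv.elim
      (fun hy => lt_of_mem_termVars ha hy h)
      fun hy => .tail (.single (.cut_formula h hC hy)) (.in_neg hC (Or.inl ⟨a, ha⟩))

/-- A rank of the expansions that increases along the dependency relation of a cut-free proof. -/
def rank (lev : ℕ → ℕ) : Node L → ℕ ×ₗ ℕ
  | Node.cut _ => toLex (0, 0)
  | Node.expansion r p =>
      toLex ((r.content.termVars p).sup fun y => lev y + 1, p.length)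

/-- Without cuts, the dependency relation is generated by eigenvariables in terms and by dominance
alone, and `rank` increases strictly along both. -/
theorem IsLeveled.isProof (hP : P.IsLeveled) (hc : P.CutFree) : P.IsProof := by
  obtain ⟨lev, hlev⟩ := hP.level
  have hcut : ∀ C, C ∉ P.cuts := fun C h => by
    rw [hc] at h
    exact Multiset.notMem_zero C h
  have hstep : ∀ x y, P.Lt0 x y → rank lev x < rank lev y := by
    intro x y h
    cases h with
    | @term r p a s q t h₁ h₂ ha =>
      obtain ⟨hr, A, G, h₁⟩ := h₁
      obtain ⟨-, F, G', h₂⟩ := h₂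
      -- The level of `a` separates the two ranks: it strictly exceeds the levels of all term
      -- variables above the `∀`-expansion, and `a` itself contributes `lev a + 1` to the rank of
      -- the `∃`-expansion.
      refine Prod.Lex.toLex_lt_toLex.2 (Or.inl (lt_of_le_of_lt (b := lev a) ?_ ?_))
      · obtain ⟨π, hπ, hv⟩ := ETree.has_of_sub h₁
        rcases r with E | C | C
        · refine Finset.sup_le fun y hy => hlev (Place.tree E.Sh, π, a)
            ⟨E, mem_roots.2 (Or.inl ⟨E, hr, rfl⟩), hπ⟩ y (Or.inl ?_)
          exact hv ▸ hy
        · exact (hcut C hr).elim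
        · exact (hcut C hr).elim
      · exact Finset.le_sup (f := fun y => lev y + 1) (ETree.subset_termVars h₂ ha)
    | @dominates r p q h₁ h₂ =>
      -- Descending may leave the first component unchanged; then the length of the position
      -- decides.
      have hle := Finset.sup_mono (f := fun y => lev y + 1)
        (r.content.termVars_subset_append p q)
      rcases hle.lt_or_eq with h | h
      · exact Prod.Lex.toLex_lt_toLex.2 (Or.inl h)
      · exact Prod.Lex.toLex_lt_toLex.2 (Or.inr ⟨h, by simp⟩)
    | in_pos h => exact (hcut _ h).elim
    | in_neg h => exact (hcut _ h).elim
    | cut_formula _ h => exact (hcut _ h).elim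
  have hlt : ∀ x y, P.Lt x y → rank lev x < rank lev y := by
    intro x y h
    induction h with
    | single h => exact hstep _ _ h
    | tail _ h ih => exact ih.trans (hstep _ _ h)
  exact ⟨hP.preProof, fun x h => (hlt x x h).false, hP.tautology⟩

end RawProof

end ExpansionCut

open ExpansionCut in
/-- Weak normalization of cut reduction for expansion proofs with cuts. -/
theorem theorem32 {L : FirstOrder.Language.{u, v}} (P : RawProof L) (hP : P.IsProof) :
    ∃ Q : RawProof L, Q.IsProof ∧ Q.CutFree ∧ Q.Sh = P.Sh ∧ P.Reduces Q := by
  obtain ⟨Q, hQ, hc, hS, hR⟩ := hP.isLeveled.exists_reduces_cutFree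
  exact ⟨Q, hQ.isProof hc, hc, hS, hR⟩
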